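/- There is a randomized algorithm with the following property. For all real numbers $c \ge 1$ and $d \ge 2$ there are constants $C_1, C_2$ and $w$, depending only on $c$ and $d$, such that the following holds. Let $\mathcal{S} = (U, \mathcal{F})$ be a finite set system ($\mathcal{F}$ a set of subsets of the finite set $U$) whose primal and dual shatter functions satisfy $\pi_{\mathcal{F}}(k) \le c \cdot k^d$ and $\pi^*_{\mathcal{F}}(k) \le c \cdot k^d$ for all integers $k \ge 1$. Here $\pi_{\mathcal{F}}(k) = \max_{A \subseteq U, |A| \le k} |\{X \cap A : X \in \mathcal{F}\}|$, and $\pi^*_{\mathcal{F}}$ is the shatter function of the dual set system $(\mathcal{F}, \{\{X \in \mathcal{F} : u \in X\} : u \in U\})$. Let $\|S\| = |U| + \sum_{X \in \mathcal{F}} |X|$. On input $\mathcal{S}$, $c$ and $d$ (with $\mathcal{S}$ given by the lists of elements of its sets, where $U = \{0, \dots, |U|-1\}$, and with $c$ and $d$ rounded up to multiples of $1/(\|S\|+1)$), the algorithm runs in time $\mathcal{O}(\|S\| \log \|S\|)$, namely it halts within $C_1 (\|S\| \log \|S\| + 1)$ steps for every outcome of its random choices (where $0\log 0=0$), and, with probability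 at least $2/3$, its output is a total order on $U$ with crossing number at most $$C_2 \cdot |U|^{1 - \frac{1}{d^2}} \cdot \log^2 |U|.$$ Here $\log$ is the base-2 logarithm, and the crossing number of a total order on $U$ is the maximum over all $X \in \mathcal{F}$ of the number of pairs $(u, u')$ that are adjacent in the order and of which exactly one element belongs to $X$; it is $0$ if $\mathcal{F}$ is empty. Time is the number of steps of a random access machine with unit-cost arithmetic, indirect addressing and uniform random choice from $\{0, \dots, x\}$, whose registers and memory cells hold natural numbers that never exceed $(\|S\|+2)^w$, that is, have $\mathcal{O}(\log \|S\|)$ bits; its memory holds the input and is $0$ elsewhere at the start. If $U = \emptyset$, the bound on the crossing number is read as $0$. -/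

import Mathlib

namespace Welzl

/-! ### Finite set systems, shatter functions, crossing numbers -/

/-- A finite set system `(U, F)`: a finite ground set and a family of (distinct) subsets of it. -/
structure SetSystem (α : Type*) where
  ground : Finset α
  family : Finset (Finset α)
  subset_ground : ∀ X ∈ family, X ⊆ ground

namespace SetSystem

variable {α : Type*} [DecidableEq α]

/-- The dual set system: its ground set is `F`, and its sets are
`{X ∈ F | u ∈ X}` for the elements `u` of `U`. -/
def dual (S : SetSystem α) : SetSystem (Finset α) where
  ground := S.family
  family := S.ground.image fun u => S.family.filter fun X => u ∈ X
  subset_ground := by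
    intro Y hY
    obtain ⟨u, -, rfl⟩ := Finset.mem_image.mp hY
    exact Finset.filter_subset _ _

/-- The shatter function: the maximum of `|{X ∩ A : X ∈ F}|` over `A ⊆ U` with `|A| ≤ k`. -/
def shatter (S : SetSystem α) (k : ℕ) : ℕ :=
  (S.ground.powerset.filter fun A => A.card ≤ k).sup fun A => (S.family.image fun X => X ∩ A).card

/-- The size `‖S‖ = |U| + ∑_{X ∈ F} |X|`. -/
def size (S : SetSystem α) : ℕ :=
  S.ground.card + ∑ X ∈ S.family, X.card

/-- A total order on `U`, written as the list of the elements of `U` in increasing order. -/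
def IsOrder (S : SetSystem α) (l : List α) : Prop :=
  l.Nodup ∧ l.toFinset = S.ground

/-- The number of adjacent pairs of `l` that are crossed by `X`: exactly one of the two elements
belongs to `X`. -/
def crossings (l : List α) (X : Finset α) : ℕ :=
  (l.zip l.tail).countP fun p => decide (p.1 ∈ X) != decide (p.2 ∈ X)

/-- The crossing number of an order: the maximum number of crossings with a set of `F`. -/
def crossingNumber (S : SetSystem α) (l : List α) : ℕ :=
  S.family.sup (crossings l)

end SetSystem

/-! ### A randomized random access machine

Registers and memory cells hold natural numbers. Programs are built from the usual unit-cost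
instructions by composition, branching and loops. -/

/-- The arithmetic operations; `sub` is truncated subtraction, and `x / 0 = 0`. -/
inductive BinOp
  | add
  | sub
  | mul
  | div

/-- The value of an arithmetic operation. -/
def BinOp.eval : BinOp → ℕ → ℕ → ℕ
  | .add, x, y => x + y
  | .sub, x, y => x - y
  | .mul, x, y => x * y
  | .div, x, y => x / y

/-- Programs. Here `R` stands for the registers and `M` for the memory.
* `const r v` : `R[r] := v`
* `op o r s t` : `R[r] := R[s] o R[t]`
* `load r s` : `R[r] := M[R[s]]`
* `store r s` : `M[R[r]] := R[s]`
* `rand r s` : `R[r] :=` a fresh uniformly random element of `{0, …, R[s]}`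
* `seq a b` : first `a`, then `b`
* `ite r a b` : `a` if `R[r] ≠ 0`, and `b` otherwise
* `loop r a` : repeat `a` as long as `R[r] ≠ 0` -/
inductive Cmd
  | const (r v : ℕ)
  | op (o : BinOp) (r s t : ℕ)
  | load (r s : ℕ)
  | store (r s : ℕ)
  | rand (r s : ℕ)
  | seq (a b : Cmd)
  | ite (r : ℕ) (a b : Cmd)
  | loop (r : ℕ) (a : Cmd)

/-- The contents of the registers and of the memory. -/
structure Store where
  reg : ℕ → ℕ
  mem : ℕ → ℕ

/-- Overwrite a register. -/
def Store.setReg (σ : Store) (r v : ℕ) : Store :=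
  { σ with reg := Function.update σ.reg r v }

/-- Overwrite a memory cell. -/
def Store.setMem (σ : Store) (a v : ℕ) : Store :=
  { σ with mem := Function.update σ.mem a v }

/-- A configuration: the programs that are still to be executed, in this order, and the store. -/
structure Config where
  todo : List Cmd
  store : Store

/-- The machine has halted when nothing is left to be executed. -/
def Config.Halted (x : Config) : Prop := x.todo = []

/-- One step of the machine, as a distribution over the next configuration. -/
noncomputable def step : Config → PMF Config
  | ⟨[], σ⟩ => PMF.pure ⟨[], σ⟩
  | ⟨.const r v :: k, σ⟩ => PMF.pure ⟨k, σ.setReg r v⟩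
  | ⟨.op o r s t :: k, σ⟩ => PMF.pure ⟨k, σ.setReg r (o.eval (σ.reg s) (σ.reg t))⟩
  | ⟨.load r s :: k, σ⟩ => PMF.pure ⟨k, σ.setReg r (σ.mem (σ.reg s))⟩
  | ⟨.store r s :: k, σ⟩ => PMF.pure ⟨k, σ.setMem (σ.reg r) (σ.reg s)⟩
  | ⟨.rand r s :: k, σ⟩ =>
      (PMF.uniformOfFintype (Fin (σ.reg s + 1))).map fun i => ⟨k, σ.setReg r i.val⟩
  | ⟨.seq a b :: k, σ⟩ => PMF.pure ⟨a :: b :: k, σ⟩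
  | ⟨.ite r a b :: k, σ⟩ => PMF.pure ⟨(if σ.reg r = 0 then b else a) :: k, σ⟩
  | ⟨.loop r a :: k, σ⟩ => PMF.pure ⟨if σ.reg r = 0 then k else a :: .loop r a :: k, σ⟩

/-- The distribution of the configuration after `t` steps. -/
noncomputable def run : ℕ → Config → PMF Config
  | 0, x => PMF.pure x
  | t + 1, x => (step x).bind (run t)

/-- The initial configuration: all registers are `0`, and the memory holds the input from
address `0` on, followed by zeros. -/
def start (P : Cmd) (input : List ℕ) : Config :=
  ⟨[P], ⟨fun _ => 0, fun i => input.getD i 0⟩⟩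

/-- The output of length `n`: the memory block that starts at the address in register `0`. -/
def Store.output (σ : Store) (n : ℕ) : List ℕ :=
  (List.range n).map fun i => σ.mem (σ.reg 0 + i)

/-! ### The input format -/

/-- `rows` is a listing of the set system `S` on `{0, …, n - 1}`: every set of the family is listed
exactly once, as a list of its elements without repetition, in any order. -/
def IsListing (rows : List (List ℕ)) (n : ℕ) (S : SetSystem ℕ) : Prop :=
  S.ground = Finset.range n ∧
  (∀ r ∈ rows, r.Nodup) ∧
  (rows.map List.toFinset).Nodup ∧
  (rows.map List.toFinset).toFinset = S.family

/-- The canonical input. A real parameter `x` is handed over as the fixed-point number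
`⌈x q⌉ / q` of precision `1 / q`. The header `|U|, |F|, q, ⌈c q⌉, ⌈d q⌉` is followed by the sets,
each as its number of elements and then its elements. -/
noncomputable def encode (c d : ℝ) (q n : ℕ) (rows : List (List ℕ)) : List ℕ :=
  [n, rows.length, q, ⌈c * q⌉₊, ⌈d * q⌉₊] ++ rows.flatMap fun r => r.length :: r

end Welzl

namespace Welzl

/-! ### Reasoning about runs of the machine -/

/-! The order is the linearisation of one cycle on `{0, …, n - 1}`. At first every element is a
cycle of length one; the algorithm keeps a list `C` with one representative per cycle and merges
cycles by exchanging the successors of two representatives. By the triangle inequality this creates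
at most two new crossings with a set, and none unless the set separates the two (`cr_swapVal`).

A round works as follows. Let `k = |C|` and `L = ⌊log k⌋`. About `k ^ (1 / d ^ 2)` representatives
are drawn at random, the exact number being `2 ^ j` with `j ≤ (L - K) / d ^ 2` for a constant `K`.
One set is kept for each trace on the sample; by the primal bound there are at most `c 2 ^ (jd)` of
them. The elements are then classified by the kept sets that contain them; by the dual bound there
are at most `c (c 2 ^ (jd)) ^ d` classes, and `K` is chosen so that this is at most `k / 2`
(`two_mul_le_two_pow`). Pairing representatives within classes therefore removes a quarter of them
(`Outcome.four_mul_le`), and `O(log n)` rounds leave a bounded number of cycles, which are merged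
arbitrarily.

For the crossings, let `X` be a set and `Y` the kept set with the same trace. Paired representatives
agree on `Y`, so `X` separates them only if one of the two lies in the symmetric difference of `X`
and `Y`. That difference avoids the sample. A union bound over pairs of sets shows that, up to a
small probability, every difference that avoids the sample contains at most `θ` representatives,
with `θ` of order `log n` times `n ^ (1 - 1 / d ^ 2)` (`avg_not_good_le`, `le_mul_two_pow`). A round
then adds at most `2 θ` crossings per set (`GoodSample.cr_le`), and the rounds contribute the second
logarithm.

Traces and classes are found by partition refinement on linked lists of incidences, so a round takes
time linear in `‖S‖`. Labels are never reused, hence no table has to be cleared. The shrinking of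
`C` and the running time hold for all random outcomes; only the crossing bound is probabilistic.

The machine is handled in layers. `Ok` bundles the bound on numbers, halting and failure
probability. Deterministic parts are written in the language `H`, whose compilation is proved
correct once (`okS_compile`), and are verified with the Hoare-style rules for `W`. Only the random
draws and the main loop are treated as machine programs (`okS_draws`, `okS_mainLoop`).
`ok_welzlProgram` assembles the program, and `ok_start` supplies the estimates. -/

/-- All registers and memory cells are at most `B`. -/
def Store.Bounded (B : ℕ) (σ : Store) : Prop := ∀ i, σ.reg i ≤ B ∧ σ.mem i ≤ B

/-- Every configuration reached from `x` is bounded by `B`, all runs halt within `T` steps, and the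
final store is outside of `E` with probability at most `p`. -/
structure Ok (B : ℕ) (E : Set Store) (T : ℕ) (x : Config) (p : ENNReal) : Prop where
  bounded : ∀ t, ∀ y ∈ (run t x).support, y.store.Bounded B
  halted : ∀ y ∈ (run T x).support, y.Halted
  fail : (run T x).toOuterMeasure {y | y.store ∉ E} ≤ p

variable {B : ℕ} {E : Set Store} {T T' : ℕ} {p p' : ENNReal} {σ : Store} {k : List Cmd}

lemma Store.Bounded.setReg (h : σ.Bounded B) {r v : ℕ} (hv : v ≤ B) :
    (σ.setReg r v).Bounded B := by
  intro i
  refine ⟨?_, (h i).2⟩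
  simp only [Store.setReg, Function.update_apply]
  split_ifs
  · exact hv
  · exact (h i).1

lemma Store.Bounded.setMem (h : σ.Bounded B) {r v : ℕ} (hv : v ≤ B) :
    (σ.setMem r v).Bounded B := by
  intro i
  refine ⟨(h i).1, ?_⟩
  simp only [Store.setMem, Function.update_apply]
  split_ifs
  · exact hv
  · exact (h i).2

lemma run_halted (t : ℕ) (σ : Store) : run t ⟨[], σ⟩ = PMF.pure ⟨[], σ⟩ := by
  induction t with
  | zero => rfl
  | succ t ih => simp [run, step, PMF.pure_bind, ih]

lemma run_add (s t : ℕ) (x : Config) : run (s + t) x = (run s x).bind (run t) := by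
  induction s generalizing x with
  | zero => simp [run]
  | succ s ih =>
    rw [Nat.succ_add]
    simp only [run, PMF.bind_bind]
    congr 1
    funext y
    exact ih y

lemma pmf_bind_congr {α β : Type*} (q : PMF α) (f g : α → PMF β)
    (h : ∀ a ∈ q.support, f a = g a) : q.bind f = q.bind g := by
  ext b
  simp only [PMF.bind_apply]
  refine tsum_congr fun a => ?_
  by_cases ha : a ∈ q.support
  · rw [h a ha]
  · rw [(PMF.apply_eq_zero_iff q a).2 ha]; simp

lemma run_add_of_halted {x : Config} (h : ∀ y ∈ (run T x).support, y.Halted) (t : ℕ) :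
    run (T + t) x = run T x := by
  rw [run_add]
  conv_rhs => rw [← PMF.bind_pure (run T x)]
  refine pmf_bind_congr _ _ _ fun y hy => ?_
  obtain ⟨l, σ⟩ := y
  have : l = [] := h _ hy
  subst this
  exact run_halted t σ

lemma Ok.mono {x : Config} (h : Ok B E T x p) (hT : T ≤ T') (hp : p ≤ p') : Ok B E T' x p' := by
  obtain ⟨t, rfl⟩ := Nat.exists_eq_add_of_le hT
  have := run_add_of_halted h.halted t
  exact ⟨h.bounded, by rw [this]; exact h.halted, by rw [this]; exact h.fail.trans hp⟩

lemma Ok.trivial_fail {x : Config} (h : Ok B E T x p) : Ok B E T x 1 := by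
  refine ⟨h.bounded, h.halted, ?_⟩
  calc (run T x).toOuterMeasure {y | y.store ∉ E}
      ≤ (run T x).toOuterMeasure Set.univ := MeasureTheory.measure_mono (Set.subset_univ _)
    _ = 1 := ((run T x).toOuterMeasure_apply_eq_one_iff Set.univ).2 (Set.subset_univ _)

lemma Ok.of_halted (hσ : σ.Bounded B) (h : σ ∈ E) : Ok B E T ⟨[], σ⟩ 0 := by
  refine ⟨fun t y hy => ?_, fun y hy => ?_, ?_⟩
  · rw [run_halted] at hy
    rw [(PMF.mem_support_pure_iff _ _).1 hy]; exact hσ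
  · rw [run_halted] at hy
    rw [(PMF.mem_support_pure_iff _ _).1 hy]; rfl
  · rw [run_halted, PMF.toOuterMeasure_pure_apply]
    simp [h]

lemma Ok.of_halted_one (hσ : σ.Bounded B) : Ok B E T ⟨[], σ⟩ 1 := by
  refine ⟨fun t y hy => ?_, fun y hy => ?_, ?_⟩
  · rw [run_halted] at hy
    rw [(PMF.mem_support_pure_iff _ _).1 hy]; exact hσ
  · rw [run_halted] at hy
    rw [(PMF.mem_support_pure_iff _ _).1 hy]; rfl
  · rw [run_halted, PMF.toOuterMeasure_pure_apply]
    split_ifs <;> simp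

lemma Ok.step {x y : Config} (hx : x.store.Bounded B) (hs : step x = PMF.pure y)
    (h : Ok B E T y p) : Ok B E (T + 1) x p := by
  have hr : ∀ t, run (t + 1) x = run t y := fun t => by simp [run, hs]
  refine ⟨fun t z hz => ?_, by rw [hr]; exact h.halted, by rw [hr]; exact h.fail⟩
  cases t with
  | zero => rw [(PMF.mem_support_pure_iff _ _).1 hz]; exact hx
  | succ t => rw [hr] at hz; exact h.bounded t z hz

lemma Ok.const {r v : ℕ} (hσ : σ.Bounded B) (hv : v ≤ B)
    (h : (σ.setReg r v).Bounded B → Ok B E T ⟨k, σ.setReg r v⟩ p) :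
    Ok B E (T + 1) ⟨.const r v :: k, σ⟩ p :=
  Ok.step hσ rfl (h (hσ.setReg hv))

lemma Ok.op {o : BinOp} {r s t : ℕ} (hσ : σ.Bounded B) (hv : o.eval (σ.reg s) (σ.reg t) ≤ B)
    (h : (σ.setReg r (o.eval (σ.reg s) (σ.reg t))).Bounded B →
      Ok B E T ⟨k, σ.setReg r (o.eval (σ.reg s) (σ.reg t))⟩ p) :
    Ok B E (T + 1) ⟨.op o r s t :: k, σ⟩ p :=
  Ok.step hσ rfl (h (hσ.setReg hv))

lemma Ok.load {r s : ℕ} (hσ : σ.Bounded B)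
    (h : (σ.setReg r (σ.mem (σ.reg s))).Bounded B →
      Ok B E T ⟨k, σ.setReg r (σ.mem (σ.reg s))⟩ p) :
    Ok B E (T + 1) ⟨.load r s :: k, σ⟩ p :=
  Ok.step hσ rfl (h (hσ.setReg (hσ _).2))

lemma Ok.store {r s : ℕ} (hσ : σ.Bounded B)
    (h : (σ.setMem (σ.reg r) (σ.reg s)).Bounded B →
      Ok B E T ⟨k, σ.setMem (σ.reg r) (σ.reg s)⟩ p) :
    Ok B E (T + 1) ⟨.store r s :: k, σ⟩ p :=
  Ok.step hσ rfl (h (hσ.setMem (hσ _).1))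

lemma Ok.seq {a b : Cmd} (hσ : σ.Bounded B) (h : Ok B E T ⟨a :: b :: k, σ⟩ p) :
    Ok B E (T + 1) ⟨.seq a b :: k, σ⟩ p :=
  Ok.step hσ rfl h

lemma Ok.ite {r : ℕ} {a b : Cmd} (hσ : σ.Bounded B)
    (h : Ok B E T ⟨(if σ.reg r = 0 then b else a) :: k, σ⟩ p) :
    Ok B E (T + 1) ⟨.ite r a b :: k, σ⟩ p :=
  Ok.step hσ rfl h

lemma Ok.loop_zero {r : ℕ} {a : Cmd} (hσ : σ.Bounded B) (hr : σ.reg r = 0)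
    (h : Ok B E T ⟨k, σ⟩ p) : Ok B E (T + 1) ⟨.loop r a :: k, σ⟩ p :=
  Ok.step hσ (by simp [Welzl.step, hr]) h

lemma Ok.loop_pos {r : ℕ} {a : Cmd} (hσ : σ.Bounded B) (hr : σ.reg r ≠ 0)
    (h : Ok B E T ⟨a :: .loop r a :: k, σ⟩ p) : Ok B E (T + 1) ⟨.loop r a :: k, σ⟩ p :=
  Ok.step hσ (by simp [Welzl.step, hr]) h

/-- The only rule in which probabilities mix: failure bounds may depend on the outcome and are
averaged, while the bound on numbers and halting are required for every outcome. -/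
lemma Ok.rand {r s : ℕ} (hσ : σ.Bounded B) (P : ℕ → ENNReal)
    (h : ∀ i, i ≤ σ.reg s → (σ.setReg r i).Bounded B → Ok B E T ⟨k, σ.setReg r i⟩ (P i)) :
    Ok B E (T + 1) ⟨.rand r s :: k, σ⟩
      (∑ i ∈ Finset.range (σ.reg s + 1), ((σ.reg s + 1 : ℕ) : ENNReal)⁻¹ * P i) := by
  have hb : ∀ i, i ≤ σ.reg s → (σ.setReg r i).Bounded B := fun i hi =>
    hσ.setReg (hi.trans (hσ s).1)
  have hr : ∀ t, run (t + 1) ⟨.rand r s :: k, σ⟩ =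
      (PMF.uniformOfFintype (Fin (σ.reg s + 1))).bind fun i => run t ⟨k, σ.setReg r i.val⟩ := by
    intro t
    simp only [run, Welzl.step, PMF.bind_map]
    rfl
  refine ⟨fun t z hz => ?_, fun z hz => ?_, ?_⟩
  · cases t with
    | zero => rw [(PMF.mem_support_pure_iff _ _).1 hz]; exact hσ
    | succ t =>
      rw [hr, PMF.mem_support_bind_iff] at hz
      obtain ⟨i, -, hi⟩ := hz
      have hi' : i.val ≤ σ.reg s := by have := i.isLt; omega
      exact (h i.val hi' (hb _ hi')).bounded t z hi
  · rw [hr, PMF.mem_support_bind_iff] at hz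
    obtain ⟨i, -, hi⟩ := hz
    have hi' : i.val ≤ σ.reg s := by have := i.isLt; omega
    exact (h i.val hi' (hb _ hi')).halted z hi
  · rw [hr, PMF.toOuterMeasure_bind_apply, tsum_fintype, Finset.sum_range]
    refine Finset.sum_le_sum fun i _ => ?_
    have hi' : i.val ≤ σ.reg s := by have := i.isLt; omega
    rw [PMF.uniformOfFintype_apply, Fintype.card_fin]
    gcongr
    exact (h i.val hi' (hb _ hi')).fail

end Welzl

namespace Welzl

/-! ### A language with variables and arrays

Variables are numbered by `ℕ`, arrays are numbered by `0, …, 15` and are infinite. Only loops whose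
number of iterations is fixed when they are entered are available. -/

/-- Contents of the variables, of the arrays and of the input-output area. -/
structure St where
  v : ℕ → ℕ
  a : ℕ → ℕ → ℕ
  io : ℕ → ℕ

/-- Deterministic programs.
* `inc x` : `x := x + 1`
* `mov x y` : `x := y`
* `cst x n` : `x := n`
* `opr o x y z` : `x := y o z`
* `ld x k y` : `x := A_k[y]`
* `st k x y` : `A_k[x] := y`
* `ldi x y` : `x := M[y]`, in the input-output area
* `sti x y` : `M[x] := y`, in the input-output area
* `seq a c` : first `a`, then `c`
* `ite x a c` : `a` if `x ≠ 0`, otherwise `c`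
* `rep x a` : `x` times `a`, where `x` is counted down -/
inductive H
  | inc (x : ℕ)
  | mov (x y : ℕ)
  | cst (x n : ℕ)
  | opr (o : BinOp) (x y z : ℕ)
  | ld (x k y : ℕ)
  | st (k x y : ℕ)
  | ldi (x y : ℕ)
  | sti (x y : ℕ)
  | seq (a c : H)
  | ite (x : ℕ) (a c : H)
  | rep (x : ℕ) (a : H)

/-- Assignment of a variable. -/
def St.set (s : St) (x n : ℕ) : St := { s with v := Function.update s.v x n }

/-- Assignment of an array entry. -/
def St.put (s : St) (k i n : ℕ) : St :=
  { s with a := Function.update s.a k (Function.update (s.a k) i n) }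

/-- Assignment in the input-output area. -/
def St.puti (s : St) (i n : ℕ) : St := { s with io := Function.update s.io i n }

/-- The state after the execution of a program. -/
def ev : H → St → St
  | .inc x, s => s.set x (s.v x + 1)
  | .mov x y, s => s.set x (s.v y)
  | .cst x n, s => s.set x n
  | .opr o x y z, s => s.set x (o.eval (s.v y) (s.v z))
  | .ld x k y, s => s.set x (s.a k (s.v y))
  | .st k x y, s => s.put k (s.v x) (s.v y)
  | .ldi x y, s => s.set x (s.io (s.v y))
  | .sti x y, s => s.puti (s.v x) (s.v y)
  | .seq a c, s => ev c (ev a s)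
  | .ite x a c, s => if s.v x = 0 then ev c s else ev a s
  | .rep x a, s => (fun t => (ev a t).set x ((ev a t).v x - 1))^[s.v x] s

/-- One iteration of a `rep` loop. -/
def iter (x : ℕ) (a : H) (t : St) : St := (ev a t).set x ((ev a t).v x - 1)

lemma ev_rep (x : ℕ) (a : H) (s : St) : ev (.rep x a) s = (iter x a)^[s.v x] s := rfl

/-- The number of machine steps of a program. -/
def cost : H → St → ℕ
  | .inc _, _ => 5
  | .mov _ _, _ => 1
  | .cst _ _, _ => 1
  | .opr _ _ _ _, _ => 1
  | .ld _ _ _, _ => 15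
  | .st _ _ _, _ => 15
  | .ldi _ _, _ => 1
  | .sti _ _, _ => 1
  | .seq a c, s => cost a s + cost c (ev a s) + 1
  | .ite x a c, s => (if s.v x = 0 then cost c s else cost a s) + 1
  | .rep x a, s => (∑ j ∈ Finset.range (s.v x), (cost a ((iter x a)^[j] s) + 7)) + 1

/-- Sums, products and constants are at most `B₀`, and accesses to the input-output area are below
`b`. -/
def Saf (B₀ b : ℕ) : H → St → Prop
  | .inc _, _ => True
  | .mov _ _, _ => True
  | .cst _ n, _ => n ≤ B₀
  | .opr .add _ y z, s => s.v y + s.v z ≤ B₀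
  | .opr .mul _ y z, s => s.v y * s.v z ≤ B₀
  | .opr _ _ _ _, _ => True
  | .ld _ _ _, _ => True
  | .st _ _ _, _ => True
  | .ldi _ y, s => s.v y < b
  | .sti x _, s => s.v x < b
  | .seq a c, s => Saf B₀ b a s ∧ Saf B₀ b c (ev a s)
  | .ite x a c, s => if s.v x = 0 then Saf B₀ b c s else Saf B₀ b a s
  | .rep x a, s => ∀ j < s.v x, Saf B₀ b a ((iter x a)^[j] s)

/-- `x` is not assigned. -/
def H.fixesVar (x : ℕ) : H → Bool
  | .inc y => y != x
  | .mov y _ => y != x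
  | .cst y _ => y != x
  | .opr _ y _ _ => y != x
  | .ld y _ _ => y != x
  | .st _ _ _ => true
  | .ldi y _ => y != x
  | .sti _ _ => true
  | .seq a c => a.fixesVar x && c.fixesVar x
  | .ite _ a c => a.fixesVar x && c.fixesVar x
  | .rep y a => y != x && a.fixesVar x

/-- The array `k` is not assigned. -/
def H.fixesArr (k : ℕ) : H → Bool
  | .st l _ _ => l != k
  | .seq a c => a.fixesArr k && c.fixesArr k
  | .ite _ a c => a.fixesArr k && c.fixesArr k
  | .rep _ a => a.fixesArr k
  | _ => true

/-- The input-output area is not assigned. -/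
def H.fixesBuffer : H → Bool
  | .sti _ _ => false
  | .seq a c => a.fixesBuffer && c.fixesBuffer
  | .ite _ a c => a.fixesBuffer && c.fixesBuffer
  | .rep _ a => a.fixesBuffer
  | _ => true

/-- Loop counters are not assigned by the loop bodies, and array numbers are below `16`. -/
def H.wf : H → Bool
  | .ld _ k _ => decide (k < 16)
  | .st k _ _ => decide (k < 16)
  | .seq a c => a.wf && c.wf
  | .ite _ a c => a.wf && c.wf
  | .rep x a => a.fixesVar x && a.wf
  | _ => true

@[simp] lemma St.set_v (s : St) (x n : ℕ) : (s.set x n).v = Function.update s.v x n := rfl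
@[simp] lemma St.set_a (s : St) (x n : ℕ) : (s.set x n).a = s.a := rfl
@[simp] lemma St.set_io (s : St) (x n : ℕ) : (s.set x n).io = s.io := rfl
@[simp] lemma St.put_v (s : St) (k i n : ℕ) : (s.put k i n).v = s.v := rfl
@[simp] lemma St.put_a (s : St) (k i n : ℕ) :
    (s.put k i n).a = Function.update s.a k (Function.update (s.a k) i n) := rfl
@[simp] lemma St.put_io (s : St) (k i n : ℕ) : (s.put k i n).io = s.io := rfl
@[simp] lemma St.puti_v (s : St) (i n : ℕ) : (s.puti i n).v = s.v := rfl
@[simp] lemma St.puti_a (s : St) (i n : ℕ) : (s.puti i n).a = s.a := rfl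
@[simp] lemma St.puti_io (s : St) (i n : ℕ) :
    (s.puti i n).io = Function.update s.io i n := rfl

lemma iterate_invariant {α β : Type*} (f : α → α) (g : α → β) (h : ∀ s, g (f s) = g s) (n : ℕ)
    (s : α) : g (f^[n] s) = g s := by
  induction n generalizing s with
  | zero => rfl
  | succ n ih => rw [Function.iterate_succ_apply, ih, h]

lemma ev_fixesVar {x : ℕ} : ∀ {h : H}, h.fixesVar x = true → ∀ s, (ev h s).v x = s.v x := by
  intro h
  induction h with
  | seq a c iha ihc =>
    intro hx s
    simp only [H.fixesVar, Bool.and_eq_true] at hx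
    simp [ev, iha hx.1, ihc hx.2]
  | ite y a c iha ihc =>
    intro hx s
    simp only [H.fixesVar, Bool.and_eq_true] at hx
    simp only [ev]
    split_ifs
    · exact ihc hx.2 s
    · exact iha hx.1 s
  | rep y a ih =>
    intro hx s
    simp only [H.fixesVar, Bool.and_eq_true, bne_iff_ne, ne_eq] at hx
    rw [ev_rep]
    refine iterate_invariant (iter y a) (fun s => s.v x) (fun s => ?_) _ _
    simp [iter, Ne.symm hx.1, ih hx.2]
  | _ =>
    intro hx s
    simp only [H.fixesVar, bne_iff_ne, ne_eq] at hx
    first | simp [ev, Ne.symm hx] | simp [ev]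

lemma ev_fixesArr {k : ℕ} : ∀ {h : H}, h.fixesArr k = true → ∀ s, (ev h s).a k = s.a k := by
  intro h
  induction h with
  | seq a c iha ihc =>
    intro hx s
    simp only [H.fixesArr, Bool.and_eq_true] at hx
    simp [ev, iha hx.1, ihc hx.2]
  | ite y a c iha ihc =>
    intro hx s
    simp only [H.fixesArr, Bool.and_eq_true] at hx
    simp only [ev]
    split_ifs
    · exact ihc hx.2 s
    · exact iha hx.1 s
  | rep y a ih =>
    intro hx s
    rw [ev_rep]
    refine iterate_invariant (iter y a) (fun s => s.a k) (fun s => ?_) _ _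
    simp [iter, ih hx]
  | st l x y =>
    intro hx s
    simp only [H.fixesArr, bne_iff_ne, ne_eq] at hx
    simp [ev, Ne.symm hx]
  | _ =>
    intro hx s
    simp [ev]

lemma ev_fixesBuffer : ∀ {h : H}, h.fixesBuffer = true → ∀ s, (ev h s).io = s.io := by
  intro h
  induction h with
  | seq a c iha ihc =>
    intro hx s
    simp only [H.fixesBuffer, Bool.and_eq_true] at hx
    simp [ev, iha hx.1, ihc hx.2]
  | ite y a c iha ihc =>
    intro hx s
    simp only [H.fixesBuffer, Bool.and_eq_true] at hx
    simp only [ev]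
    split_ifs
    · exact ihc hx.2 s
    · exact iha hx.1 s
  | rep y a ih =>
    intro hx s
    rw [ev_rep]
    refine iterate_invariant (iter y a) (fun s => s.io) (fun s => ?_) _ _
    simp [iter, ih hx]
  | sti x y => intro hx s; simp [H.fixesBuffer] at hx
  | _ =>
    intro hx s
    simp [ev]

/-! ### Compilation -/

/-- The machine program of a program. -/
def H.compile : H → Cmd
  | .inc x => .seq (.const 1 1) (.seq (.op .add (x + 4) (x + 4) 1) (.const 1 0))
  | .mov x y => .op .add (x + 4) (y + 4) 0
  | .cst x n => .const (x + 4) n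
  | .opr o x y z => .op o (x + 4) (y + 4) (z + 4)
  | .ld x k y =>
      .seq (.const 1 16) (.seq (.op .mul 1 1 (y + 4)) (.seq (.op .add 1 1 3) (.seq (.const 2 k)
        (.seq (.op .add 1 1 2) (.seq (.load (x + 4) 1) (.seq (.const 1 0) (.const 2 0)))))))
  | .st k x y =>
      .seq (.const 1 16) (.seq (.op .mul 1 1 (x + 4)) (.seq (.op .add 1 1 3) (.seq (.const 2 k)
        (.seq (.op .add 1 1 2) (.seq (.store 1 (y + 4)) (.seq (.const 1 0) (.const 2 0)))))))
  | .ldi x y => .load (x + 4) (y + 4)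
  | .sti x y => .store (x + 4) (y + 4)
  | .seq a c => .seq a.compile c.compile
  | .ite x a c => .ite (x + 4) a.compile c.compile
  | .rep x a =>
      .loop (x + 4) (.seq a.compile
        (.seq (.const 1 1) (.seq (.op .sub (x + 4) (x + 4) 1) (.const 1 0))))

/-- The registers of the machine: `0`, `1`, `2` hold `0`, and `3` holds the start of the arrays. -/
def concReg (b : ℕ) (v : ℕ → ℕ) : ℕ → ℕ
  | 0 => 0
  | 1 => 0
  | 2 => 0
  | 3 => b
  | r + 4 => v r

/-- The machine store that represents a state. -/
def conc (b : ℕ) (s : St) : Store where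
  reg := concReg b s.v
  mem x := if x < b then s.io x else s.a ((x - b) % 16) ((x - b) / 16)

/-- All variables and array entries are at most `M`. -/
def St.Bd (M : ℕ) (s : St) : Prop :=
  (∀ i, s.v i ≤ M) ∧ (∀ k i, s.a k i ≤ M) ∧ ∀ i, s.io i ≤ M

lemma St.Bd.mono {M M' : ℕ} {s : St} (h : s.Bd M) (hM : M ≤ M') : s.Bd M' :=
  ⟨fun i => (h.1 i).trans hM, fun k i => (h.2.1 k i).trans hM, fun i => (h.2.2 i).trans hM⟩

lemma St.Bd.set {M : ℕ} {s : St} (h : s.Bd M) {x n : ℕ} (hn : n ≤ M) : (s.set x n).Bd M := by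
  refine ⟨fun i => ?_, h.2.1, h.2.2⟩
  simp only [St.set_v, Function.update_apply]
  split_ifs
  · exact hn
  · exact h.1 i

lemma St.Bd.put {M : ℕ} {s : St} (h : s.Bd M) {k i n : ℕ} (hn : n ≤ M) : (s.put k i n).Bd M := by
  refine ⟨h.1, fun l j => ?_, h.2.2⟩
  simp only [St.put_a, Function.update_apply]
  split_ifs
  · rw [Function.update_apply]
    split_ifs
    · exact hn
    · exact h.2.1 _ _
  · exact h.2.1 l j

lemma St.Bd.puti {M : ℕ} {s : St} (h : s.Bd M) {i n : ℕ} (hn : n ≤ M) : (s.puti i n).Bd M := by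
  refine ⟨h.1, h.2.1, fun j => ?_⟩
  simp only [St.puti_io, Function.update_apply]
  split_ifs
  · exact hn
  · exact h.2.2 j

lemma St.Bd.conc {M b B : ℕ} {s : St} (h : s.Bd M) (hM : M ≤ B) (hb : b ≤ B) :
    (conc b s).Bounded B := by
  intro i
  constructor
  · match i with
    | 0 => exact Nat.zero_le _
    | 1 => exact Nat.zero_le _
    | 2 => exact Nat.zero_le _
    | 3 => exact hb
    | r + 4 => exact (h.1 r).trans hM
  · simp only [Welzl.conc]
    split_ifs
    · exact (h.2.2 i).trans hM
    · exact (h.2.1 _ _).trans hM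

lemma conc_setReg (b : ℕ) (s : St) (x n : ℕ) :
    (conc b s).setReg (x + 4) n = conc b (s.set x n) := by
  simp only [conc, Store.setReg, Store.mk.injEq]
  refine ⟨funext fun r => ?_, rfl⟩
  match r with
  | 0 => simp [concReg]
  | 1 => simp [concReg]
  | 2 => simp [concReg]
  | 3 => simp [concReg]
  | r + 4 => simp [concReg, Function.update_apply]

lemma conc_setMem (b : ℕ) (s : St) {k i : ℕ} (hk : k < 16) (n : ℕ) :
    (conc b s).setMem (16 * i + b + k) n = conc b (s.put k i n) := by
  simp only [conc, Store.setMem, Store.mk.injEq]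
  refine ⟨rfl, funext fun x => ?_⟩
  by_cases hx : x < b
  · have : x ≠ 16 * i + b + k := by omega
    simp [hx, this]
  · simp only [Function.update_apply, hx, if_false, St.put_a]
    by_cases h : x = 16 * i + b + k
    · have h1 : (x - b) % 16 = k := by omega
      have h2 : (x - b) / 16 = i := by omega
      rw [if_pos h, h1, h2]; simp
    · rw [if_neg h]
      split_ifs with h1
      · rw [Function.update_apply, if_neg (by omega), h1]
      · rfl

lemma conc_setMem_io (b : ℕ) (s : St) {i : ℕ} (hi : i < b) (n : ℕ) :
    (conc b s).setMem i n = conc b (s.puti i n) := by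
  simp only [conc, Store.setMem, Store.mk.injEq]
  refine ⟨rfl, funext fun x => ?_⟩
  simp only [Function.update_apply, St.puti_io]
  by_cases h : x = i
  · simp [h, hi]
  · simp [h]

lemma conc_mem (b : ℕ) (s : St) {k i : ℕ} (hk : k < 16) :
    (conc b s).mem (16 * i + b + k) = s.a k i := by
  have h1 : (16 * i + b + k - b) % 16 = k := by omega
  have h2 : (16 * i + b + k - b) / 16 = i := by omega
  have h3 : ¬ 16 * i + b + k < b := by omega
  simp only [conc, h1, h2, h3, if_false]

lemma Store.ext_of {σ τ : Store} (h : σ.reg = τ.reg) (h' : σ.mem = τ.mem) : σ = τ := by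
  cases σ; cases τ; simp_all

/-- Lets a scratch register that holds `0` between instructions be used and cleared without trace,
so that the store again has the form `conc`. -/
lemma setReg_restore (σ : Store) {r : ℕ} (h : σ.reg r = 0) (x n m : ℕ) (hx : x ≠ r) :
    ((σ.setReg r m).setReg x n).setReg r 0 = σ.setReg x n := by
  refine Store.ext_of (funext fun i => ?_) rfl
  simp only [Store.setReg, Function.update_apply]
  split_ifs <;> simp_all

/-- The parameters of an execution: values of sums, products and constants are at most `B₀`,
the arrays start at `b`, there are at most `tmax` steps. -/
structure Par where
  B₀ : ℕ
  b : ℕ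
  tmax : ℕ

/-- A bound for all values and addresses. -/
def Par.B (π : Par) : ℕ := 16 * (π.B₀ + π.tmax) + π.b + 16

/-- If at most `π.tmax - T` steps have been made, then the run from `s` with the programs `k`
satisfies `Ok` for `T` steps. -/
def OkS (π : Par) (E : Set Store) (T : ℕ) (s : St) (k : List Cmd) (p : ENNReal) : Prop :=
  T ≤ π.tmax → s.Bd (π.B₀ + (π.tmax - T)) → Ok π.B E T ⟨k, conc π.b s⟩ p

variable {π : Par} {E : Set Store} {T : ℕ} {p : ENNReal} {k : List Cmd} {s : St}

lemma OkS.bounded (h : s.Bd (π.B₀ + (π.tmax - T))) : (conc π.b s).Bounded π.B :=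
  h.conc (by unfold Par.B; omega) (by unfold Par.B; omega)

/-- Shared by increments and by the decrement of loop counters. Since `OkS` allows values up to `B₀`
plus the number of steps already made, an increment pays for its growth with its own running time
and needs no safety condition. -/
lemma okS_one {x : ℕ} {o : BinOp} (ho : o.eval (s.v x) 1 ≤ s.v x + 1)
    (h : OkS π E T (s.set x (o.eval (s.v x) 1)) k p) :
    OkS π E (T + 5) s (.seq (.const 1 1) (.seq (.op o (x + 4) (x + 4) 1) (.const 1 0)) :: k)
      p := by
  intro hT hs
  have hB : 1 ≤ π.B := by unfold Par.B; omega
  have hx := hs.1 x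
  have e : o.eval (((conc π.b s).setReg 1 1).reg (x + 4)) (((conc π.b s).setReg 1 1).reg 1) =
      o.eval (s.v x) 1 := by
    simp [Store.setReg, conc, concReg]
  refine Ok.seq (OkS.bounded hs) (Ok.const (OkS.bounded hs) hB fun h1 => Ok.seq h1 ?_)
  refine Ok.op h1 (by rw [e]; unfold Par.B; omega) ?_
  rw [e]
  refine fun h2 => Ok.const h2 (Nat.zero_le _) fun h3 => ?_
  rw [setReg_restore _ rfl _ _ _ (by omega), conc_setReg]
  exact h (by omega) ((hs.mono (by omega)).set (by omega))

/-- Address computation. -/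
lemma okS_address {y n : ℕ} {c : Cmd} (hn : n < 16)
    (hy : T ≤ π.tmax → s.Bd (π.B₀ + (π.tmax - T)) →
      (((conc π.b s).setReg 1 (16 * s.v y + π.b + n)).setReg 2 n).Bounded π.B →
      Ok π.B E T ⟨c :: k, ((conc π.b s).setReg 1 (16 * s.v y + π.b + n)).setReg 2 n⟩ p) :
    OkS π E (T + 10) s (.seq (.const 1 16) (.seq (.op .mul 1 1 (y + 4)) (.seq (.op .add 1 1 3)
      (.seq (.const 2 n) (.seq (.op .add 1 1 2) c)))) :: k) p := by
  intro hT hs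
  have hB : 16 ≤ π.B := by unfold Par.B; omega
  have hx := hs.1 y
  refine Ok.seq (OkS.bounded hs) (Ok.const (OkS.bounded hs) hB fun h1 => Ok.seq h1 ?_)
  have e1 : BinOp.mul.eval (((conc π.b s).setReg 1 16).reg 1)
      (((conc π.b s).setReg 1 16).reg (y + 4)) = 16 * s.v y := by
    simp [BinOp.eval, Store.setReg, conc, concReg]
  refine Ok.op h1 (by rw [e1]; unfold Par.B; omega) ?_
  rw [e1]
  have e2 : ((conc π.b s).setReg 1 16).setReg 1 (16 * s.v y) =
      (conc π.b s).setReg 1 (16 * s.v y) := by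
    simp [Store.setReg]
  rw [e2]
  refine fun h2 => Ok.seq h2 ?_
  have e3 : BinOp.add.eval (((conc π.b s).setReg 1 (16 * s.v y)).reg 1)
      (((conc π.b s).setReg 1 (16 * s.v y)).reg 3) = 16 * s.v y + π.b := by
    simp [BinOp.eval, Store.setReg, conc, concReg]
  refine Ok.op h2 (by rw [e3]; unfold Par.B; omega) ?_
  rw [e3]
  have e4 : ((conc π.b s).setReg 1 (16 * s.v y)).setReg 1 (16 * s.v y + π.b) =
      (conc π.b s).setReg 1 (16 * s.v y + π.b) := by
    simp [Store.setReg]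
  rw [e4]
  refine fun h3 => Ok.seq h3 (Ok.const h3 (by omega) fun h4 => Ok.seq h4 ?_)
  have e5 : BinOp.add.eval ((((conc π.b s).setReg 1 (16 * s.v y + π.b)).setReg 2 n).reg 1)
      ((((conc π.b s).setReg 1 (16 * s.v y + π.b)).setReg 2 n).reg 2) = 16 * s.v y + π.b + n := by
    simp [BinOp.eval, Store.setReg]
  refine Ok.op h4 (by rw [e5]; unfold Par.B; omega) ?_
  rw [e5]
  have e6 : (((conc π.b s).setReg 1 (16 * s.v y + π.b)).setReg 2 n).setReg 1
      (16 * s.v y + π.b + n) = ((conc π.b s).setReg 1 (16 * s.v y + π.b + n)).setReg 2 n := by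
    refine Store.ext_of (funext fun i => ?_) rfl
    simp only [Store.setReg, Function.update_apply]
    split_ifs <;> simp_all
  rw [e6]
  exact fun h5 => hy (by omega) (hs.mono (by omega)) h5

/-- The compiled program simulates the program. -/
theorem okS_compile (h : H) : ∀ {s : St} {k : List Cmd} {T : ℕ} {p : ENNReal}, h.wf = true →
    Saf π.B₀ π.b h s → OkS π E T (ev h s) k p →
    OkS π E (T + cost h s) s (h.compile :: k) p := by
  induction h with
  | inc x => intro s k T p _ _ h; exact okS_one (o := .add) le_rfl h
  | mov x y =>
    intro s k T p _ _ h hT hs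
    -- A move is the addition of register `0`, which always holds `0`.
    have e : BinOp.add.eval ((conc π.b s).reg (y + 4)) ((conc π.b s).reg 0) = s.v y := rfl
    have hy := hs.1 y
    refine Ok.op (OkS.bounded hs) (by rw [e]; unfold Par.B; omega) fun _ => ?_
    rw [e, conc_setReg]
    exact h (by simp only [cost] at hT; omega)
      ((hs.mono (by simp only [cost] at hT ⊢; omega)).set (by simp only [cost] at hT hy; omega))
  | cst x n =>
    intro s k T p _ hn h hT hs
    simp only [Saf] at hn
    refine Ok.const (OkS.bounded hs) (by unfold Par.B; omega) fun _ => ?_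
    rw [conc_setReg]
    exact h (by simp only [cost] at hT; omega)
      ((hs.mono (by simp only [cost] at hT ⊢; omega)).set (by omega))
  | opr o x y z =>
    intro s k T p _ hn h hT hs
    have e : o.eval ((conc π.b s).reg (y + 4)) ((conc π.b s).reg (z + 4)) =
      o.eval (s.v y) (s.v z) := rfl
    simp only [cost] at hT hs
    have hy := hs.1 y
    have hv : o.eval (s.v y) (s.v z) ≤ π.B₀ + (π.tmax - T) := by
      cases o with
      | add => simp only [Saf] at hn; simp only [BinOp.eval]; omega
      | mul => simp only [Saf] at hn; simp only [BinOp.eval]; omega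
      | sub => simp only [BinOp.eval]; omega
      | div =>
        simp only [BinOp.eval]
        have := Nat.div_le_self (s.v y) (s.v z)
        omega
    refine Ok.op (OkS.bounded hs) (by rw [e]; unfold Par.B; omega) fun _ => ?_
    rw [e, conc_setReg]
    exact h (by omega) ((hs.mono (by omega)).set hv)
  | ld x n y =>
    intro s k T p hn _ h hT hs
    simp only [H.wf, decide_eq_true_eq] at hn
    simp only [cost] at hT hs
    have hy := hs.2.1 n (s.v y)
    refine okS_address (T := T + 5) hn ?_ hT hs
    intro _ _ h1
    refine Ok.seq h1 (Ok.load h1 ?_)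
    have e : (((conc π.b s).setReg 1 (16 * s.v y + π.b + n)).setReg 2 n).mem
        ((((conc π.b s).setReg 1 (16 * s.v y + π.b + n)).setReg 2 n).reg 1) =
        s.a n (s.v y) := conc_mem π.b s hn
    rw [e]
    refine fun h2 => Ok.seq h2 (Ok.const h2 (Nat.zero_le _) fun h3 =>
      Ok.const h3 (Nat.zero_le _) fun h4 => ?_)
    convert h (by omega) ((hs.mono (by omega)).set (by omega)) using 2
    rw [ev, ← conc_setReg]
    refine Store.ext_of (funext fun i => ?_) rfl
    simp only [Store.setReg, Function.update_apply]
    split_ifs <;> simp_all [conc, concReg]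
  | st n x y =>
    intro s k T p hn _ h hT hs
    simp only [H.wf, decide_eq_true_eq] at hn
    simp only [cost] at hT hs
    have hy := hs.1 y
    refine okS_address (T := T + 5) hn ?_ hT hs
    intro _ _ h1
    refine Ok.seq h1 (Ok.store h1 ?_)
    have e1 : (((conc π.b s).setReg 1 (16 * s.v x + π.b + n)).setReg 2 n).reg 1 =
        16 * s.v x + π.b + n := rfl
    have e2 : (((conc π.b s).setReg 1 (16 * s.v x + π.b + n)).setReg 2 n).reg (y + 4) =
        s.v y := by simp [Store.setReg, conc, concReg]
    rw [e1, e2]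
    refine fun h2 => Ok.seq h2 (Ok.const h2 (Nat.zero_le _) fun h3 =>
      Ok.const h3 (Nat.zero_le _) fun h4 => ?_)
    convert h (by omega) ((hs.mono (by omega)).put (by omega)) using 2
    rw [ev, ← conc_setMem _ _ hn]
    refine Store.ext_of (funext fun i => ?_) rfl
    simp only [Store.setReg, Store.setMem, Function.update_apply]
    split_ifs <;> simp_all [conc, concReg]
  | ldi x y =>
    intro s k T p _ hn h hT hs
    simp only [Saf] at hn
    simp only [cost] at hT hs
    have e : (conc π.b s).mem ((conc π.b s).reg (y + 4)) = s.io (s.v y) := if_pos hn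
    refine Ok.load (OkS.bounded hs) ?_
    rw [e, conc_setReg]
    have hy := hs.2.2 (s.v y)
    exact fun _ => h (by omega) ((hs.mono (by omega)).set (by omega))
  | sti x y =>
    intro s k T p _ hn h hT hs
    simp only [Saf] at hn
    simp only [cost] at hT hs
    have e : (conc π.b s).setMem ((conc π.b s).reg (x + 4)) ((conc π.b s).reg (y + 4)) =
      conc π.b (s.puti (s.v x) (s.v y)) := conc_setMem_io π.b s hn _
    refine Ok.store (OkS.bounded hs) ?_
    rw [e]
    have hy := hs.1 y
    exact fun _ => h (by omega) ((hs.mono (by omega)).puti (by omega))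
  | seq a c iha ihc =>
    intro s k T p hw hn h hT hs
    simp only [H.wf, Bool.and_eq_true] at hw
    have h' := iha hw.1 hn.1 (ihc hw.2 hn.2 h)
    simp only [cost] at hT hs ⊢
    have e : T + (cost a s + cost c (ev a s) + 1) = T + cost c (ev a s) + cost a s + 1 := by ring
    rw [e] at hT hs ⊢
    exact Ok.seq (OkS.bounded hs) (h' (by omega) (hs.mono (by omega)))
  | ite x a c iha ihc =>
    intro s k T p hw hn h hT hs
    simp only [H.wf, Bool.and_eq_true] at hw
    simp only [cost, ev, Saf] at hT hs hn h ⊢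
    rw [← add_assoc] at hT hs ⊢
    refine Ok.ite (OkS.bounded hs) ?_
    have e : (conc π.b s).reg (x + 4) = s.v x := rfl
    rw [e]
    split_ifs at hT hs hn h ⊢
    · exact ihc hw.2 hn h (by omega) (hs.mono (by omega))
    · exact iha hw.1 hn h (by omega) (hs.mono (by omega))
  | rep x a ih =>
    intro s k T p hw hn h
    simp only [H.wf, Bool.and_eq_true] at hw
    generalize hc : s.v x = c
    induction c generalizing s with
    | zero =>
      intro hT hs
      simp only [cost, hc, Finset.range_zero, Finset.sum_empty, zero_add] at hT hs ⊢
      refine Ok.loop_zero (OkS.bounded hs) hc ?_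
      rw [ev_rep, hc] at h
      exact h (by omega) (hs.mono (by omega))
    | succ c IH =>
      -- Well-formedness is used here: the body leaves its counter alone, so the machine's while
      -- loop makes exactly the number of iterations fixed on entry.
      have hx : (ev a s).v x = c + 1 := by rw [ev_fixesVar hw.1, hc]
      have hx' : (iter x a s).v x = c := by simp [iter, hx]
      have h1 : OkS π E (T + cost (.rep x a) (iter x a s)) (iter x a s)
          ((H.rep x a).compile :: k) p := by
        refine IH ?_ ?_ hx'
        · intro j hj
          have := hn (j + 1) (by omega)
          rwa [Function.iterate_succ_apply] at this
        · rw [ev_rep, hc, Function.iterate_succ_apply] at h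
          rwa [ev_rep, hx']
      have h2 := okS_one (o := .sub) (by simp only [BinOp.eval]; omega) h1
      have h3 := ih hw.2 (s := s) (hn 0 (by omega)) h2
      have e : T + cost (.rep x a) s =
          T + cost (.rep x a) (iter x a s) + 5 + cost a s + 1 + 1 := by
        simp only [cost, hc, hx', Finset.sum_range_succ', Function.iterate_succ_apply,
          Function.iterate_zero, id]
        ring
      rw [e]
      intro hT hs
      refine Ok.loop_pos (OkS.bounded hs) (hc.trans_ne (by omega)) ?_
      have hs' := hs.mono (M' := π.B₀ + (π.tmax - (T + cost (.rep x a) (iter x a s) + 5 +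
        cost a s + 1))) (by omega)
      exact Ok.seq (OkS.bounded hs') (h3 (by omega) (hs.mono (by omega)))

end Welzl

namespace Welzl

/-! ### Total correctness with time bounds -/

/-- From `s`, the program `h` is safe, takes at most `T` steps and ends in a state with `Q`. -/
def W (π : Par) (h : H) (s : St) (T : ℕ) (Q : St → Prop) : Prop :=
  cost h s ≤ T ∧ Saf π.B₀ π.b h s ∧ Q (ev h s)

variable {π : Par} {E : Set Store} {T T' : ℕ} {p : ENNReal} {k : List Cmd} {s : St}
  {Q Q' : St → Prop} {h a c : H}

lemma OkS.mono {p' : ENNReal} (h : OkS π E T s k p) (hT : T ≤ T') (hp : p ≤ p') :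
    OkS π E T' s k p' := fun hT' hs =>
  Ok.mono (h (by omega) (hs.mono (by omega))) hT hp

lemma W.okS {T₁ : ℕ} (hw : h.wf = true) (hW : W π h s T Q)
    (hQ : ∀ t, Q t → OkS π E T₁ t k p) : OkS π E (T₁ + T) s (h.compile :: k) p :=
  (okS_compile h hw hW.2.1 (hQ _ hW.2.2)).mono (Nat.add_le_add_left hW.1 _) le_rfl

lemma W.mono (h₁ : W π h s T Q) (hT : T ≤ T') (hQ : ∀ t, Q t → Q' t) : W π h s T' Q' :=
  ⟨h₁.1.trans hT, h₁.2.1, hQ _ h₁.2.2⟩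

lemma W.seq {T₁ T₂ : ℕ} (h₁ : W π a s T₁ fun t => W π c t T₂ Q) (hT : T₁ + T₂ + 1 ≤ T) :
    W π (.seq a c) s T Q := by
  obtain ⟨h₁, h₂, h₃, h₄, h₅⟩ := h₁
  exact ⟨by simp only [cost]; omega, ⟨h₂, h₄⟩, h₅⟩

lemma W.ite {x T₁ : ℕ} (h₁ : s.v x ≠ 0 → W π a s T₁ Q) (h₂ : s.v x = 0 → W π c s T₁ Q)
    (hT : T₁ + 1 ≤ T) : W π (.ite x a c) s T Q := by
  by_cases hx : s.v x = 0
  · obtain ⟨h₁, h₂, h₃⟩ := h₂ hx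
    exact ⟨by simp only [cost, hx, if_true]; omega, by simpa only [Saf, hx, if_true],
      by simpa only [ev, hx, if_true]⟩
  · obtain ⟨h₁, h₂, h₃⟩ := h₁ hx
    exact ⟨by simp only [cost, hx, if_false]; omega, by simpa only [Saf, hx, if_false],
      by simpa only [ev, hx, if_false]⟩

/-- What is not assigned by `h` is the same in `s` and `t`. -/
structure Fr (h : H) (s t : St) : Prop where
  v : ∀ y, h.fixesVar y = true → t.v y = s.v y
  a : ∀ k, h.fixesArr k = true → t.a k = s.a k
  io : h.fixesBuffer = true → t.io = s.io

lemma Fr.refl (h : H) (s : St) : Fr h s s := ⟨fun _ _ => rfl, fun _ _ => rfl, fun _ => rfl⟩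

lemma fr_ev (h : H) (s : St) : Fr h s (ev h s) :=
  ⟨fun _ hy => ev_fixesVar hy s, fun _ hk => ev_fixesArr hk s, fun hi => ev_fixesBuffer hi s⟩

/-- Specifications need only mention what changes; that a given variable or array is untouched is a
Boolean check on the program, settled by `rfl`. -/
lemma W.frame (hW : W π h s T fun t => Fr h s t → Q t) : W π h s T Q :=
  ⟨hW.1, hW.2.1, hW.2.2 (fr_ev h s)⟩

lemma fr_iter {x : ℕ} {t : St} (hf : Fr (.rep x a) s t) : Fr (.rep x a) s (iter x a t) := by
  refine ⟨fun y hy => ?_, fun k hk => ?_, fun hi => ?_⟩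
  · rw [← hf.v y hy]
    simp only [H.fixesVar, Bool.and_eq_true, bne_iff_ne, ne_eq] at hy
    simp [iter, Ne.symm hy.1, ev_fixesVar hy.2]
  · rw [← hf.a k hk]
    exact ev_fixesArr (h := a) hk t
  · rw [← hf.io hi]
    exact ev_fixesBuffer (h := a) hi t

/-- The rule for loops, with an invariant `I` and the time `c j` for iteration `j`. -/
lemma W.rep {x n : ℕ} (I : ℕ → St → Prop) (c : ℕ → ℕ) (hn : s.v x = n) (h₀ : I 0 s)
    (hstep : ∀ j < n, ∀ t, Fr (.rep x a) s t → I j t →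
      W π a t (c j) fun t' => I (j + 1) (t'.set x (t'.v x - 1)))
    (hT : (∑ j ∈ Finset.range n, (c j + 7)) + 1 ≤ T)
    (hQ : ∀ t, Fr (.rep x a) s t → I n t → Q t) : W π (.rep x a) s T Q := by
  have key : ∀ j ≤ n, Fr (.rep x a) s ((iter x a)^[j] s) ∧ I j ((iter x a)^[j] s) := by
    intro j
    induction j with
    | zero => exact fun _ => ⟨Fr.refl _ _, h₀⟩
    | succ j ih =>
      intro hj
      obtain ⟨hf, hI⟩ := ih (by omega)
      rw [Function.iterate_succ_apply']
      exact ⟨fr_iter hf, (hstep j (by omega) _ hf hI).2.2⟩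
  refine ⟨?_, ?_, ?_⟩
  · simp only [cost, hn]
    refine le_trans (Nat.add_le_add_right (Finset.sum_le_sum fun j hj => ?_) 1) hT
    have hj' := Finset.mem_range.1 hj
    obtain ⟨hf, hI⟩ := key j hj'.le
    exact Nat.add_le_add_right (hstep j hj' _ hf hI).1 7
  · intro j hj
    rw [hn] at hj
    obtain ⟨hf, hI⟩ := key j hj.le
    exact (hstep j hj _ hf hI).2.1
  · rw [ev_rep, hn]
    obtain ⟨hf, hI⟩ := key n le_rfl
    exact hQ _ hf hI

/-- The rule for loops with a uniform time bound. -/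
lemma W.rep_const {x n : ℕ} (I : ℕ → St → Prop) (c : ℕ) (hn : s.v x = n) (h₀ : I 0 s)
    (hstep : ∀ j < n, ∀ t, Fr (.rep x a) s t → I j t →
      W π a t c fun t' => I (j + 1) (t'.set x (t'.v x - 1)))
    (hT : n * (c + 7) + 1 ≤ T)
    (hQ : ∀ t, Fr (.rep x a) s t → I n t → Q t) : W π (.rep x a) s T Q :=
  W.rep I (fun _ => c) hn h₀ hstep (by simpa using hT) hQ

lemma W.le (hW : W π h s T Q) (hT : T ≤ T') : W π h s T' Q := ⟨hW.1.trans hT, hW.2⟩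

lemma W.seq_fr {T₁ T₂ : ℕ} {R : St → Prop} (h₁ : W π a s T₁ R)
    (h₂ : ∀ t, Fr a s t → R t → W π c t T₂ Q) : W π (.seq a c) s (T₁ + T₂ + 1) Q :=
  W.seq ⟨h₁.1, h₁.2.1, h₂ _ (fr_ev a s) h₁.2.2⟩ le_rfl

/-- The rule for a program that starts with an instruction. -/
lemma W.cons {T₁ : ℕ} (hc : cost a s = T₁) (hs : Saf π.B₀ π.b a s) (h₁ : W π c (ev a s) T Q) :
    W π (.seq a c) s (T₁ + T + 1) Q :=
  W.seq ⟨hc.le, hs, h₁⟩ le_rfl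

lemma W.cons_one (hc : cost a s = 1) (hs : Saf π.B₀ π.b a s) (h₁ : W π c (ev a s) T Q) :
    W π (.seq a c) s (T + 2) Q :=
  W.le (W.cons hc hs h₁) (by omega)

lemma W.cons_acc (hc : cost a s = 15) (hs : Saf π.B₀ π.b a s) (h₁ : W π c (ev a s) T Q) :
    W π (.seq a c) s (T + 16) Q :=
  W.le (W.cons hc hs h₁) (by omega)

end Welzl

namespace Welzl

/-! ### Partition refinement -/

/-- Labels of the elements, the new labels for old labels, and the first unused label. -/
structure Lab where
  lab : ℕ → ℕ
  nw : ℕ → ℕ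
  c : ℕ

/-- All labels in use are below `c`. -/
def Lab.Valid (S : Lab) : Prop := (∀ x, S.lab x < S.c) ∧ ∀ o, S.nw o < S.c

/-- Move `z` to the new class that is split off from its old class. -/
def refStep (c₀ : ℕ) (S : Lab) (z : ℕ) : Lab :=
  if S.nw (S.lab z) < c₀ then
    ⟨Function.update S.lab z S.c, Function.update S.nw (S.lab z) S.c, S.c + 1⟩
  else ⟨Function.update S.lab z (S.nw (S.lab z)), S.nw, S.c⟩

/-- Split every class into the elements in `zs` and the others. -/
def refine (S : Lab) (zs : List ℕ) : Lab := zs.foldl (refStep S.c) S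

/-- The state after the elements `ys` have been moved. An entry of `nw` is current if it is at least
`S₀.c`, and stale otherwise. By `inj`, two old classes never share a current new label. -/
structure RefInv (S₀ : Lab) (ys : List ℕ) (S : Lab) : Prop where
  old : ∀ x, x ∉ ys → S.lab x = S₀.lab x
  new : ∀ x ∈ ys, S.lab x = S.nw (S₀.lab x) ∧ S₀.c ≤ S.nw (S₀.lab x)
  lt : ∀ o, S.nw o < S.c
  le : S₀.c ≤ S.c
  le_add : S.c ≤ S₀.c + ys.length
  inj : ∀ o o', S₀.c ≤ S.nw o → S.nw o = S.nw o' → o = o'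

lemma RefInv.step {S₀ S : Lab} {ys : List ℕ} (h : RefInv S₀ ys S) {z : ℕ} (hz : z ∉ ys) :
    RefInv S₀ (ys ++ [z]) (refStep S₀.c S z) := by
  have hl := h.old z hz
  have hlt := h.lt
  have hle := h.le
  have hla := h.le_add
  unfold refStep
  rw [hl]
  split_ifs with hc
  -- A stale entry at the label of `z` means that `z` is the first element of its class to be moved,
  -- so overwriting that entry disturbs no earlier element.
  · have hne : ∀ x ∈ ys, S₀.lab x ≠ S₀.lab z := by
      intro x hx e
      have := (h.new x hx).2
      rw [e] at this
      omega
    refine ⟨fun x hx => ?_, fun x hx => ?_, fun o => ?_, by simp only; omega,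
      by simp only [List.length_append, List.length_singleton]; omega, fun o o' h1 h2 => ?_⟩
    · simp only [List.mem_append, List.mem_singleton, not_or] at hx
      simp [hx.2, h.old x hx.1]
    · simp only [List.mem_append, List.mem_singleton] at hx
      rcases hx with hx | rfl
      · have hxz : x ≠ z := fun e => hz (e ▸ hx)
        simp [hxz, hne x hx, h.new x hx]
      · simp [hle]
    · simp only [Function.update_apply]
      split_ifs
      · omega
      · have := hlt o; omega
    · simp only [Function.update_apply] at h1 h2
      have a1 := hlt o
      have a2 := hlt o'
      split_ifs at h1 h2
      · simp_all
      · omega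
      · omega
      · exact h.inj o o' h1 h2
  · refine ⟨fun x hx => ?_, fun x hx => ?_, hlt, hle,
      by simp only [List.length_append, List.length_singleton]; omega, h.inj⟩
    · simp only [List.mem_append, List.mem_singleton, not_or] at hx
      simp [hx.2, h.old x hx.1]
    · simp only [List.mem_append, List.mem_singleton] at hx
      rcases hx with hx | rfl
      · have hxz : x ≠ z := fun e => hz (e ▸ hx)
        simp [hxz, h.new x hx]
      · simp only [Function.update_self, true_and]; omega

lemma RefInv.foldl {S₀ S : Lab} {ys zs : List ℕ} (h : RefInv S₀ ys S) (hn : (ys ++ zs).Nodup) :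
    RefInv S₀ (ys ++ zs) (zs.foldl (refStep S₀.c) S) := by
  induction zs generalizing ys S with
  | nil => simpa using h
  | cons z zs ih =>
    have hz : z ∉ ys := by
      intro hz
      exact (List.disjoint_of_nodup_append hn) hz (by simp)
    have := ih (h.step hz) (by simpa using hn)
    simpa using this

lemma refInv_refine {S : Lab} (hS : S.Valid) {zs : List ℕ} (hn : zs.Nodup) :
    RefInv S zs (refine S zs) := by
  have h : RefInv S [] S := ⟨fun _ _ => rfl, by simp, hS.2, le_rfl, by simp, fun o o' h => by
    have := hS.2 o; omega⟩
  exact h.foldl (zs := zs) (by simpa using hn)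

lemma refine_valid {S : Lab} (hS : S.Valid) {zs : List ℕ} (hn : zs.Nodup) :
    (refine S zs).Valid := by
  have h := refInv_refine hS hn
  refine ⟨fun x => ?_, h.lt⟩
  by_cases hx : x ∈ zs
  · rw [(h.new x hx).1]; exact h.lt _
  · rw [h.old x hx]; exact (hS.1 x).trans_le h.le

/-- Moved elements carry labels from `S.c` on and the others older ones, so the two kinds never
collide; among moved elements the new label determines the old class by `RefInv.inj`. -/
lemma refine_lab_eq_iff {S : Lab} (hS : S.Valid) {zs : List ℕ} (hn : zs.Nodup) (x y : ℕ) :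
    (refine S zs).lab x = (refine S zs).lab y ↔ S.lab x = S.lab y ∧ (x ∈ zs ↔ y ∈ zs) := by
  have h := refInv_refine hS hn
  have hx' := hS.1 x
  have hy' := hS.1 y
  by_cases hx : x ∈ zs <;> by_cases hy : y ∈ zs
  · have h1 := h.new x hx
    have h2 := h.new y hy
    simp only [h1.1, h2.1, hx, hy, and_true]
    exact ⟨h.inj _ _ h1.2, fun e => by rw [e]⟩
  · have h1 := h.new x hx
    simp only [h1.1, h.old y hy, hx, hy]
    simp; omega
  · have h1 := h.new y hy
    simp only [h1.1, h.old x hx, hx, hy]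
    simp; omega
  · simp [h.old x hx, h.old y hy, hx, hy]

lemma refine_le_lab {S : Lab} (hS : S.Valid) {zs : List ℕ} (hn : zs.Nodup) {l x : ℕ}
    (hl : l ≤ S.c) (hx : l ≤ S.lab x) : l ≤ (refine S zs).lab x := by
  have h := refInv_refine hS hn
  by_cases hz : x ∈ zs
  · have := h.new x hz; omega
  · rwa [h.old x hz]

/-! ### Linked lists -/

/-- Starting from the node `p`, the values along the pointers `nx` are `zs`; all nodes are
below `P`. -/
def Chain (nx vl : ℕ → ℕ) (P : ℕ) : ℕ → List ℕ → Prop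
  | _, [] => True
  | p, z :: zs => p < P ∧ vl p = z ∧ Chain nx vl P (nx p) zs

/-- All nodes in use lie below `P`, so writing the node `P` cannot damage an existing list. The
pointer of a last node is arbitrary, because lengths are stored separately. -/
lemma Chain.fresh {nx vl : ℕ → ℕ} {P p x y : ℕ} {zs : List ℕ} (h : Chain nx vl P p zs) :
    Chain (Function.update nx P x) (Function.update vl P y) (P + 1) p zs := by
  induction zs generalizing p with
  | nil => trivial
  | cons z zs ih =>
    obtain ⟨h1, h2, h3⟩ := h
    refine ⟨by omega, ?_, ?_⟩
    · rwa [Function.update_of_ne (by omega)]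
    · rw [Function.update_of_ne (by omega)]
      exact ih h3

/-- The lists `Ls i` are stored with the heads `hd i` and the lengths `cn i`. -/
def Lists (hd nx vl cn : ℕ → ℕ) (P : ℕ) (Ls : ℕ → List ℕ) : Prop :=
  ∀ i, cn i = (Ls i).length ∧ Chain nx vl P (hd i) (Ls i)

lemma Lists.prepend {hd nx vl cn : ℕ → ℕ} {P : ℕ} {Ls : ℕ → List ℕ}
    (h : Lists hd nx vl cn P Ls) (i z : ℕ) :
    Lists (Function.update hd i P) (Function.update nx P (hd i)) (Function.update vl P z)
      (Function.update cn i (cn i + 1)) (P + 1) (Function.update Ls i (z :: Ls i)) := by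
  intro j
  by_cases hj : j = i
  · subst hj
    simp only [Function.update_self, List.length_cons, (h j).1, true_and]
    refine ⟨Nat.lt_succ_self _, by simp, ?_⟩
    simpa using (h j).2.fresh
  · simp only [Function.update_of_ne hj]
    exact ⟨(h j).1, (h j).2.fresh⟩

/-! ### Merging cycles -/

/-- The function `f` maps `a` along the list `t` to `b`. -/
def Path (f : ℕ → ℕ) : ℕ → List ℕ → ℕ → Prop
  | a, [], b => f a = b
  | a, x :: t, b => f a = x ∧ Path f x t b

/-- Exchange the values at `u` and `v`. -/
def swapVal (f : ℕ → ℕ) (u v : ℕ) : ℕ → ℕ :=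
  Function.update (Function.update f u (f v)) v (f u)

lemma Path.append {f : ℕ → ℕ} {a x b : ℕ} {t t' : List ℕ} (h : Path f a t x)
    (h' : Path f x t' b) : Path f a (t ++ x :: t') b := by
  induction t generalizing a with
  | nil => exact ⟨h, h'⟩
  | cons y t ih => exact ⟨h.1, ih h.2⟩

lemma Path.congr {f g : ℕ → ℕ} {a a' b : ℕ} {t : List ℕ} (h : Path f a t b)
    (ha : g a' = f a) (ht : ∀ x ∈ t, g x = f x) : Path g a' t b := by
  induction t generalizing a a' with
  | nil => exact ha.trans h
  | cons y t ih =>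
    exact ⟨ha.trans h.1, ih h.2 (ht y (by simp)) fun x hx => ht x (by simp [hx])⟩

/-- The cycles of `f` that start at the elements of `reps` partition `{0, …, n - 1}`. -/
def Cycles (n : ℕ) (f : ℕ → ℕ) (reps : List ℕ) : Prop :=
  ∃ B : ℕ → List ℕ, (∀ r ∈ reps, Path f r (B r) r) ∧
    (reps.flatMap fun r => r :: B r).Perm (List.range n)

lemma Cycles.perm {n : ℕ} {f : ℕ → ℕ} {reps reps' : List ℕ} (h : Cycles n f reps)
    (hp : reps.Perm reps') : Cycles n f reps' := by
  obtain ⟨B, hB, hperm⟩ := h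
  exact ⟨B, fun r hr => hB r (hp.mem_iff.2 hr), (hp.flatMap_right _).symm.trans hperm⟩

lemma Cycles.sublist_perm {n : ℕ} {f : ℕ → ℕ} {reps : List ℕ} (h : Cycles n f reps) :
    reps.Nodup ∧ ∀ r ∈ reps, r < n := by
  obtain ⟨B, hB, hperm⟩ := h
  have hnd : (reps.flatMap fun r => r :: B r).Nodup := hperm.nodup_iff.2 List.nodup_range
  constructor
  · have : ∀ l : List ℕ, l.Sublist (l.flatMap fun r => r :: B r) := by
      intro l
      induction l with
      | nil => simp
      | cons a l ih =>
        simp only [List.flatMap_cons, List.cons_append]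
        exact (ih.trans (List.sublist_append_right _ _)).cons_cons a
    exact hnd.sublist (this reps)
  · intro r hr
    have : r ∈ reps.flatMap fun r => r :: B r := List.mem_flatMap.2 ⟨r, hr, by simp⟩
    simpa using hperm.mem_iff.1 this

/-- Exchanging the successors of two points on different cycles joins the cycles, and `v` remains as
representative. -/
lemma Cycles.merge_cons {n : ℕ} {f : ℕ → ℕ} {u v : ℕ} {l : List ℕ}
    (h : Cycles n f (u :: v :: l)) : Cycles n (swapVal f u v) (v :: l) := by
  obtain ⟨B, hB, hperm⟩ := h
  have hnd : ((u :: v :: l).flatMap fun r => r :: B r).Nodup :=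
    hperm.nodup_iff.2 List.nodup_range
  simp only [List.flatMap_cons, List.cons_append, List.nodup_cons, List.mem_append,
    List.mem_cons, not_or, List.nodup_append] at hnd
  obtain ⟨⟨huu, huv, huv', hul⟩, hBu, ⟨⟨hvv, hvl⟩, hBv, hBl, hd1⟩, hd2⟩ := hnd
  have hval : ∀ x, x ≠ u → x ≠ v → swapVal f u v x = f x := by
    intro x h1 h2; simp [swapVal, h1, h2]
  -- From `v` the new cycle runs along the old cycle of `u`, arrives at `u`, and continues along the
  -- old cycle of `v`.
  refine ⟨fun r => if r = v then B u ++ u :: B v else B r, ?_, ?_⟩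
  · intro r hr
    by_cases hrv : r = v
    · subst hrv
      simp only [if_true]
      refine Path.append (x := u) ?_ ?_
      · refine (hB u (by simp)).congr (by simp [swapVal]) fun x hx => hval x ?_ ?_
        · rintro rfl; exact huu hx
        · rintro rfl; exact (hd2 _ hx _ (Or.inl rfl)) rfl
      · refine (hB r (by simp)).congr (by simp [swapVal, huv]) fun x hx => hval x ?_ ?_
        · rintro rfl; exact huv' hx
        · rintro rfl; exact hvv hx
    · have hrl : r ∈ l := by simpa [hrv] using hr
      simp only [hrv, if_false]
      have hmem : ∀ x ∈ r :: B r, x ∈ l.flatMap fun r => r :: B r :=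
        fun x hx => List.mem_flatMap.2 ⟨r, hrl, hx⟩
      have hne : ∀ x ∈ r :: B r, x ≠ u ∧ x ≠ v := by
        intro x hx
        constructor
        · rintro rfl; exact hul (hmem x hx)
        · rintro rfl; exact hvl (hmem x hx)
      refine (hB r (by simp [hrl])).congr (hval r (hne r (by simp)).1 (hne r (by simp)).2)
        fun x hx => hval x (hne x (by simp [hx])).1 (hne x (by simp [hx])).2
  · have e : (l.flatMap fun r => r :: if r = v then B u ++ u :: B v else B r) =
        l.flatMap fun r => r :: B r := by
      rw [List.flatMap_def, List.flatMap_def]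
      congr 1
      refine List.map_congr_left fun r hr => ?_
      have : r ≠ v := by
        rintro rfl
        exact hvl (List.mem_flatMap.2 ⟨r, hr, by simp⟩)
      simp [this]
    rw [List.flatMap_cons, e]
    simp only [if_true]
    refine List.Perm.trans ?_ hperm
    simp only [List.flatMap_cons, List.cons_append, List.append_assoc]
    refine (List.Perm.cons v (List.perm_middle)).trans ?_
    refine (List.Perm.swap _ _ _).trans (List.Perm.cons u ?_)
    exact List.perm_middle.symm

lemma Cycles.merge {n : ℕ} {f : ℕ → ℕ} {u v : ℕ} {l₁ l₂ : List ℕ}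
    (h : Cycles n f (l₁ ++ u :: l₂)) (hv : v ∈ l₁) :
    Cycles n (swapVal f u v) (l₁ ++ l₂) := by
  obtain ⟨a, b, rfl⟩ := List.append_of_mem hv
  have h1 : ((a ++ v :: b) ++ u :: l₂).Perm (u :: v :: (a ++ b ++ l₂)) := by
    refine List.perm_middle.trans (List.Perm.cons u ?_)
    simp only [List.append_assoc, List.cons_append]
    exact List.perm_middle
  refine ((h.perm h1).merge_cons).perm ?_
  simp only [List.append_assoc, List.cons_append]
  exact List.perm_middle.symm

lemma Cycles.id (n : ℕ) {f : ℕ → ℕ} (hf : ∀ x < n, f x = x) : Cycles n f (List.range n) := by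
  refine ⟨fun _ => [], fun r hr => hf r (List.mem_range.1 hr), ?_⟩
  have : ((List.range n).flatMap fun r => [r]) = List.range n := by simp
  rw [this]

lemma path_iterate {f : ℕ → ℕ} {a b : ℕ} {t : List ℕ} (h : Path f a t b) :
    a :: t = (List.range (t.length + 1)).map fun i => f^[i] a := by
  induction t generalizing a with
  | nil => simp
  | cons x t ih =>
    rw [List.length_cons, List.range_succ_eq_map, List.map_cons, List.map_map, ih h.2, ← h.1]
    simp only [List.cons.injEq, Function.iterate_zero, id, true_and]
    exact List.map_congr_left fun i _ => rfl

lemma Cycles.order {n : ℕ} {f : ℕ → ℕ} {r : ℕ} (h : Cycles n f [r]) :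
    ((List.range n).map fun i => f^[i] r).Perm (List.range n) := by
  obtain ⟨B, hB, hperm⟩ := h
  simp only [List.flatMap_cons, List.flatMap_nil, List.append_nil] at hperm
  have hlen := hperm.length_eq
  simp only [List.length_cons, List.length_range] at hlen
  have := path_iterate (hB r (by simp))
  rw [hlen] at this
  rwa [← this]

/-- The number of elements of `{0, …, n - 1}` that are separated from their image. -/
def cr (n : ℕ) (χ : ℕ → Prop) [DecidablePred χ] (f : ℕ → ℕ) : ℕ :=
  ∑ x ∈ Finset.range n, if (χ x ↔ χ (f x)) then 0 else 1

/-- Only the values at `u` and `v` change. Going from `u` to `f v` by way of `v`, and from `v` to `f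
u` by way of `u`, costs the two old pairs plus twice the pair of `u` and `v`. -/
lemma cr_swapVal {n : ℕ} (χ : ℕ → Prop) [DecidablePred χ] (f : ℕ → ℕ) {u v : ℕ} (hu : u < n)
    (hv : v < n) (huv : u ≠ v) :
    cr n χ (swapVal f u v) ≤ cr n χ f + 2 * if (χ u ↔ χ v) then 0 else 1 := by
  have hu' : u ∈ Finset.range n := Finset.mem_range.2 hu
  have hv' : v ∈ (Finset.range n).erase u :=
    Finset.mem_erase.2 ⟨huv.symm, Finset.mem_range.2 hv⟩
  unfold cr
  rw [← Finset.add_sum_erase _ _ hu', ← Finset.add_sum_erase _ _ hv',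
    ← Finset.add_sum_erase (Finset.range n) _ hu', ← Finset.add_sum_erase _ _ hv']
  have e : ∑ x ∈ ((Finset.range n).erase u).erase v,
      (if (χ x ↔ χ (swapVal f u v x)) then 0 else 1) =
      ∑ x ∈ ((Finset.range n).erase u).erase v, if (χ x ↔ χ (f x)) then 0 else 1 := by
    refine Finset.sum_congr rfl fun x hx => ?_
    simp only [Finset.mem_erase] at hx
    simp [swapVal, hx.1, hx.2.1]
  rw [e]
  have e1 : swapVal f u v u = f v := by simp [swapVal, huv]
  have e2 : swapVal f u v v = f u := by simp [swapVal]
  rw [e1, e2]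
  by_cases h1 : χ u <;> by_cases h2 : χ v <;> by_cases h3 : χ (f u) <;> by_cases h4 : χ (f v) <;>
    simp [h1, h2, h3, h4] <;> omega

lemma crossings_le_cr {n : ℕ} {f : ℕ → ℕ} {r : ℕ} (h : Cycles n f [r]) (X : Finset ℕ) :
    SetSystem.crossings ((List.range n).map fun i => f^[i] r) X ≤ cr n (· ∈ X) f := by
  set l := (List.range n).map fun i => f^[i] r with hl
  have h1 : cr n (· ∈ X) f = l.countP fun x => decide (x ∈ X) != decide (f x ∈ X) := by
    rw [h.order.countP_eq]
    unfold cr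
    rw [List.countP_eq_length_filter, ← List.toFinset_card_of_nodup
      (List.nodup_range.filter _), Finset.card_eq_sum_ones, List.toFinset_filter,
      Finset.sum_filter, List.toFinset_range]
    refine Finset.sum_congr rfl fun x _ => ?_
    by_cases h1 : x ∈ X <;> by_cases h2 : f x ∈ X <;> simp [h1, h2]
  rw [h1]
  unfold SetSystem.crossings
  have h2 : l.zip l.tail = (List.range (n - 1)).map fun i => (f^[i] r, f^[i + 1] r) := by
    refine List.ext_getElem ?_ fun i h1 h2 => ?_
    · simp [hl]
    · simp [hl]
  have h3 : l.countP (fun x => decide (x ∈ X) != decide (f x ∈ X)) =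
      (List.range n).countP fun i => decide (f^[i] r ∈ X) != decide (f^[i + 1] r ∈ X) := by
    rw [hl, List.countP_map]
    refine List.countP_congr fun i _ => ?_
    simp only [Function.comp, Function.iterate_succ_apply']
  rw [h2, h3, List.countP_map]
  -- `cr` also counts the pair that closes the cycle; the linear order omits it.
  refine List.Sublist.countP_le ?_
  exact List.range_sublist.2 (Nat.sub_le _ _)

end Welzl

namespace Welzl

/-! ### The program

Variables: the header of the input, derived constants, the number of representatives, its logarithm,
the loop flag, the first unused label, and auxiliary variables. `r0`, `r1`, `r2` hold `0`, `1`,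
`2`. -/

notation "rN" => (0 : ℕ)
notation "rM" => (1 : ℕ)
notation "rQ" => (2 : ℕ)
notation "rC" => (3 : ℕ)
notation "rD" => (4 : ℕ)
notation "rK" => (5 : ℕ)
notation "rQQ" => (6 : ℕ)
notation "rDD" => (7 : ℕ)
notation "rk" => (8 : ℕ)
notation "rL" => (9 : ℕ)
notation "rf" => (10 : ℕ)
notation "rctr" => (11 : ℕ)
notation "ri" => (12 : ℕ)
notation "ru" => (13 : ℕ)
notation "rt" => (14 : ℕ)
notation "rw'" => (15 : ℕ)
notation "ro" => (16 : ℕ)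
notation "rz" => (17 : ℕ)
notation "rp" => (18 : ℕ)
notation "rl" => (19 : ℕ)
notation "rc0" => (20 : ℕ)
notation "rcnt" => (21 : ℕ)
notation "r0" => (22 : ℕ)
notation "r1" => (23 : ℕ)
notation "r2" => (24 : ℕ)
notation "rk2" => (25 : ℕ)
notation "rs" => (26 : ℕ)
notation "rk1" => (27 : ℕ)
notation "rpos" => (28 : ℕ)

/-! Arrays: linked lists of the elements of the sets and of the sets that contain an element
(heads, pointers, values, lengths), labels of sets and elements, new labels of labels, sampled
elements, used labels, waiting elements, representatives, and successors on cycles. -/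

notation "aHR" => (0 : ℕ)
notation "aNR" => (1 : ℕ)
notation "aVR" => (2 : ℕ)
notation "aCR" => (3 : ℕ)
notation "aHC" => (4 : ℕ)
notation "aNC" => (5 : ℕ)
notation "aVC" => (6 : ℕ)
notation "aCC" => (7 : ℕ)
notation "aLF" => (8 : ℕ)
notation "aLU" => (9 : ℕ)
notation "aNW" => (10 : ℕ)
notation "aMK" => (11 : ℕ)
notation "aSN" => (12 : ℕ)
notation "aPD" => (13 : ℕ)
notation "aCU" => (14 : ℕ)
notation "aNX" => (15 : ℕ)

infixr:30 " ;; " => H.seq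

/-- Put `z` in front of the list number `x`, in the fresh node `rp`. -/
def prependCmd (h nx vl cn x z : ℕ) : H :=
  .ld rt h x ;; .st nx rp rt ;; .st vl rp z ;; .st h x rp ;; .ld rt cn x ;; .inc rt ;; .st cn x rt

/-- Body of the loop over the elements of a set. -/
def parseElem : H :=
  .ldi ru rpos ;; .inc rpos ;; prependCmd aHR aNR aVR aCR ri ru ;;
    prependCmd aHC aNC aVC aCC ru ri ;; .inc rp

/-- Read the sets and store them and the transposed lists. -/
def parseCmd : H :=
  .cst rp 0 ;; .cst rpos 5 ;; .cst ri 0 ;; .mov rcnt rM ;;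
  .rep rcnt (.ldi rl rpos ;; .inc rpos ;; .rep rl parseElem ;; .inc ri)

/-- Body of the loop of `refineCmd`. -/
def refineElem (l nx vl : ℕ) : H :=
  .ld rz vl rp ;; .ld ro l rz ;; .ld rw' aNW ro ;; .opr .sub rt rc0 rw' ;;
  .ite rt (.mov rw' rctr ;; .st aNW ro rw' ;; .inc rctr) (.mov rt rt) ;;
  .st l rz rw' ;; .ld rp nx rp

/-- Refine the labels `l` by the list number `x`. -/
def refineCmd (l h nx vl cn x : ℕ) : H :=
  .mov rc0 rctr ;; .ld rp h x ;; .ld rl cn x ;; .rep rl (refineElem l nx vl)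

/-- Compute the logarithm of the number of representatives and the loop flag. -/
def flagCmd : H :=
  .mov rt rk ;; .cst rL 0 ;; .mov rcnt rk ;;
  .rep rcnt (.opr .div rt rt r2 ;; .ite rt (.inc rL) (.mov rt rt)) ;;
  .opr .sub rf rL rK

/-- Compute the sample size. -/
def sizeCmd : H :=
  .opr .mul rt rf rQQ ;; .opr .div rt rt rDD ;; .cst rs 1 ;;
  .rep rt (.opr .add rs rs rs) ;; .opr .sub rk1 rk r1

/-- Mark the sampled element with number `ri`. -/
def markCmd : H := .ld ru aCU ri ;; .st aMK ru r1 ;; .opr .sub rs rs r1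

/-- Fill an initial segment of an array with a fresh label. -/
def resetCmd (l n : ℕ) : H :=
  .cst ri 0 ;; .mov rcnt n ;; .rep rcnt (.st l ri rctr ;; .inc ri) ;; .inc rctr

/-- Label the sets by their traces on the sample. -/
def tracesCmd : H :=
  resetCmd aLF rM ;; .cst ri 0 ;; .mov rcnt rk ;;
  .rep rcnt (.ld ru aCU ri ;; .ld rt aMK ru ;;
    .ite rt (.st aMK ru r0 ;; refineCmd aLF aHC aNC aVC aCC ru) (.mov rt rt) ;; .inc ri)

/-- Label the elements by the sets that contain them, among one set for each trace. -/
def classesCmd : H :=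
  resetCmd aLU rN ;; .cst ri 0 ;; .mov rcnt rM ;;
  .rep rcnt (.ld ru aLF ri ;; .ld rt aSN ru ;;
    .ite rt (.mov rt rt) (.st aSN ru r1 ;; refineCmd aLU aHR aNR aVR aCR ri) ;; .inc ri)

/-- Body of the loop of `pairCmd`. -/
def pairElem : H :=
  .ld ru aCU ri ;; .ld ro aLU ru ;; .ld rw' aPD ro ;;
  .ite rw'
    (.opr .sub rw' rw' r1 ;; .st aPD ro r0 ;; .ld rz aNX ru ;; .ld rp aNX rw' ;;
      .st aNX ru rp ;; .st aNX rw' rz)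
    (.mov rt ru ;; .inc rt ;; .st aPD ro rt ;; .st aCU rk2 ru ;; .inc rk2) ;;
  .inc ri

/-- Merge the cycles of representatives with equal labels in pairs. -/
def pairCmd : H :=
  .cst ri 0 ;; .cst rk2 0 ;; .mov rcnt rk ;; .rep rcnt pairElem ;; .mov rk rk2

/-- Read the header. -/
def headerCmd : H :=
  .cst r1 1 ;; .cst r2 2 ;; .ldi rN r0 ;; .ldi rM r1 ;; .ldi rQ r2 ;; .cst rt 3 ;; .ldi rC rt ;;
  .cst rt 4 ;; .ldi rD rt ;; .opr .div rt rC rQ ;; .inc rt ;; .opr .div rK rD rQ ;; .inc rK ;;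
  .inc rK ;; .opr .mul rK rK rt ;; .inc rK ;; .opr .mul rQQ rQ rQ ;; .opr .mul rDD rD rD

/-- Start with the elements as representatives of cycles of length one. -/
def initCmd : H :=
  .cst ri 0 ;; .mov rcnt rN ;; .rep rcnt (.st aCU ri ri ;; .st aNX ri ri ;; .inc ri) ;;
  .mov rk rN ;; .cst rctr 1

/-- Merge the remaining cycles. -/
def joinCmd : H :=
  .ld rw' aCU r0 ;; .cst ri 1 ;; .opr .sub rcnt rk r1 ;;
  .rep rcnt (.ld ru aCU ri ;; .ld rz aNX ru ;; .ld rp aNX rw' ;; .st aNX ru rp ;;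
    .st aNX rw' rz ;; .inc ri)

/-- Write the cycle to the output. -/
def outputCmd : H :=
  .cst ri 0 ;; .mov rcnt rN ;; .rep rcnt (.sti ri rw' ;; .ld rw' aNX rw' ;; .inc ri)

def setupCmd : H := headerCmd ;; parseCmd ;; initCmd ;; flagCmd

def roundCmd : H := tracesCmd ;; classesCmd ;; pairCmd ;; flagCmd

def finishCmd : H := joinCmd ;; outputCmd

/-- Choose and mark a random representative. -/
def drawCmd : Cmd := .seq (.rand (ri + 4) (rk1 + 4)) markCmd.compile

/-- The main loop. -/
def mainLoop : Cmd :=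
  .loop (rf + 4) (.seq sizeCmd.compile (.seq (.loop (rs + 4) drawCmd) roundCmd.compile))

/-- Let register `3` point behind the input. -/
def baseCmd : Cmd :=
  .seq (.const 1 1) (.seq (.load 3 1) (.seq (.const 1 2) (.seq (.load 2 1) (.seq (.op .add 3 3 2)
    (.seq (.const 1 5) (.seq (.op .add 3 3 1) (.seq (.const 1 0) (.const 2 0))))))))

/-- The whole program. -/
def welzlProgram : Cmd :=
  .seq baseCmd (.seq setupCmd.compile (.seq mainLoop finishCmd.compile))

variable {π : Par} {s : St} {Q : St → Prop} {T : ℕ}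

/-- The time depends only on the length of the list that is traversed, which makes a whole round
linear in the number of incidences. -/
lemma w_refineCmd {l h nx vl cn x P : ℕ} {Ls : ℕ → List ℕ}
    (hl : l ≠ aNW) (hnx : nx ≠ aNW ∧ nx ≠ l) (hvl : vl ≠ aNW ∧ vl ≠ l)
    (hx : x ≠ rc0 ∧ x ≠ rp)
    (hL : Lists (s.a h) (s.a nx) (s.a vl) (s.a cn) P Ls) :
    W π (refineCmd l h nx vl cn x) s (150 * (Ls (s.v x)).length + 50) fun t =>
      (⟨t.a l, t.a aNW, t.v rctr⟩ : Lab) =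
        refine ⟨s.a l, s.a aNW, s.v rctr⟩ (Ls (s.v x)) := by
  obtain ⟨hlen, hch⟩ := hL (s.v x)
  set zs := Ls (s.v x) with hzs
  set S : Lab := ⟨s.a l, s.a aNW, s.v rctr⟩ with hS
  unfold refineCmd
  refine W.seq (T₁ := 1) ⟨le_rfl, trivial, ?_⟩ (T₂ := 150 * zs.length + 48) (by omega)
  refine W.seq (T₁ := 15) ⟨le_rfl, trivial, ?_⟩ (T₂ := 150 * zs.length + 32) (by omega)
  refine W.seq (T₁ := 15) ⟨le_rfl, trivial, ?_⟩ (T₂ := 150 * zs.length + 16) (by omega)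
  refine W.rep_const (fun j t => (⟨t.a l, t.a aNW, t.v rctr⟩ : Lab) =
      (zs.take j).foldl (refStep S.c) S ∧ Chain (s.a nx) (s.a vl) P (t.v rp) (zs.drop j)) 110
      (n := zs.length) ?_ ?_ ?_ ?_ ?_
  · simp [ev, hx.1, hx.2, hlen]
  · simp [ev, hx.1, hS, hch]
  · rintro j hj t hf ⟨hlab, hc⟩
    have e1 : t.v rc0 = S.c := (hf.v rc0 rfl).trans (by simp [ev, hS])
    have e2 : t.a vl = s.a vl := (hf.a vl (by simp [H.fixesArr, refineElem, hvl.1.symm, hvl.2.symm])).trans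
      (by simp [ev])
    have e3 : t.a nx = s.a nx := (hf.a nx (by simp [H.fixesArr, refineElem, hnx.1.symm, hnx.2.symm])).trans
      (by simp [ev])
    rw [List.drop_eq_getElem_cons hj] at hc
    obtain ⟨-, hc1, hc2⟩ := hc
    refine ⟨?_, ?_, ?_⟩
    · simp only [refineElem, cost]; split_ifs <;> norm_num
    · simp [refineElem, Saf]
    · have e4 : zs.take (j + 1) = zs.take j ++ [zs[j]] := by simp
      rw [e4, List.foldl_append, ← hlab]
      simp only [List.foldl_cons, List.foldl_nil]
      by_cases hcase : t.a aNW (t.a l zs[j]) < S.c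
      · have : S.c - t.a aNW (t.a l zs[j]) ≠ 0 := by omega
        simp [refineElem, ev, e2, hc1, e1, BinOp.eval, this, refStep, hcase, hl, hl.symm, hnx, e3,
          hc2]
      · have : S.c - t.a aNW (t.a l zs[j]) = 0 := by omega
        simp [refineElem, ev, e2, hc1, e1, BinOp.eval, this, refStep, hcase, hl.symm, hnx, e3, hc2]
  · omega
  · rintro t - ⟨ht, -⟩
    simpa [refine] using ht

end Welzl

/-! ### Correctness of the trace partition -/

namespace Welzl

variable {π : Par} {s : St} {Q : St → Prop} {T : ℕ}

lemma w_resetCmd {l n : ℕ} (hn : n ≠ ri ∧ n ≠ rcnt) :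
    W π (resetCmd l n) s (60 * s.v n + 20) fun t =>
      (∀ x, t.a l x = if x < s.v n then s.v rctr else s.a l x) ∧ t.v rctr = s.v rctr + 1 := by
  unfold resetCmd
  refine W.le (W.cons_one rfl (Nat.zero_le _) (W.cons_one rfl trivial (W.seq_fr (T₁ := 30 * s.v n + 1)
    (W.rep_const (fun j t => t.v ri = j ∧ ∀ x, t.a l x = if x < j then s.v rctr else s.a l x)
      21 (n := s.v n) ?_ ?_ ?_ ?_ fun t _ h => h) (T₂ := 5) ?_))) (by omega)
  · simp [ev, hn]
  · simp [ev]
  · rintro j - t hf ⟨h1, h2⟩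
    have e1 : t.v rctr = s.v rctr := (hf.v _ rfl).trans (by simp [ev])
    refine ⟨by simp [cost], by simp [Saf], ?_⟩
    simp only [ev, St.set_v, St.put_v, St.set_a, St.put_a, Function.update_self, h1, e1]
    simp only [Function.update_apply]
    refine ⟨by simp, fun x => ?_⟩
    rw [h2]
    split_ifs <;> first | rfl | omega
  · omega
  · rintro t hf ⟨h1, h2⟩
    have e1 : t.v rctr = s.v rctr := (hf.v _ rfl).trans (by simp [ev])
    refine ⟨by simp [cost], trivial, ?_⟩
    simp only [ev, St.set_v, St.set_a, Function.update_self, e1]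
    refine ⟨fun x => ?_, trivial⟩
    rw [h2]

/-- The array `f` starts with the entries of `C`. -/
def Holds (f : ℕ → ℕ) (C : List ℕ) : Prop := ∀ j (hj : j < C.length), f j = C[j]

lemma mem_take_succ {C : List ℕ} {j : ℕ} (hj : j < C.length) (u : ℕ) :
    u ∈ C.take (j + 1) ↔ u ∈ C.take j ∨ u = C[j] := by
  have e : C.take (j + 1) = C.take j ++ [C[j]] := by simp
  rw [e, List.mem_append, List.mem_singleton]

lemma getElem_not_mem_take {C : List ℕ} (hC : C.Nodup) {j : ℕ} (hj : j < C.length) :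
    C[j] ∉ C.take j := by
  intro h
  obtain ⟨i, hi, e⟩ := List.mem_take_iff_getElem.1 h
  have := (hC.getElem_inj_iff).1 e
  omega

lemma sum_getElem (C : List ℕ) (g : ℕ → ℕ) {f : ℕ → ℕ} (hf : Holds f C) :
    ∑ j ∈ Finset.range C.length, g (f j) = (C.map g).sum := by
  rw [Finset.sum_range, ← List.sum_ofFn]
  congr 1
  refine List.ext_getElem (by simp) fun i h1 h2 => ?_
  simp only [List.getElem_ofFn, List.getElem_map]
  rw [hf]

/-- Refining by the column of each marked element of `C` separates exactly the sets with different
traces on the sample. A mark is removed when it is used, so an element drawn repeatedly is processed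
once. That all labels are at least the old counter lets the other tables be read without clearing
them. -/
lemma w_tracesCmd {C : List ℕ} {P : ℕ} {Lc : ℕ → List ℕ} (hk : s.v rk = C.length)
    (hC : Holds (s.a aCU) C) (hnd : C.Nodup) (h0 : s.v r0 = 0)
    (hL : Lists (s.a aHC) (s.a aNC) (s.a aVC) (s.a aCC) P Lc) (hLn : ∀ u, (Lc u).Nodup)
    (hv : Lab.Valid ⟨s.a aLF, s.a aNW, s.v rctr⟩) :
    W π tracesCmd s (60 * s.v rM + 150 * (C.map fun u => (Lc u).length).sum +
        130 * C.length + 100) fun t =>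
      (∀ u, t.a aMK u = if u ∈ C then 0 else s.a aMK u) ∧
      Lab.Valid ⟨t.a aLF, t.a aNW, t.v rctr⟩ ∧ s.v rctr ≤ t.v rctr ∧
      (∀ x < s.v rM, s.v rctr ≤ t.a aLF x) ∧
      ∀ x < s.v rM, ∀ y < s.v rM, t.a aLF x = t.a aLF y ↔
        ∀ u ∈ C, s.a aMK u ≠ 0 → (x ∈ Lc u ↔ y ∈ Lc u) := by
  unfold tracesCmd
  refine W.le (W.seq_fr (w_resetCmd (by norm_num)) (T₂ := 150 * (C.map fun u => (Lc u).length).sum +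
        130 * C.length + 79) fun s₁ hf₁ ⟨hr1, hr2⟩ => ?_) (by omega)
  have hvar : ∀ y, (resetCmd aLF rM).fixesVar y = true → s₁.v y = s.v y := hf₁.v
  have harr : ∀ y, (resetCmd aLF rM).fixesArr y = true → s₁.a y = s.a y := hf₁.a
  refine W.le (W.cons_one rfl (Nat.zero_le _) (W.cons_one rfl trivial (W.rep
    (fun j t => t.v ri = j ∧ (∀ u, t.a aMK u = if u ∈ C.take j then 0 else s.a aMK u) ∧
      Lab.Valid ⟨t.a aLF, t.a aNW, t.v rctr⟩ ∧ s.v rctr ≤ t.v rctr ∧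
      (∀ x < s.v rM, s.v rctr ≤ t.a aLF x) ∧
      ∀ x < s.v rM, ∀ y < s.v rM, t.a aLF x = t.a aLF y ↔
        ∀ u ∈ C.take j, s.a aMK u ≠ 0 → (x ∈ Lc u ↔ y ∈ Lc u))
    (fun j => 150 * (Lc (s.a aCU j)).length + 120)
    -- The invariant at `j` states the final claim with `C` replaced by its first `j` elements; the
    -- time is charged to the column of element `j` and summed by `sum_getElem`.
    (n := C.length) ?_ ?_ ?_ le_rfl ?_))) ?_
  · simp [ev, hvar rk rfl, hk]
  · have hc := hv.1
    refine ⟨by simp [ev], fun u => ?_, ⟨fun x => ?_, fun o => ?_⟩, ?_, fun x hx => ?_,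
      fun x hx y hy => ?_⟩
    · simp [ev, harr aMK rfl]
    · simp only [ev, St.set_a, St.set_v]
      have := hc x
      simp [hr1, hr2]; split_ifs <;> simp at this ⊢; omega
    · simp only [ev, St.set_a, St.set_v]
      have := hv.2 o
      simp [harr aNW rfl, hr2] at this ⊢; omega
    · simp [ev, hr2]
    · simp [ev, hr1, hx]
    · simp [ev, hr1, hx, hy]
  · rintro j hj t hf ⟨h1, h2, h3, h4, h5, h6⟩
    have e1 : ∀ k, (resetCmd aLF rM).fixesArr k = true → k ≠ aLF → k ≠ aNW → k ≠ aMK →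
        t.a k = s.a k := by
      intro k hk1 hk2 hk3 hk4
      refine (hf.a k ?_).trans ((by simp [ev] : _ = s₁.a k).trans (harr k hk1))
      simp [H.fixesArr, refineCmd, refineElem, hk2.symm, hk3.symm, hk4.symm]
    have eu : t.a aCU (t.v ri) = C[j] := by
      rw [h1, e1 aCU rfl (by norm_num) (by norm_num) (by norm_num), hC j hj]
    have e0 : t.v r0 = 0 := (hf.v r0 rfl).trans (by simp [ev, hvar r0 rfl, h0])
    have hcu : s.a aCU j = C[j] := hC j hj
    have hnm := getElem_not_mem_take hnd hj
    rw [hcu]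
    refine W.le (W.cons_acc rfl trivial (W.cons_acc rfl trivial (W.seq_fr (R := fun t' =>
      (∀ u, t'.a aMK u = if u ∈ C.take (j + 1) then 0 else s.a aMK u) ∧
      Lab.Valid ⟨t'.a aLF, t'.a aNW, t'.v rctr⟩ ∧ s.v rctr ≤ t'.v rctr ∧
      (∀ x < s.v rM, s.v rctr ≤ t'.a aLF x) ∧
      ∀ x < s.v rM, ∀ y < s.v rM, t'.a aLF x = t'.a aLF y ↔
        ∀ u ∈ C.take (j + 1), s.a aMK u ≠ 0 → (x ∈ Lc u ↔ y ∈ Lc u))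
      (T₁ := 150 * (Lc C[j]).length + 68)
      (W.ite (T₁ := 150 * (Lc C[j]).length + 67) ?_ ?_ le_rfl) (T₂ := 5) ?_))) (by omega)
    · intro hm
      simp only [ev, St.set_v, St.set_a, Function.update_self, eu] at hm
      have hm' : s.a aMK C[j] ≠ 0 := by
        rw [h2, if_neg hnm] at hm
        simpa using hm
      refine W.le (W.cons_acc rfl trivial (W.mono (w_refineCmd (P := P) (Ls := Lc) (by norm_num)
        (by norm_num) (by norm_num) (by norm_num) ?_) le_rfl ?_ |>.frame)) ?_
      · simp [ev, e1 aHC rfl, e1 aNC rfl, e1 aVC rfl, e1 aCC rfl, hL]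
      · intro t' ht' hft
        have em : t'.a aMK = _ := hft.a aMK rfl
        simp [ev, eu] at ht' em
        have hval := refine_valid h3 (hLn C[j])
        have hri := refInv_refine h3 (hLn C[j])
        have hlab := refine_lab_eq_iff h3 (hLn C[j])
        have hlel : ∀ x, _ := fun x => refine_le_lab h3 (hLn C[j]) (x := x) h4
        rw [← ht'] at hval hri hlab hlel
        refine ⟨fun u => ?_, hval, h4.trans hri.le, fun x hx => hlel x (h5 x hx),
          fun x hx y hy => ?_⟩
        · rw [em]
          simp only [Function.update_apply, mem_take_succ hj]
          by_cases hu : u = C[j]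
          · simp [hu, e0]
          · simp [hu, h2]
        · refine (hlab x y).trans ?_
          simp only
          rw [h6 x hx y hy]
          constructor
          · rintro ⟨g1, g2⟩ u hu hmu
            rcases (mem_take_succ hj u).1 hu with hu | rfl
            · exact g1 u hu hmu
            · exact g2
          · exact fun g => ⟨fun u hu => g u ((mem_take_succ hj u).2 (Or.inl hu)),
              g _ ((mem_take_succ hj _).2 (Or.inr rfl)) hm'⟩
      · simp [ev, eu]
    · intro hm
      simp only [ev, St.set_v, St.set_a, Function.update_self, eu] at hm
      have hm' : s.a aMK C[j] = 0 := by
        rw [h2, if_neg hnm] at hm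
        simpa using hm
      refine ⟨by simp [cost], trivial, ?_⟩
      simp only [ev, St.set_a, St.set_v]
      refine ⟨fun u => ?_, by simpa using h3, by simpa using h4, h5, fun x hx y hy => ?_⟩
      · rw [h2]
        simp only [mem_take_succ hj]
        by_cases hu : u = C[j]
        · simp [hu, hm']
        · simp [hu]
      · rw [h6 x hx y hy]
        refine ⟨fun g u hu hmu => ?_, fun g u hu => g u ((mem_take_succ hj u).2 (Or.inl hu))⟩
        rcases (mem_take_succ hj u).1 hu with hu | rfl
        · exact g u hu hmu
        · exact absurd hm' hmu
    · rintro t' hft ⟨g1, g2, g3, g4, g5⟩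
      have ei : t'.v ri = _ := hft.v ri rfl
      simp [ev, h1] at ei
      refine ⟨by simp [cost], trivial, ?_⟩
      simp only [ev, St.set_a, St.set_v]
      refine ⟨by simp [ei], g1, by simpa using g2, by simpa using g3, g4, g5⟩
  · rintro t - ⟨-, h2, h3, h4, h5, h6⟩
    simp only [List.take_length] at h2 h6
    exact ⟨h2, h3, h4, h5, h6⟩
  · have := sum_getElem C (fun u => (Lc u).length) hC
    rw [Finset.sum_add_distrib, Finset.sum_add_distrib, ← Finset.mul_sum, this]
    simp
    omega

end Welzl

/-! ### Correctness of the classification, the pairing and the sample size -/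

namespace Welzl

variable {π : Par} {s : St} {Q : St → Prop} {T : ℕ}

/-- `R` represents the labels `lab x` for `x < j`. -/
structure Reps (lab : ℕ → ℕ) (j : ℕ) (R : List ℕ) : Prop where
  lt : ∀ x ∈ R, x < j
  cover : ∀ x < j, ∃ y ∈ R, lab y = lab x
  inj : ∀ x ∈ R, ∀ y ∈ R, lab x = lab y → x = y
  nodup : R.Nodup

/-- The first set with each trace label becomes its representative, recognised by the table `aSN`
being `0` at that label, and only representatives refine the elements. The entries of `aSN` outside
the labels in use stay as they were, so the next round finds its fresh labels unseen. -/
lemma w_classesCmd {P : ℕ} {Lr : ℕ → List ℕ} (h1 : s.v r1 = 1)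
    (hL : Lists (s.a aHR) (s.a aNR) (s.a aVR) (s.a aCR) P Lr) (hLn : ∀ u, (Lr u).Nodup)
    (hv : Lab.Valid ⟨s.a aLU, s.a aNW, s.v rctr⟩) (hs : ∀ x < s.v rM, s.a aSN (s.a aLF x) = 0) :
    W π classesCmd s (60 * s.v rN + 150 * (∑ x ∈ Finset.range (s.v rM), (Lr x).length) +
        130 * s.v rM + 100) fun t =>
      ∃ R, Reps (s.a aLF) (s.v rM) R ∧
      (∀ o, (∀ x < s.v rM, s.a aLF x ≠ o) → t.a aSN o = s.a aSN o) ∧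
      Lab.Valid ⟨t.a aLU, t.a aNW, t.v rctr⟩ ∧ s.v rctr ≤ t.v rctr ∧
      (∀ x < s.v rN, s.v rctr ≤ t.a aLU x) ∧
      ∀ x < s.v rN, ∀ y < s.v rN, t.a aLU x = t.a aLU y ↔ ∀ X ∈ R, (x ∈ Lr X ↔ y ∈ Lr X) := by
  unfold classesCmd
  refine W.le (W.seq_fr (w_resetCmd (by norm_num)) (T₂ := 150 * (∑ x ∈ Finset.range (s.v rM),
    (Lr x).length) + 130 * s.v rM + 79) fun s₁ hf₁ ⟨hr1, hr2⟩ => ?_) (by omega)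
  have hvar : ∀ y, (resetCmd aLU rN).fixesVar y = true → s₁.v y = s.v y := hf₁.v
  have harr : ∀ y, (resetCmd aLU rN).fixesArr y = true → s₁.a y = s.a y := hf₁.a
  refine W.le (W.cons_one rfl (Nat.zero_le _) (W.cons_one rfl trivial (W.rep
    (fun j t => t.v ri = j ∧ ∃ R, Reps (s.a aLF) j R ∧
      (∀ x < s.v rM, t.a aSN (s.a aLF x) ≠ 0 ↔ ∃ y ∈ R, s.a aLF y = s.a aLF x) ∧
      (∀ o, (∀ x < s.v rM, s.a aLF x ≠ o) → t.a aSN o = s.a aSN o) ∧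
      Lab.Valid ⟨t.a aLU, t.a aNW, t.v rctr⟩ ∧ s.v rctr ≤ t.v rctr ∧
      (∀ x < s.v rN, s.v rctr ≤ t.a aLU x) ∧
      ∀ x < s.v rN, ∀ y < s.v rN, t.a aLU x = t.a aLU y ↔ ∀ X ∈ R, (x ∈ Lr X ↔ y ∈ Lr X))
    (fun j => 150 * (Lr j).length + 120)
    (n := s.v rM) ?_ ?_ ?_ le_rfl ?_))) ?_
  · simp [ev, hvar rM rfl]
  · have hc := hv.1
    refine ⟨by simp [ev], [], ⟨by simp, by simp, by simp, by simp⟩, fun x hx => ?_, fun o ho => ?_,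
      ⟨fun x => ?_, fun o => ?_⟩, ?_, fun x hx => ?_, fun x hx y hy => ?_⟩
    · simp [ev, harr aSN rfl, hs x hx]
    · simp [ev, harr aSN rfl]
    · simp only [ev, St.set_a, St.set_v]
      have := hc x
      simp [hr1, hr2]; split_ifs <;> simp at this ⊢; omega
    · simp only [ev, St.set_a, St.set_v]
      have := hv.2 o
      simp [harr aNW rfl, hr2] at this ⊢; omega
    · simp [ev, hr2]
    · simp [ev, hr1, hx]
    · simp [ev, hr1, hx, hy]
  · rintro j hj t hf ⟨hi, R, hR, h2, h3, h4, h5, h6, h7⟩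
    have e1 : ∀ k, (resetCmd aLU rN).fixesArr k = true → k ≠ aLU → k ≠ aNW → k ≠ aSN →
        t.a k = s.a k := by
      intro k hk1 hk2 hk3 hk4
      refine (hf.a k ?_).trans ((by simp [ev] : _ = s₁.a k).trans (harr k hk1))
      simp [H.fixesArr, refineCmd, refineElem, hk2.symm, hk3.symm, hk4.symm]
    have eLF : t.a aLF = s.a aLF := e1 aLF rfl (by norm_num) (by norm_num) (by norm_num)
    have e0 : t.v r1 = 1 := (hf.v r1 rfl).trans (by simp [ev, hvar r1 rfl, h1])
    refine W.le (W.cons_acc rfl trivial (W.cons_acc rfl trivial (W.seq_fr (R := fun t' =>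
      ∃ R, Reps (s.a aLF) (j + 1) R ∧
      (∀ x < s.v rM, t'.a aSN (s.a aLF x) ≠ 0 ↔ ∃ y ∈ R, s.a aLF y = s.a aLF x) ∧
      (∀ o, (∀ x < s.v rM, s.a aLF x ≠ o) → t'.a aSN o = s.a aSN o) ∧
      Lab.Valid ⟨t'.a aLU, t'.a aNW, t'.v rctr⟩ ∧ s.v rctr ≤ t'.v rctr ∧
      (∀ x < s.v rN, s.v rctr ≤ t'.a aLU x) ∧
      ∀ x < s.v rN, ∀ y < s.v rN, t'.a aLU x = t'.a aLU y ↔ ∀ X ∈ R, (x ∈ Lr X ↔ y ∈ Lr X))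
      (T₁ := 150 * (Lr j).length + 68)
      (W.ite (T₁ := 150 * (Lr j).length + 67) ?_ ?_ le_rfl) (T₂ := 5) ?_))) (by omega)
    · intro hm
      simp [ev, hi, eLF] at hm
      refine ⟨by simp [cost], trivial, ?_⟩
      obtain ⟨y, hy, hyx⟩ := (h2 j hj).1 hm
      refine ⟨R, ⟨fun x hx => (hR.lt x hx).trans_le (Nat.le_succ j), fun x hx => ?_, hR.inj,
        hR.nodup⟩, by simpa [ev] using h2, by simpa [ev] using h3, by simpa [ev] using h4,
        by simpa [ev] using h5, by simpa [ev] using h6, by simpa [ev] using h7⟩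
      rcases Nat.lt_succ_iff_lt_or_eq.1 hx with hx | rfl
      · exact hR.cover x hx
      · exact ⟨y, hy, hyx⟩
    · intro hm
      simp [ev, hi, eLF] at hm
      -- An unseen label has no representative yet, which keeps `R` free of two sets with the same
      -- trace.
      have hnew : ∀ y ∈ R, s.a aLF y ≠ s.a aLF j := by
        intro y hy e
        exact (h2 j hj).2 ⟨y, hy, e⟩ hm
      refine W.le (W.cons_acc rfl trivial (W.mono (w_refineCmd (P := P) (Ls := Lr) (by norm_num)
        (by norm_num) (by norm_num) (by norm_num) ?_) le_rfl ?_ |>.frame)) ?_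
      · simp [ev, e1 aHR rfl, e1 aNR rfl, e1 aVR rfl, e1 aCR rfl, hL]
      · intro t' ht' hft
        have em : t'.a aSN = _ := hft.a aSN rfl
        simp [ev, hi, eLF, e0] at ht' em
        have hval := refine_valid h4 (hLn j)
        have hri := refInv_refine h4 (hLn j)
        have hlab := refine_lab_eq_iff h4 (hLn j)
        have hlel : ∀ x, _ := fun x => refine_le_lab h4 (hLn j) (x := x) h5
        rw [← ht'] at hval hri hlab hlel
        refine ⟨R ++ [j], ⟨?_, ?_, ?_, ?_⟩, fun x hx => ?_, fun o ho => ?_, hval, h5.trans hri.le,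
          fun x hx => hlel x (h6 x hx), fun x hx y hy => ?_⟩
        · intro x hx
          rcases List.mem_append.1 hx with hx | hx
          · have := hR.lt x hx; omega
          · simp at hx; omega
        · intro x hx
          rcases Nat.lt_succ_iff_lt_or_eq.1 hx with hx | rfl
          · obtain ⟨y, hy, e⟩ := hR.cover x hx
            exact ⟨y, by simp [hy], e⟩
          · exact ⟨x, by simp, rfl⟩
        · intro x hx y hy e
          simp only [List.mem_append, List.mem_singleton] at hx hy
          rcases hx with hx | rfl <;> rcases hy with hy | rfl
          · exact hR.inj x hx y hy e
          · exact absurd e (hnew x hx)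
          · exact absurd e.symm (hnew y hy)
          · rfl
        · refine List.nodup_append.2 ⟨hR.nodup, by simp, fun x hx y hy => ?_⟩
          simp only [List.mem_singleton] at hy
          have := hR.lt x hx
          omega
        · rw [em]
          simp only [Function.update_apply, List.mem_append, List.mem_singleton]
          split_ifs with hxj
          · simp only [ne_eq, one_ne_zero, not_false_eq_true, true_iff]
            exact ⟨j, Or.inr rfl, hxj.symm⟩
          · rw [h2 x hx]
            constructor
            · rintro ⟨y, hy, e⟩; exact ⟨y, Or.inl hy, e⟩
            · rintro ⟨y, hy | rfl, e⟩
              · exact ⟨y, hy, e⟩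
              · exact absurd e.symm hxj
        · rw [em, Function.update_of_ne (fun e => ho j hj e.symm), h3 o ho]
        · refine (hlab x y).trans ?_
          simp only
          rw [h7 x hx y hy]
          simp only [List.mem_append, List.mem_singleton]
          constructor
          · rintro ⟨g1, g2⟩ X (hX | rfl)
            · exact g1 X hX
            · exact g2
          · exact fun g => ⟨fun X hX => g X (Or.inl hX), g j (Or.inr rfl)⟩
      · simp [ev, hi]
    · rintro t' hft ⟨R', g⟩
      have ei : t'.v ri = _ := hft.v ri rfl
      simp [ev, hi] at ei
      refine ⟨by simp [cost], trivial, ?_⟩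
      simp only [ev, St.set_a, St.set_v]
      refine ⟨by simp [ei], R', by simpa using g⟩
  · rintro t - ⟨-, R, hR, h2, h3, h4, h5, h6, h7⟩
    exact ⟨R, hR, h3, h4, h5, h6, h7⟩
  · rw [Finset.sum_add_distrib, Finset.sum_add_distrib, ← Finset.mul_sum]
    simp
    omega

/-- The state of the pairing of `C` after `j` steps: `K` has been kept, `P` waits for partners. -/
structure PairInv (n : ℕ) (C : List ℕ) (lab pend₀ nx₀ : ℕ → ℕ) (j : ℕ) (K : List ℕ) (P : Finset ℕ)
    (pend nx : ℕ → ℕ) : Prop where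
  cycles : Cycles n nx (K ++ C.drop j)
  sub : ∀ v ∈ P, v ∈ K
  subC : ∀ v ∈ K, v ∈ C
  pendP : ∀ v ∈ P, pend (lab v) = v + 1
  pendC : ∀ u ∈ C, pend (lab u) ≠ 0 → ∃ v ∈ P, pend (lab u) = v + 1 ∧ lab v = lab u
  len : 2 * K.length = j + P.card
  le : K.length ≤ j
  off : ∀ o, (∀ u ∈ C, lab u ≠ o) → pend o = pend₀ o
  cross : ∀ (χ D : ℕ → Prop) [DecidablePred χ] [DecidablePred D],
    (∀ u ∈ C, ∀ v ∈ C, lab u = lab v → ¬ D u → ¬ D v → (χ u ↔ χ v)) →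
    cr n χ nx + 2 * (∑ v ∈ P, if D v then 1 else 0) ≤
      cr n χ nx₀ + 2 * (C.take j).countP fun u => D u

lemma PairInv.init {n : ℕ} {C : List ℕ} {lab pend nx : ℕ → ℕ} (hc : Cycles n nx C)
    (hp : ∀ u ∈ C, pend (lab u) = 0) : PairInv n C lab pend nx 0 [] ∅ pend nx :=
  ⟨by simpa using hc, by simp, by simp, by simp, fun u hu h => absurd (hp u hu) h, by simp, by simp,
    fun _ _ => rfl, fun χ D _ _ _ => by simp⟩

lemma countP_take_succ (C : List ℕ) {j : ℕ} (hj : j < C.length) (D : ℕ → Prop) [DecidablePred D] :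
    ((C.take (j + 1)).countP fun u => decide (D u)) =
      ((C.take j).countP fun u => decide (D u)) + if D C[j] then 1 else 0 := by
  have e : C.take (j + 1) = C.take j ++ [C[j]] := by simp
  rw [e, List.countP_append, List.countP_singleton]
  simp

/-- In `cross`, an element of `D` brings a credit of two when it is met, and retains it while it
waits for a partner. -/
lemma PairInv.keep {n : ℕ} {C : List ℕ} {lab pend₀ nx₀ pend nx : ℕ → ℕ} {j : ℕ} {K : List ℕ}
    {P : Finset ℕ} (h : PairInv n C lab pend₀ nx₀ j K P pend nx) (hj : j < C.length)
    (hp : pend (lab C[j]) = 0) :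
    PairInv n C lab pend₀ nx₀ (j + 1) (K ++ [C[j]]) (insert C[j] P)
      (Function.update pend (lab C[j]) (C[j] + 1)) nx := by
  have hne : ∀ v ∈ P, lab v ≠ lab C[j] := by
    intro v hv e
    have := h.pendP v hv
    rw [e] at this
    omega
  have hnP : C[j] ∉ P := fun hm => hne _ hm rfl
  have hCj : C[j] ∈ C := List.getElem_mem hj
  refine ⟨?_, ?_, ?_, ?_, ?_, ?_, ?_, ?_, ?_⟩
  · have := h.cycles
    rw [List.drop_eq_getElem_cons hj] at this
    simpa using this
  · intro v hv
    rcases Finset.mem_insert.1 hv with rfl | hv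
    · simp
    · simp [h.sub v hv]
  · intro v hv
    rcases List.mem_append.1 hv with hv | hv
    · exact h.subC v hv
    · rw [List.mem_singleton.1 hv]; exact hCj
  · intro v hv
    rcases Finset.mem_insert.1 hv with rfl | hv
    · simp
    · rw [Function.update_of_ne (hne v hv), h.pendP v hv]
  · intro u hu hpu
    by_cases hl : lab u = lab C[j]
    · exact ⟨C[j], by simp, by simp [hl], hl.symm⟩
    · rw [Function.update_of_ne hl] at hpu ⊢
      obtain ⟨v, hv, e⟩ := h.pendC u hu hpu
      exact ⟨v, by simp [hv], e⟩
  · rw [Finset.card_insert_of_notMem hnP, List.length_append, List.length_singleton]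
    have := h.len
    omega
  · have := h.le
    simp only [List.length_append, List.length_singleton]; omega
  · intro o ho
    rw [Function.update_of_ne (fun e => ho _ hCj e.symm), h.off o ho]
  · intro χ D _ _ hχ
    have := h.cross χ D hχ
    rw [Finset.sum_insert hnP, countP_take_succ C hj]
    omega

/-- The waiting partner stays as representative of the merged cycle. If the merge separates the two
for `χ`, then one of them is in `D`, and its credit pays for the at most two new crossings. -/
lemma PairInv.merge {n : ℕ} {C : List ℕ} {lab pend₀ nx₀ pend nx : ℕ → ℕ} {j : ℕ} {K : List ℕ}
    {P : Finset ℕ} (h : PairInv n C lab pend₀ nx₀ j K P pend nx) (hj : j < C.length)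
    (hp : pend (lab C[j]) ≠ 0) :
    PairInv n C lab pend₀ nx₀ (j + 1) K (P.erase (pend (lab C[j]) - 1))
      (Function.update pend (lab C[j]) 0) (swapVal nx C[j] (pend (lab C[j]) - 1)) := by
  have hCj : C[j] ∈ C := List.getElem_mem hj
  obtain ⟨v, hv, e, hlv⟩ := h.pendC _ hCj hp
  rw [e, Nat.add_sub_cancel]
  have hvK := h.sub v hv
  have hcyc := h.cycles
  rw [List.drop_eq_getElem_cons hj] at hcyc
  obtain ⟨hnd, hlt⟩ := hcyc.sublist_perm
  have hltv := hlt v (by simp [hvK])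
  have hltj := hlt C[j] (List.mem_append_right _ (List.mem_cons_self))
  have hne : C[j] ≠ v := by
    rintro e
    exact (List.disjoint_of_nodup_append hnd) hvK (by simp [e])
  have hne' : ∀ w ∈ P.erase v, lab w ≠ lab C[j] := by
    intro w hw e'
    have h1 := h.pendP w (Finset.mem_of_mem_erase hw)
    rw [e', e] at h1
    exact Finset.ne_of_mem_erase hw (by omega)
  refine ⟨hcyc.merge hvK, ?_, h.subC, ?_, ?_, ?_, ?_, ?_, ?_⟩
  · exact fun w hw => h.sub w (Finset.mem_of_mem_erase hw)
  · intro w hw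
    rw [Function.update_of_ne (hne' w hw), h.pendP w (Finset.mem_of_mem_erase hw)]
  · intro u hu hpu
    by_cases hl : lab u = lab C[j]
    · simp [hl] at hpu
    · rw [Function.update_of_ne hl] at hpu ⊢
      obtain ⟨w, hw, e1, e2⟩ := h.pendC u hu hpu
      refine ⟨w, Finset.mem_erase.2 ⟨?_, hw⟩, e1, e2⟩
      rintro rfl
      exact hl (e2.symm.trans hlv)
  -- `j` grows by one and the number of waiting elements falls by one, so the number of kept
  -- elements is unchanged.
  · have h1 := Finset.card_erase_add_one hv
    have := h.len
    omega
  · have := h.le; omega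
  · intro o ho
    rw [Function.update_of_ne (fun e => ho _ hCj e.symm), h.off o ho]
  · intro χ D _ _ hχ
    have h1 := h.cross χ D hχ
    have h2 := cr_swapVal χ nx hltj hltv hne
    rw [countP_take_succ C hj]
    rw [← Finset.add_sum_erase _ _ hv] at h1
    have h3 : (if (χ C[j] ↔ χ v) then 0 else 1) ≤
        (if D C[j] then 1 else 0) + if D v then 1 else 0 := by
      by_cases g1 : D C[j]
      · simp only [g1, if_true]; split_ifs <;> omega
      · by_cases g2 : D v
        · simp only [g1, g2, if_true, if_false]; split_ifs <;> omega
        · simp [hχ _ hCj v (h.subC v hvK) hlv.symm g1 g2]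
    omega

lemma w_pairCmd {n : ℕ} {C : List ℕ} (hk : s.v rk = C.length) (hC : Holds (s.a aCU) C)
    (h0 : s.v r0 = 0) (h1 : s.v r1 = 1) (hp : ∀ u ∈ C, s.a aPD (s.a aLU u) = 0)
    (hcyc : Cycles n (s.a aNX) C) :
    W π pairCmd s (200 * C.length + 20) fun t => ∃ C' : List ℕ, Holds (t.a aCU) C' ∧
      t.v rk = C'.length ∧ Cycles n (t.a aNX) C' ∧
      2 * C'.length ≤ C.length + (C.toFinset.image (s.a aLU)).card ∧
      (∀ o, (∀ u ∈ C, s.a aLU u ≠ o) → t.a aPD o = s.a aPD o) ∧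
      ∀ (χ D : ℕ → Prop) [DecidablePred χ] [DecidablePred D],
        (∀ u ∈ C, ∀ v ∈ C, s.a aLU u = s.a aLU v → ¬ D u → ¬ D v → (χ u ↔ χ v)) →
        cr n χ (t.a aNX) ≤ cr n χ (s.a aNX) + 2 * C.countP fun u => D u := by
  unfold pairCmd
  refine W.le (W.cons_one rfl (Nat.zero_le _) (W.cons_one rfl (Nat.zero_le _)
    (W.cons_one rfl trivial (W.seq_fr (W.rep_const (fun j t => t.v ri = j ∧ ∃ K P,
      PairInv n C (s.a aLU) (s.a aPD) (s.a aNX) j K P (t.a aPD) (t.a aNX) ∧ t.v rk2 = K.length ∧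
      Holds (t.a aCU) K ∧ ∀ i (hi : i < C.length), j ≤ i → t.a aCU i = C[i]) 170 (n := C.length)
      ?_ ?_ ?_ le_rfl fun t _ h => h)
      (T₂ := 1) ?_)))) (by omega)
  · simp [ev, hk]
  -- The kept elements overwrite a prefix of the array of representatives in place; this is harmless
  -- since at most `j` have been kept after `j` steps, so the unread entries survive.
  · refine ⟨by simp [ev], [], ∅, by simpa [ev] using PairInv.init hcyc hp, by simp [ev],
      fun j hj => by simp at hj, fun i hi _ => ?_⟩
    simpa [ev] using hC i hi
  · rintro j hj t hf ⟨hi, K, P, hI, hlen, hK, hrest⟩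
    have e0 : t.v r0 = 0 := (hf.v r0 rfl).trans (by simp [ev, h0])
    have e1 : t.v r1 = 1 := (hf.v r1 rfl).trans (by simp [ev, h1])
    have eU : t.a aLU = s.a aLU := (hf.a aLU rfl).trans (by simp [ev])
    have eC : t.a aCU j = C[j] := hrest j hj le_rfl
    refine ⟨?_, ?_, ?_⟩
    · simp only [pairElem, cost]; split_ifs <;> norm_num
    · simp [pairElem, Saf]
    · by_cases hcase : t.a aPD (s.a aLU C[j]) = 0
      · simp only [pairElem, ev, St.set_v, St.set_a, St.put_v, St.put_a]
        have hle := hI.le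
        refine ⟨by simp [hi, eC, eU, hcase], K ++ [C[j]], insert C[j] P, ?_, ?_, ?_, ?_⟩
        · simpa [hi, eC, eU, hcase] using hI.keep hj hcase
        · simp [hi, eC, eU, hcase, hlen]
        · have : Holds (Function.update (t.a aCU) K.length C[j]) (K ++ [C[j]]) := by
            intro i hi'
            simp only [List.length_append, List.length_singleton] at hi'
            by_cases hiK : i = K.length
            · subst hiK; simp
            · rw [Function.update_of_ne hiK, hK i (by omega), List.getElem_append_left]
          simpa [hi, eC, eU, hcase, hlen] using this
        · intro i hi' hji
          have : Function.update (t.a aCU) K.length C[j] i = C[i] := by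
            rw [Function.update_of_ne (by omega)]
            exact hrest i hi' (by omega)
          simpa [hi, eC, eU, hcase, hlen] using this
      · simp only [pairElem, ev, St.set_v, St.set_a, St.put_v, St.put_a]
        refine ⟨by simp [hi, eC, eU, hcase], K, P.erase (t.a aPD (s.a aLU C[j]) - 1), ?_, ?_, ?_,
          ?_⟩
        · simpa [hi, eC, eU, hcase, e0, e1, BinOp.eval, swapVal] using hI.merge hj hcase
        · simp [hi, eC, eU, hcase, hlen]
        · simpa [hi, eC, eU, hcase] using hK
        · intro i hi' hji
          have := hrest i hi' (by omega)
          simpa [hi, eC, eU, hcase] using this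
  · rintro t hf ⟨-, K, P, hI, hlen, hK, -⟩
    refine ⟨le_rfl, trivial, ?_⟩
    refine ⟨K, by simpa [ev] using hK, by simp [ev, hlen], ?_, ?_, ?_, ?_⟩
    · have := hI.cycles
      simpa [ev] using this
    · have h2 := hI.len
      -- Each class has at most one waiting element, because the table of waiting elements stores it
      -- at the label of the class.
      have h3 : P.card ≤ (C.toFinset.image (s.a aLU)).card := by
        refine Finset.card_le_card_of_injOn (s.a aLU) (fun v hv => ?_) fun v hv w hw e => ?_
        · simp only [Finset.coe_image, Set.mem_image, Finset.mem_coe, List.mem_toFinset]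
          exact ⟨v, hI.subC v (hI.sub v hv), rfl⟩
        · have a1 := hI.pendP v hv
          have a2 := hI.pendP w hw
          rw [e] at a1
          omega
      omega
    · simpa [ev] using hI.off
    · intro χ D _ _ hχ
      have := hI.cross χ D hχ
      simp only [List.take_length] at this
      simp only [ev, St.set_a]
      omega

/-- Loops of `H` have a length fixed in advance, so `k` is halved `k` times, which is affordable;
only halvings with a nonzero result are counted. -/
lemma w_flagCmd (h2 : s.v r2 = 2) :
    W π flagCmd s (50 * s.v rk + 20) fun t =>
      t.v rL = Nat.log 2 (s.v rk) ∧ t.v rf = Nat.log 2 (s.v rk) - s.v rK := by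
  unfold flagCmd
  refine W.le (W.cons_one rfl trivial (W.cons_one rfl (Nat.zero_le _) (W.cons_one rfl trivial
    (W.seq_fr (W.rep_const (fun j t => t.v rt = s.v rk / 2 ^ j ∧
      t.v rL = min j (Nat.log 2 (s.v rk))) 20 (n := s.v rk) ?_ ?_ ?_ le_rfl fun t _ h => h)
      (T₂ := 1) ?_)))) (by omega)
  · simp [ev]
  · simp [ev]
  · rintro j hj t hf ⟨g1, g2⟩
    have e2 : t.v r2 = 2 := (hf.v r2 rfl).trans (by simp [ev, h2])
    refine ⟨?_, ?_, ?_⟩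
    · simp only [cost]; split_ifs <;> norm_num
    · simp [Saf]
    · have hd : s.v rk / 2 ^ j / 2 = s.v rk / 2 ^ (j + 1) := by
        rw [Nat.div_div_eq_div_mul, pow_succ]
      have hz : s.v rk / 2 ^ (j + 1) = 0 ↔ Nat.log 2 (s.v rk) < j + 1 := by
        rw [Nat.div_eq_zero_iff_lt (by positivity)]
        exact (Nat.log_lt_iff_lt_pow (by norm_num) (by omega)).symm
      by_cases hc : s.v rk / 2 ^ (j + 1) = 0
      · have := hz.1 hc
        simp [ev, e2, g1, g2, BinOp.eval, hd, hc]; omega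
      · have := mt hz.2 hc
        simp [ev, e2, g1, g2, BinOp.eval, hd, hc]; omega
  · rintro t hf ⟨g1, g2⟩
    have eK : t.v rK = s.v rK := (hf.v rK rfl).trans (by simp [ev])
    have hlt : Nat.log 2 (s.v rk) ≤ s.v rk := Nat.log_le_self _ _
    refine ⟨le_rfl, trivial, ?_⟩
    simp [ev, g2, eK, BinOp.eval, hlt]

lemma w_sizeCmd (h1 : s.v r1 = 1) (hB : s.v rf * s.v rQQ ≤ π.B₀)
    (hB' : 2 ^ (s.v rf * s.v rQQ / s.v rDD) ≤ π.B₀) :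
    W π sizeCmd s (10 * (s.v rf * s.v rQQ / s.v rDD) + 20) fun t =>
      t.v rs = 2 ^ (s.v rf * s.v rQQ / s.v rDD) ∧ t.v rk1 = s.v rk - 1 := by
  have h1B : 1 ≤ π.B₀ := le_trans Nat.one_le_two_pow hB'
  unfold sizeCmd
  refine W.le (W.cons_one rfl hB (W.cons_one rfl trivial (W.cons_one rfl h1B
    (W.seq_fr (W.rep_const (fun j t => t.v rs = 2 ^ j) 1 (n := s.v rf * s.v rQQ / s.v rDD)
      ?_ ?_ ?_ le_rfl fun t _ h => h) (T₂ := 1) ?_)))) (by omega)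
  · simp [ev, BinOp.eval]
  · simp [ev]
  · rintro j hj t hf g
    refine ⟨le_rfl, ?_, ?_⟩
    · simp only [Saf, g]
      refine le_trans ?_ hB'
      rw [← two_mul, ← pow_succ']
      exact Nat.pow_le_pow_right (by norm_num) hj
    · simp [ev, g, BinOp.eval, pow_succ]; omega
  · rintro t hf g
    have e1 : t.v r1 = 1 := (hf.v r1 rfl).trans (by simp [ev, h1])
    have ek : t.v rk = s.v rk := (hf.v rk rfl).trans (by simp [ev])
    refine ⟨le_rfl, trivial, ?_⟩
    simp [ev, g, e1, ek, BinOp.eval]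

end Welzl

/-! ### Correctness of the final merging, the output and the reading of the input -/

namespace Welzl

variable {π : Par} {s : St} {Q : St → Prop} {T : ℕ}

/-- The remaining cycles are merged into the first one regardless of classes, at a cost of at most
two crossings each. The empty list of representatives, which occurs for an empty ground set, is
treated separately. -/
lemma w_joinCmd {n : ℕ} {C : List ℕ} (hk : s.v rk = C.length) (hC : Holds (s.a aCU) C)
    (h0 : s.v r0 = 0) (h1 : s.v r1 = 1) (hcyc : Cycles n (s.a aNX) C) (hB : 1 ≤ π.B₀) :
    W π joinCmd s (150 * C.length + 30) fun t =>
      (∀ r, C.head? = some r → t.v rw' = r ∧ Cycles n (t.a aNX) [r]) ∧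
      ∀ (χ : ℕ → Prop) [DecidablePred χ],
        cr n χ (t.a aNX) ≤ cr n χ (s.a aNX) + 2 * C.length := by
  cases C with
  | nil =>
    unfold joinCmd
    refine W.le (W.cons_acc rfl trivial (W.cons_one rfl hB (W.cons_one rfl trivial
      (W.rep_const (fun j t => t.a aNX = s.a aNX) 0 (n := 0) ?_ ?_ ?_ le_rfl ?_)))) ?_
    · simp at hk
      simp [ev, hk, BinOp.eval]
    · simp [ev]
    · simp
    · intro t hf h
      refine ⟨by simp, fun χ _ => ?_⟩
      rw [h]; simp
    · simp
  | cons r C =>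
    unfold joinCmd
    refine W.le (W.cons_acc rfl trivial (W.cons_one rfl hB (W.cons_one rfl trivial
      (W.rep_const (fun j t => t.v ri = j + 1 ∧ Cycles n (t.a aNX) (r :: C.drop j) ∧
        ∀ (χ : ℕ → Prop) [DecidablePred χ], cr n χ (t.a aNX) ≤ cr n χ (s.a aNX) + 2 * j) 120
        (n := C.length) ?_ ?_ ?_ le_rfl ?_)))) ?_
    · simp at hk
      simp [ev, hk, h1, BinOp.eval]
    · simpa [ev] using hcyc
    · rintro j hj t hf ⟨g1, g2, g3⟩
      have hr : s.a aCU 0 = r := hC 0 (by simp)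
      have er : t.v rw' = r := (hf.v rw' rfl).trans (by simp [ev, h0, hr])
      have eC : t.a aCU (j + 1) = C[j] := by
        rw [hf.a aCU rfl]
        have := hC (j + 1) (by simpa using hj)
        rw [List.getElem_cons_succ] at this
        simpa [ev] using this
      rw [List.drop_eq_getElem_cons hj] at g2
      refine ⟨?_, ?_, ?_⟩
      · simp [cost]
      · simp [Saf]
      · obtain ⟨hnd, hlt⟩ := g2.sublist_perm
        have hne : C[j] ≠ r := by
          simp only [List.nodup_cons, List.mem_cons, not_or] at hnd
          exact Ne.symm hnd.1.1
        have hm := Cycles.merge (l₁ := [r]) (l₂ := C.drop (j + 1)) (u := C[j]) g2 (v := r) (by simp)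
        refine ⟨by simp [ev, g1], ?_, fun χ _ => ?_⟩
        · simpa [ev, g1, eC, er, swapVal] using hm
        · have hc := cr_swapVal χ (t.a aNX) (hlt C[j] (List.mem_cons_of_mem _ List.mem_cons_self)) (hlt r List.mem_cons_self) hne
          have h3 := g3 χ
          have h4 : (2 * if (χ C[j] ↔ χ r) then 0 else 1) ≤ 2 := by split_ifs <;> omega
          have h5 : cr n χ (swapVal (t.a aNX) C[j] r) ≤ cr n χ (s.a aNX) + 2 * (j + 1) := by
            omega
          simpa [ev, g1, eC, er, swapVal] using h5
    · rintro t hf ⟨g1, g2, g3⟩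
      have hr : s.a aCU 0 = r := hC 0 (by simp)
      have er : t.v rw' = r := (hf.v rw' rfl).trans (by simp [ev, h0, hr])
      refine ⟨fun r' hr' => ?_, fun χ _ => ?_⟩
      · simp only [List.head?_cons, Option.some.injEq] at hr'
        subst hr'
        exact ⟨er, by simpa using g2⟩
      · have := g3 χ
        simp only [List.length_cons]; omega
    · simp only [List.length_cons]; omega

lemma w_outputCmd (hb : s.v rN ≤ π.b) :
    W π outputCmd s (40 * s.v rN + 20) fun t =>
      ∀ i < s.v rN, t.io i = (s.a aNX)^[i] (s.v rw') := by
  unfold outputCmd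
  refine W.le (W.cons_one rfl (Nat.zero_le _) (W.cons_one rfl trivial
    (W.rep_const (fun j t => t.v ri = j ∧ t.v rw' = (s.a aNX)^[j] (s.v rw') ∧
      ∀ i < j, t.io i = (s.a aNX)^[i] (s.v rw')) 25
      (n := s.v rN) ?_ ?_ ?_ le_rfl fun t _ h => h.2.2))) (by omega)
  · simp [ev]
  · simp [ev]
  · rintro j hj t hf ⟨g1, g2, g3⟩
    have eX : t.a aNX = s.a aNX := (hf.a aNX rfl).trans (by simp [ev])
    refine ⟨?_, ?_, ?_⟩
    · simp [cost]
    · simp [Saf, g1]; omega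
    · refine ⟨by simp [ev, g1], ?_, fun i hi => ?_⟩
      · rw [Function.iterate_succ_apply']
        simp [ev, eX, g2]
      · by_cases hij : i = j
        · subst hij; simp [ev, g1, g2]
        · have := g3 i (by omega)
          simpa [ev, g1, hij] using this

lemma w_initCmd (hB : 1 ≤ π.B₀) :
    W π initCmd s (60 * s.v rN + 20) fun t =>
      (∀ i < s.v rN, t.a aCU i = i ∧ t.a aNX i = i) ∧ t.v rk = s.v rN ∧ t.v rctr = 1 := by
  unfold initCmd
  refine W.le (W.cons_one rfl (Nat.zero_le _) (W.cons_one rfl trivial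
    (W.seq_fr (W.rep_const (fun j t => t.v ri = j ∧ ∀ i < j, t.a aCU i = i ∧ t.a aNX i = i) 40
      (n := s.v rN) ?_ ?_ ?_ le_rfl fun t _ h => h.2) (T₂ := 3) ?_))) (by omega)
  · simp [ev]
  · simp [ev]
  · rintro j hj t hf ⟨g1, g2⟩
    refine ⟨?_, ?_, ?_⟩
    · simp [cost]
    · simp [Saf]
    · refine ⟨by simp [ev, g1], fun i hi => ?_⟩
      by_cases hij : i = j
      · subst hij; simp [ev, g1]
      · have := g2 i (by omega)
        simpa [ev, g1, hij] using this
  · rintro t hf g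
    have eN : t.v rN = s.v rN := (hf.v rN rfl).trans (by simp [ev])
    refine ⟨by simp [cost], ⟨trivial, hB⟩, ?_⟩
    exact ⟨by simpa [ev] using g, by simp [ev, eN], by simp [ev]⟩

lemma w_headerCmd {n m q c d : ℕ} (h0 : s.v r0 = 0) (hb : 5 ≤ π.b) (hB : 4 ≤ π.B₀)
    (hn : s.io 0 = n) (hm : s.io 1 = m) (hq : s.io 2 = q) (hc : s.io 3 = c) (hd : s.io 4 = d)
    (hK : (d / q + 2) * (c / q + 1) ≤ π.B₀) (hqq : q * q ≤ π.B₀) (hdd : d * d ≤ π.B₀) :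
    W π headerCmd s 60 fun t => t.v rN = n ∧ t.v rM = m ∧
      t.v rK = (d / q + 2) * (c / q + 1) + 1 ∧ t.v rQQ = q * q ∧ t.v rDD = d * d ∧
      t.v r1 = 1 ∧ t.v r2 = 2 := by
  refine ⟨by simp [headerCmd, cost], ?_, ?_⟩
  · simp [headerCmd, Saf, ev, h0, BinOp.eval, hq, hc, hd, hK, hqq, hdd]
    omega
  · simp [headerCmd, ev, h0, BinOp.eval, hn, hm, hq, hc, hd]

/-- The incidence pairs `E` are stored both by their first and by their second components. -/
structure Stored (s : St) (P : ℕ) (E : List (ℕ × ℕ)) : Prop where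
  row : Lists (s.a aHR) (s.a aNR) (s.a aVR) (s.a aCR) P
    fun x => (E.filter fun e => e.1 = x).map Prod.snd
  col : Lists (s.a aHC) (s.a aNC) (s.a aVC) (s.a aCC) P
    fun u => (E.filter fun e => e.2 = u).map Prod.fst

lemma Stored.congr {s t : St} {P : ℕ} {E : List (ℕ × ℕ)} (h : Stored s P E)
    (ha : ∀ k < 8, t.a k = s.a k) : Stored t P E :=
  ⟨by simpa only [ha aHR (by norm_num), ha aNR (by norm_num), ha aVR (by norm_num),
      ha aCR (by norm_num)] using h.row,
    by simpa only [ha aHC (by norm_num), ha aNC (by norm_num), ha aVC (by norm_num),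
      ha aCC (by norm_num)] using h.col⟩

/-- Rows and columns are both filtered from one list `E`, so putting a single pair in front of `E`
describes the update of both list structures; they use the same node number `P` in separate arrays.
-/
lemma w_parseElem {P : ℕ} {E : List (ℕ × ℕ)} (hE : Stored s P E) (hp : s.v rp = P)
    (hb : s.v rpos < π.b) :
    W π parseElem s 300 fun t => Stored t (P + 1) ((s.v ri, s.io (s.v rpos)) :: E) ∧
      t.v rp = P + 1 ∧ t.v rpos = s.v rpos + 1 := by
  refine ⟨by simp [parseElem, prependCmd, cost], ?_, ?_, ?_, ?_⟩
  · simp [parseElem, prependCmd, Saf, hb]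
  · constructor
    · have := hE.row.prepend (s.v ri) (s.io (s.v rpos))
      convert this using 1
      · simp [parseElem, prependCmd, ev, hp]
      · simp [parseElem, prependCmd, ev, hp]
      · simp [parseElem, prependCmd, ev, hp]
      · simp [parseElem, prependCmd, ev]
      · funext x
        by_cases hx : s.v ri = x
        · subst hx; simp
        · simp [hx, Ne.symm hx]
    · have := hE.col.prepend (s.io (s.v rpos)) (s.v ri)
      convert this using 1
      · simp [parseElem, prependCmd, ev, hp]
      · simp [parseElem, prependCmd, ev, hp]
      · simp [parseElem, prependCmd, ev, hp]
      · simp [parseElem, prependCmd, ev]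
      · funext x
        by_cases hx : s.io (s.v rpos) = x
        · subst hx; simp
        · simp [hx, Ne.symm hx]
  · simp [parseElem, prependCmd, ev, hp]
  · simp [parseElem, prependCmd, ev]

/-- The rows are written in the input-output area from address `pos 0` on. -/
structure Written (io : ℕ → ℕ) (b : ℕ) (rows : List (List ℕ)) (pos : ℕ → ℕ) : Prop where
  start : pos 0 = 5
  succ : ∀ x (hx : x < rows.length), pos (x + 1) = pos x + 1 + rows[x].length
  len : ∀ x (hx : x < rows.length), io (pos x) = rows[x].length
  elem : ∀ x (hx : x < rows.length), ∀ j (hj : j < rows[x].length),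
    io (pos x + 1 + j) = rows[x][j]
  lt : ∀ x (hx : x < rows.length), pos x + rows[x].length < b

lemma w_parseCmd {rows : List (List ℕ)} {pos : ℕ → ℕ} (hw : Written s.io π.b rows pos)
    (hm : s.v rM = rows.length) (hn : ∀ r ∈ rows, r.Nodup) (ha : ∀ k < 8, ∀ i, s.a k i = 0)
    (hB : 5 ≤ π.B₀) :
    W π parseCmd s (310 * (rows.map List.length).sum + 30 * rows.length + 30) fun t =>
      ∃ P E, Stored t P E ∧ E.Nodup ∧ E.length = (rows.map List.length).sum ∧
        ∀ x u, (x, u) ∈ E ↔ ∃ hx : x < rows.length, u ∈ rows[x] := by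
  unfold parseCmd
  refine W.le (W.cons_one rfl (Nat.zero_le _) (W.cons_one rfl hB (W.cons_one rfl (Nat.zero_le _)
    (W.cons_one rfl trivial (W.rep (fun j t => t.v ri = j ∧ t.v rpos = pos j ∧ ∃ P E,
      Stored t P E ∧ t.v rp = P ∧ E.Nodup ∧ E.length = ((rows.take j).map List.length).sum ∧
        ∀ x u, (x, u) ∈ E ↔ ∃ hx : x < rows.length, x < j ∧ u ∈ rows[x])
      (fun j => (rows.getD j []).length * 307 + 16) (n := rows.length) ?_ ?_ ?_ le_rfl ?_))))) ?_
  · simp [ev, hm]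
  · refine ⟨by simp [ev], by simp [ev, hw.start], 0, [], ⟨fun i => ?_, fun i => ?_⟩, by simp [ev],
      by simp, by simp, by simp⟩
    · simp [ev, ha, Chain]
    · simp [ev, ha, Chain]
  · rintro x hx t hf ⟨g1, g2, P, E, g3, g4, g5, g6, g7⟩
    have eio : t.io = s.io := (hf.io rfl).trans (by simp [ev])
    have elen : t.io (t.v rpos) = rows[x].length := by rw [eio, g2, hw.len x hx]
    have hget : rows.getD x [] = rows[x] := by simp [hx]
    rw [hget]
    have hlt := hw.lt x hx
    refine W.le (W.cons_one rfl (show t.v rpos < π.b by omega) (W.cons (T₁ := 5) rfl trivial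
      (W.seq_fr (W.rep_const (n := rows[x].length) (fun j t' => t'.v rpos = pos x + 1 + j ∧ ∃ P E,
        Stored t' P E ∧ t'.v rp = P ∧ E.Nodup ∧
        E.length = ((rows.take x).map List.length).sum + j ∧
        ∀ y u, (y, u) ∈ E ↔ ∃ hy : y < rows.length, (y < x ∧ u ∈ rows[y]) ∨
          (y = x ∧ u ∈ rows[y].take j)) 300 ?_ ?_ ?_ le_rfl fun t _ h => h) (T₂ := 5)
          ?_))) (by omega)
    · simp [ev, elen]
    · refine ⟨by simp [ev, g2], P, E, g3.congr fun k _ => by simp [ev], by simpa [ev] using g4, g5,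
        by simpa using g6, fun y u => ?_⟩
      rw [g7]; simp
    · rintro j hj t' hf' ⟨k1, P', E', k2, k3, k4, k5, k6⟩
      have eio' : t'.io = s.io := (hf'.io rfl).trans (by simpa [ev] using eio)
      have ei : t'.v ri = x := (hf'.v ri rfl).trans (by simp [ev, g1])
      have eel : t'.io (t'.v rpos) = rows[x][j] := by rw [eio', k1, hw.elem x hx j hj]
      refine W.mono (w_parseElem k2 k3 (by rw [k1]; omega)) le_rfl ?_
      rw [ei, eel]
      rintro t'' ⟨l1, l2, l3⟩
      have hnd := hn _ (List.getElem_mem hx)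
      refine ⟨by simp [l3, k1]; omega, P' + 1, (x, rows[x][j]) :: E',
        l1.congr fun k _ => by simp, by simpa using l2, ?_, by simp [k5]; omega, fun y u => ?_⟩
      -- Rows have no repetitions, so the pair just read is new.
      · refine List.nodup_cons.2 ⟨fun hmem => ?_, k4⟩
        obtain ⟨hy, ⟨h, -⟩ | ⟨-, h⟩⟩ := (k6 _ _).1 hmem
        · omega
        · exact getElem_not_mem_take hnd hj h
      · rw [List.mem_cons, k6, Prod.mk.injEq]
        constructor
        · rintro (⟨rfl, rfl⟩ | ⟨hy, h | ⟨rfl, h⟩⟩)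
          · exact ⟨hx, Or.inr ⟨rfl, (mem_take_succ hj _).2 (Or.inr rfl)⟩⟩
          · exact ⟨hy, Or.inl h⟩
          · exact ⟨hy, Or.inr ⟨rfl, (mem_take_succ hj _).2 (Or.inl h)⟩⟩
        · rintro ⟨hy, h | ⟨rfl, h⟩⟩
          · exact Or.inr ⟨hy, Or.inl h⟩
          · rcases (mem_take_succ hj _).1 h with h | h
            · exact Or.inr ⟨hy, Or.inr ⟨rfl, h⟩⟩
            · exact Or.inl ⟨rfl, h⟩
    · rintro t' hf' ⟨k1, P', E', k2, k3, k4, k5, k6⟩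
      have ei : t'.v ri = x := (hf'.v ri rfl).trans (by simp [ev, g1])
      refine ⟨by simp [cost], trivial, by simp [ev, ei], by simp [ev, k1, hw.succ x hx], P', E',
        k2.congr fun k _ => by simp [ev], by simpa [ev] using k3, k4, ?_, fun y u => ?_⟩
      · rw [k5, ← List.take_concat_get' _ _ hx, List.map_append, List.sum_append]; simp
      · rw [k6]
        constructor
        · rintro ⟨hy, h | ⟨rfl, h⟩⟩
          · exact ⟨hy, by omega, h.2⟩
          · exact ⟨hy, by omega, List.mem_of_mem_take h⟩
        · rintro ⟨hy, h, hu⟩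
          rcases Nat.lt_succ_iff_lt_or_eq.1 h with h | rfl
          · exact ⟨hy, Or.inl ⟨h, hu⟩⟩
          · exact ⟨hy, Or.inr ⟨rfl, by simpa using hu⟩⟩
  · rintro t - ⟨-, -, P, E, g3, g4, g5, g6, g7⟩
    refine ⟨P, E, g3, g5, by simpa using g6, fun x u => ?_⟩
    rw [g7]
    exact ⟨fun ⟨h1, _, h3⟩ => ⟨h1, h3⟩, fun ⟨h1, h3⟩ => ⟨h1, h1, h3⟩⟩
  · have : ∑ j ∈ Finset.range rows.length, (rows.getD j []).length =
        (rows.map List.length).sum := by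
      rw [Finset.sum_range, ← List.sum_ofFn]
      congr 1
      refine List.ext_getElem (by simp) fun i h1 h2 => by
        simp
    rw [Finset.sum_add_distrib, Finset.sum_add_distrib, ← Finset.sum_mul, this]
    simp
    omega

end Welzl

/-! ### One round, and averages over random samples -/

namespace Welzl

variable {π : Par} {s : St} {Q : St → Prop} {T : ℕ}

/-- The parameters that are constant during the main loop. -/
structure Env where
  n : ℕ
  m : ℕ
  K : ℕ
  qq : ℕ
  dd : ℕ
  P : ℕ
  E : List (ℕ × ℕ)

/-- The invariant of the main loop, except for the marks. The representatives are `C`. -/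
structure MInv (e : Env) (s : St) (C : List ℕ) : Prop where
  n : s.v rN = e.n
  m : s.v rM = e.m
  K : s.v rK = e.K
  qq : s.v rQQ = e.qq
  dd : s.v rDD = e.dd
  zero : s.v r0 = 0
  one : s.v r1 = 1
  two : s.v r2 = 2
  stored : Stored s e.P e.E
  k : s.v rk = C.length
  cur : Holds (s.a aCU) C
  f : s.v rf = Nat.log 2 C.length - e.K
  cycles : Cycles e.n (s.a aNX) C
  validF : Lab.Valid ⟨s.a aLF, s.a aNW, s.v rctr⟩
  validU : Lab.Valid ⟨s.a aLU, s.a aNW, s.v rctr⟩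
  seen : ∀ o, s.v rctr ≤ o → s.a aSN o = 0
  pend : ∀ o, s.v rctr ≤ o → s.a aPD o = 0

/-- The result of a round with representatives `C` and sample `A`: `R` contains one set for each
trace on `A`, and `C'` are the new representatives. -/
structure Outcome (e : Env) (A : ℕ → Prop) (C C' R : List ℕ) (nx nx' : ℕ → ℕ) : Prop where
  lt : ∀ x ∈ R, x < e.m
  cover : ∀ x < e.m, ∃ y ∈ R, ∀ u ∈ C, A u → ((y, u) ∈ e.E ↔ (x, u) ∈ e.E)
  inj : ∀ x ∈ R, ∀ y ∈ R, (∀ u ∈ C, A u → ((x, u) ∈ e.E ↔ (y, u) ∈ e.E)) → x = y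
  nodup : R.Nodup
  card : 2 * C'.length ≤ C.length +
    (C.toFinset.image fun u => R.toFinset.filter fun x => (x, u) ∈ e.E).card
  cross : ∀ (χ D : ℕ → Prop) [DecidablePred χ] [DecidablePred D],
    (∀ u ∈ C, ∀ v ∈ C, (∀ x ∈ R, (x, u) ∈ e.E ↔ (x, v) ∈ e.E) → ¬ D u → ¬ D v → (χ u ↔ χ v)) →
    cr e.n χ nx' ≤ cr e.n χ nx + 2 * C.countP fun u => D u

/-- Each incidence lies in a single column, so visiting the columns of distinct elements takes time
linear in the number of incidences. -/
lemma sum_filter_snd_le (E : List (ℕ × ℕ)) {C : List ℕ} (hC : C.Nodup) :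
    (C.map fun u => ((E.filter fun e => e.2 = u).map Prod.fst).length).sum ≤ E.length := by
  induction E with
  | nil => simp
  | cons e E ih =>
    have h : ∀ u, (((e :: E).filter fun e => e.2 = u).map Prod.fst).length =
        (if e.2 = u then 1 else 0) + ((E.filter fun e => e.2 = u).map Prod.fst).length := by
      intro u
      by_cases h : e.2 = u <;> simp [h, add_comm]
    simp only [h, List.sum_map_add]
    have h2 : (C.map fun u => if e.2 = u then 1 else 0).sum ≤ 1 := by
      have : (C.map fun u => if e.2 = u then 1 else 0).sum = C.count e.2 := by
        rw [List.count_eq_countP]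
        clear hC ih h
        induction C with
        | nil => rfl
        | cons a C ih =>
          rw [List.map_cons, List.sum_cons, ih, List.countP_cons, add_comm]
          by_cases h : e.2 = a
          · simp [h]
          · simp [h, Ne.symm h]
      rw [this]
      exact List.nodup_iff_count_le_one.1 hC _
    simp only [List.length_cons]
    omega

lemma sum_filter_fst_le (E : List (ℕ × ℕ)) (m : ℕ) :
    ∑ x ∈ Finset.range m, ((E.filter fun e => e.1 = x).map Prod.snd).length ≤ E.length := by
  induction E with
  | nil => simp
  | cons e E ih =>
    have h : ∀ u, (((e :: E).filter fun e => e.1 = u).map Prod.snd).length =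
        (if e.1 = u then 1 else 0) + ((E.filter fun e => e.1 = u).map Prod.snd).length := by
      intro u
      by_cases h : e.1 = u <;> simp [h, add_comm]
    simp only [h, Finset.sum_add_distrib]
    have h2 : (∑ x ∈ Finset.range m, if e.1 = x then 1 else 0) ≤ 1 := by
      rw [Finset.sum_ite_eq]
      split_ifs <;> omega
    simp only [List.length_cons]
    omega

lemma mem_row {E : List (ℕ × ℕ)} {x u : ℕ} :
    u ∈ (E.filter fun e => e.1 = x).map Prod.snd ↔ (x, u) ∈ E := by
  simp

lemma mem_col {E : List (ℕ × ℕ)} {x u : ℕ} :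
    x ∈ (E.filter fun e => e.2 = u).map Prod.fst ↔ (x, u) ∈ E := by
  simp

lemma nodup_row {E : List (ℕ × ℕ)} (hE : E.Nodup) (x : ℕ) :
    ((E.filter fun e => e.1 = x).map Prod.snd).Nodup := by
  refine (hE.filter _).map_on fun a ha b hb h => ?_
  simp at ha hb
  exact Prod.ext (ha.2.trans hb.2.symm) h

lemma nodup_col {E : List (ℕ × ℕ)} (hE : E.Nodup) (x : ℕ) :
    ((E.filter fun e => e.2 = x).map Prod.fst).Nodup := by
  refine (hE.filter _).map_on fun a ha b hb h => ?_
  simp at ha hb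
  exact Prod.ext h (ha.2.trans hb.2.symm)

lemma Lab.Valid.mono {l w w' : ℕ → ℕ} {c c' : ℕ} (h : Lab.Valid ⟨l, w, c⟩) (hc : c ≤ c')
    (hw : ∀ o, w' o < c') : Lab.Valid ⟨l, w', c'⟩ :=
  ⟨fun x => (h.1 x).trans_le hc, hw⟩

/-- Composes the partition into traces, the partition into classes and the pairing, and rephrases
labels as statements about incidences, so that the combinatorial part sees only `Outcome`. Tables
are assumed clean from the counter on; every label used in this round lies between the old and the
new counter, which restores this assumption. -/
lemma w_roundCmd {e : Env} {C : List ℕ} (h : MInv e s C) (hE : e.E.Nodup) :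
    W π roundCmd s (440 * e.n + 190 * e.m + 300 * e.E.length + 250) fun t =>
      ∃ C' R, MInv e t C' ∧ (∀ u, t.a aMK u = if u ∈ C then 0 else s.a aMK u) ∧
        Outcome e (fun u => s.a aMK u ≠ 0) C C' R (s.a aNX) (t.a aNX) := by
  obtain ⟨hnd, hlt⟩ := h.cycles.sublist_perm
  have hCn : C.length ≤ e.n := by
    have h1 : C.toFinset ⊆ Finset.range e.n := fun x hx =>
      Finset.mem_range.2 (hlt x (List.mem_toFinset.1 hx))
    have h2 := Finset.card_le_card h1
    rwa [List.toFinset_card_of_nodup hnd, Finset.card_range] at h2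
  have hcol := sum_filter_snd_le e.E hnd
  have hrow := sum_filter_fst_le e.E e.m
  unfold roundCmd
  refine W.le (W.seq_fr (w_tracesCmd h.k h.cur hnd h.zero h.stored.col (nodup_col hE) h.validF)
    (T₂ := (60 * e.n + 150 * e.E.length + 130 * e.m + 100) + ((200 * C.length + 20) +
      (50 * C.length + 20) + 1) + 1) fun s₁ hf₁ ⟨a1, a2, a3, a4, a5⟩ => ?_)
    (by rw [h.m]; omega)
  refine W.seq_fr (W.le (w_classesCmd (P := e.P) ?_ ?_ (nodup_row hE) ?_ ?_)
    (T' := 60 * e.n + 150 * e.E.length + 130 * e.m + 100) ?_)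
    fun s₂ hf₂ ⟨R, b1, b2, b3, b4, b5, b6⟩ => W.seq_fr (w_pairCmd (n := e.n) (C := C) ?_ ?_ ?_ ?_
      ?_ ?_)
    fun s₃ hf₃ ⟨C', c1, c2, c3, c4, c5, c6⟩ => W.frame (W.mono (w_flagCmd ?_) ?_ ?_)
  · exact (hf₁.v r1 rfl).trans h.one
  · have := h.stored.row
    rwa [← hf₁.a aHR rfl, ← hf₁.a aNR rfl, ← hf₁.a aVR rfl, ← hf₁.a aCR rfl] at this
  · rw [hf₁.a aLU rfl]
    exact h.validU.mono a3 a2.2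
  · intro x hx
    rw [hf₁.v rM rfl] at hx
    rw [hf₁.a aSN rfl]
    exact h.seen _ (a4 x hx)
  · rw [hf₁.v rN rfl, h.n, hf₁.v rM rfl, h.m]
    omega
  · exact (hf₂.v rk rfl).trans ((hf₁.v rk rfl).trans h.k)
  · rw [hf₂.a aCU rfl, hf₁.a aCU rfl]; exact h.cur
  · exact (hf₂.v r0 rfl).trans ((hf₁.v r0 rfl).trans h.zero)
  · exact (hf₂.v r1 rfl).trans ((hf₁.v r1 rfl).trans h.one)
  · intro u hu
    rw [hf₂.a aPD rfl, hf₁.a aPD rfl]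
    refine h.pend _ (a3.trans (b5 u ?_))
    rw [hf₁.v rN rfl, h.n]
    exact hlt u hu
  · rw [hf₂.a aNX rfl, hf₁.a aNX rfl]; exact h.cycles
  · exact (hf₃.v r2 rfl).trans ((hf₂.v r2 rfl).trans ((hf₁.v r2 rfl).trans h.two))
  · have h1 : (C.toFinset.image (s₂.a aLU)).card ≤ C.length :=
      Finset.card_image_le.trans (List.toFinset_card_le C)
    rw [c2]
    omega
  · rintro t ⟨-, ht2⟩ hft
    have vv : ∀ y, roundCmd.fixesVar y = true → t.v y = s.v y := by
      intro y hy
      simp only [roundCmd, H.fixesVar, Bool.and_eq_true] at hy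
      exact (hft.v y hy.2.2.2).trans ((hf₃.v y hy.2.2.1).trans ((hf₂.v y hy.2.1).trans
        (hf₁.v y hy.1)))
    have aa : ∀ y, roundCmd.fixesArr y = true → t.a y = s.a y := by
      intro y hy
      simp only [roundCmd, H.fixesArr, Bool.and_eq_true] at hy
      exact (hft.a y hy.2.2.2).trans ((hf₃.a y hy.2.2.1).trans ((hf₂.a y hy.2.1).trans
        (hf₁.a y hy.1)))
    have en : s₁.v rN = e.n := (hf₁.v rN rfl).trans h.n
    have em : s₁.v rM = e.m := (hf₁.v rM rfl).trans h.m
    have ectr : t.v rctr = s₂.v rctr := (hft.v rctr rfl).trans (hf₃.v rctr rfl)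
    have eNW : t.a aNW = s₂.a aNW := (hft.a aNW rfl).trans (hf₃.a aNW rfl)
    have eLF : t.a aLF = s₁.a aLF := (hft.a aLF rfl).trans ((hf₃.a aLF rfl).trans (hf₂.a aLF rfl))
    have eLU : t.a aLU = s₂.a aLU := (hft.a aLU rfl).trans (hf₃.a aLU rfl)
    have eSN : t.a aSN = s₂.a aSN := (hft.a aSN rfl).trans (hf₃.a aSN rfl)
    have ePD : t.a aPD = s₃.a aPD := hft.a aPD rfl
    have eNX : t.a aNX = s₃.a aNX := hft.a aNX rfl
    have eNX₂ : s₂.a aNX = s.a aNX := (hf₂.a aNX rfl).trans (hf₁.a aNX rfl)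
    have eMK : t.a aMK = s₁.a aMK := (hft.a aMK rfl).trans ((hf₃.a aMK rfl).trans (hf₂.a aMK rfl))
    have eCU : t.a aCU = s₃.a aCU := hft.a aCU rfl
    have ek : t.v rk = s₃.v rk := hft.v rk rfl
    have eK : s₃.v rK = e.K := (hf₃.v rK rfl).trans ((hf₂.v rK rfl).trans
      ((hf₁.v rK rfl).trans h.K))
    rw [em] at b1
    rw [h.m] at a5 a4
    have htrace : ∀ x < e.m, ∀ y < e.m, s₁.a aLF x = s₁.a aLF y ↔
        ∀ u ∈ C, s.a aMK u ≠ 0 → ((x, u) ∈ e.E ↔ (y, u) ∈ e.E) := by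
      intro x hx y hy
      rw [a5 x hx y hy]
      simp only [mem_col]
    have hclass : ∀ u ∈ C, ∀ v ∈ C, s₂.a aLU u = s₂.a aLU v ↔
        ∀ x ∈ R, (x, u) ∈ e.E ↔ (x, v) ∈ e.E := by
      intro u hu v hv
      rw [b6 u (by rw [en]; exact hlt u hu) v (by rw [en]; exact hlt v hv)]
      simp only [mem_row]
    refine ⟨C', R, ?_, fun u => by rw [eMK, a1], ?_⟩
    · refine ⟨(vv rN rfl).trans h.n, (vv rM rfl).trans h.m, (vv rK rfl).trans h.K,
        (vv rQQ rfl).trans h.qq, (vv rDD rfl).trans h.dd, (vv r0 rfl).trans h.zero,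
        (vv r1 rfl).trans h.one, (vv r2 rfl).trans h.two, h.stored.congr fun k hk => aa k ?_,
        ek.trans c2, by rw [eCU]; exact c1, by rw [ht2, c2, eK], by rw [eNX]; exact c3, ?_, ?_, ?_,
        ?_⟩
      · interval_cases k <;> rfl
      · rw [eLF, eNW, ectr]
        exact a2.mono b4 b3.2
      · rw [eLU, eNW, ectr]
        exact b3
      · intro o ho
        rw [ectr] at ho
        rw [eSN, b2 o, hf₁.a aSN rfl]
        · exact h.seen o (a3.trans (b4.trans ho))
        · intro x _ e
          have := a2.1 x
          simp only at this
          omega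
      · intro o ho
        rw [ectr] at ho
        rw [ePD, c5 o, hf₂.a aPD rfl, hf₁.a aPD rfl]
        · exact h.pend o (a3.trans (b4.trans ho))
        · intro x _ e
          have := b3.1 x
          simp only at this
          omega
    · refine ⟨b1.lt, fun x hx => ?_, fun x hx y hy hxy => ?_, b1.nodup, ?_, fun χ D _ _ hχ => ?_⟩
      · obtain ⟨y, hy, hyx⟩ := b1.cover x hx
        exact ⟨y, hy, (htrace y (b1.lt y hy) x hx).1 hyx⟩
      · exact b1.inj x hx y hy ((htrace x (b1.lt x hx) y (b1.lt y hy)).2 hxy)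
      · refine c4.trans (Nat.add_le_add_left ?_ _)
        -- The label of an element depends only on the kept sets that contain it, so there are at
        -- most as many labels as such families.
        refine Finset.card_le_card_of_surjOn (fun S => s₂.a aLU
          (if hS : ∃ u ∈ C, (R.toFinset.filter fun x => (x, u) ∈ e.E) = S then hS.choose else 0)) ?_
        intro l hl
        simp only [Finset.coe_image, Set.mem_image, Finset.mem_coe, List.mem_toFinset] at hl ⊢
        obtain ⟨u, hu, rfl⟩ := hl
        refine ⟨_, ⟨u, hu, rfl⟩, ?_⟩
        have hS : ∃ v ∈ C, (R.toFinset.filter fun x => (x, v) ∈ e.E) =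
          R.toFinset.filter fun x => (x, u) ∈ e.E := ⟨u, hu, rfl⟩
        rw [dif_pos hS]
        obtain ⟨h1, h2⟩ := hS.choose_spec
        refine (hclass _ h1 u hu).2 fun x hx => ?_
        have := Finset.ext_iff.1 h2 x
        simpa [hx] using this
      · rw [eNX]
        have := c6 χ D fun u hu v hv huv => hχ u hu v hv ((hclass u hu v hv).1 huv)
        rwa [eNX₂] at this

/-! ### Sampling -/

/-- The mean of `g` over the lists of `r` numbers below `k`. -/
noncomputable def avg (k : ℕ) : ℕ → (List ℕ → ENNReal) → ENNReal
  | 0, g => g []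
  | r + 1, g => ∑ i ∈ Finset.range k, (k : ENNReal)⁻¹ * avg k r fun l => g (i :: l)

/-- The state after a random choice. -/
def drawSt (s : St) (i : ℕ) : St := ev markCmd (s.set ri i)

lemma drawSt_v (s : St) (i y : ℕ) (h : y ≠ ri ∧ y ≠ ru ∧ y ≠ rs) : (drawSt s i).v y = s.v y := by
  simp [drawSt, markCmd, ev, h.1, h.2.1, h.2.2]

lemma drawSt_rs {s : St} (h1 : s.v r1 = 1) (i : ℕ) : (drawSt s i).v rs = s.v rs - 1 := by
  simp [drawSt, markCmd, ev, h1, BinOp.eval]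

lemma drawSt_a (s : St) (i k : ℕ) (h : k ≠ aMK) : (drawSt s i).a k = s.a k := by
  simp [drawSt, markCmd, ev, h]

lemma drawSt_mark {s : St} (h1 : s.v r1 = 1) (i : ℕ) :
    (drawSt s i).a aMK = Function.update (s.a aMK) (s.a aCU i) 1 := by
  simp [drawSt, markCmd, ev, h1]

lemma foldl_drawSt_v (l : List ℕ) (s : St) (y : ℕ) (h : y ≠ ri ∧ y ≠ ru ∧ y ≠ rs) :
    (l.foldl drawSt s).v y = s.v y := by
  induction l generalizing s with
  | nil => rfl
  | cons i l ih => rw [List.foldl_cons, ih, drawSt_v _ _ _ h]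

lemma foldl_drawSt_a (l : List ℕ) (s : St) (k : ℕ) (h : k ≠ aMK) :
    (l.foldl drawSt s).a k = s.a k := by
  induction l generalizing s with
  | nil => rfl
  | cons i l ih => rw [List.foldl_cons, ih, drawSt_a _ _ _ h]

lemma foldl_drawSt_mark (l : List ℕ) {s : St} (h1 : s.v r1 = 1) (u : ℕ) :
    (l.foldl drawSt s).a aMK u = if u ∈ l.map (s.a aCU) then 1 else s.a aMK u := by
  induction l generalizing s with
  | nil => simp
  | cons i l ih =>
    rw [List.foldl_cons, ih (by rw [drawSt_v _ _ _ (by norm_num), h1]), drawSt_mark h1,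
      drawSt_a _ _ _ (by norm_num)]
    simp only [List.map_cons, List.mem_cons, Function.update_apply]
    by_cases h2 : u ∈ l.map (s.a aCU) <;> by_cases h3 : u = s.a aCU i <;> simp only [h2, h3] <;>
      simp

/-- Unrolling the loop turns repeated use of `Ok.rand` into `avg`. The continuation need only be
analysed for a fixed list of drawn indices, as if the sample were deterministic. -/
lemma okS_draws {X : Set Store} {kont : List Cmd} {k : ℕ} (r : ℕ) {s : St}
    {g : List ℕ → ENNReal} (h1 : s.v r1 = 1) (hr : s.v rs = r) (hk : s.v rk1 + 1 = k)
    (h : ∀ l : List ℕ, l.length = r → (∀ i ∈ l, i < k) → OkS π X T (l.foldl drawSt s) kont (g l)) :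
    OkS π X (T + 40 * r + 1) s (.loop (rs + 4) drawCmd :: kont) (avg k r g) := by
  induction r generalizing s g with
  | zero =>
    intro hT hs
    exact Ok.loop_zero (OkS.bounded hs) hr (h [] rfl (by simp) (by omega) (hs.mono (by omega)))
  | succ r ih =>
    intro hT hs
    have e : T + 40 * (r + 1) + 1 = (T + 40 * r + 1 + 33) + 4 + 1 + 1 + 1 := by ring
    rw [e] at hT hs ⊢
    refine Ok.loop_pos (OkS.bounded hs) (hr.trans_ne (by omega))
      (Ok.seq (OkS.bounded hs) ?_)
    have hk' : (conc π.b s).reg (rk1 + 4) = s.v rk1 := rfl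
    have := Ok.rand (r := ri + 4) (s := rk1 + 4) (k := markCmd.compile :: .loop (rs + 4) drawCmd ::
      kont) (E := X) (T := T + 40 * r + 1 + 33 + 4) (OkS.bounded hs)
      (fun i => avg k r fun l => g (i :: l)) fun i hi _ => ?_
    · rw [hk', hk] at this
      exact this
    · rw [hk'] at hi
      rw [conc_setReg]
      have hd : OkS π X (T + 40 * r + 1) (drawSt s i) (.loop (rs + 4) drawCmd :: kont)
          (avg k r fun l => g (i :: l)) := by
        refine ih (by rw [drawSt_v _ _ _ (by norm_num), h1]) (by rw [drawSt_rs h1, hr]; omega)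
          (by rw [drawSt_v _ _ _ (by norm_num), hk]) fun l hl hlk => ?_
        refine h (i :: l) (by simp [hl]) fun j hj => ?_
        rcases List.mem_cons.1 hj with rfl | hj
        · omega
        · exact hlk j hj
      have hc : cost markCmd (s.set ri i) ≤ 33 + 4 := by simp [markCmd, cost]
      have hw := okS_compile (π := π) markCmd (s := s.set ri i) rfl (by simp [markCmd, Saf]) hd
      have hv := hs.1 rk1
      exact (hw.mono (by omega) le_rfl) (by omega) ((hs.mono (by omega)).set (by omega))

lemma avg_mono {k : ℕ} (r : ℕ) {g g' : List ℕ → ENNReal}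
    (h : ∀ l : List ℕ, l.length = r → (∀ i ∈ l, i < k) → g l ≤ g' l) : avg k r g ≤ avg k r g' := by
  induction r generalizing g g' with
  | zero => exact h [] rfl (by simp)
  | succ r ih =>
    refine Finset.sum_le_sum fun i hi => ?_
    refine mul_le_mul_right (ih fun l hl hlk => h _ (by simp [hl]) fun j hj => ?_) _
    rcases List.mem_cons.1 hj with rfl | hj
    · exact Finset.mem_range.1 hi
    · exact hlk j hj

lemma avg_add {k : ℕ} (r : ℕ) (g g' : List ℕ → ENNReal) :
    avg k r (fun l => g l + g' l) = avg k r g + avg k r g' := by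
  induction r generalizing g g' with
  | zero => rfl
  | succ r ih => simp only [avg, ih, mul_add, Finset.sum_add_distrib]

lemma avg_sum {ι : Type*} {k : ℕ} (r : ℕ) (S : Finset ι) (g : ι → List ℕ → ENNReal) :
    avg k r (fun l => ∑ x ∈ S, g x l) = ∑ x ∈ S, avg k r (g x) := by
  induction r generalizing g with
  | zero => rfl
  | succ r ih =>
    simp only [avg, ih, Finset.mul_sum]
    exact Finset.sum_comm

lemma avg_const {k : ℕ} (hk : k ≠ 0) (r : ℕ) (c : ENNReal) : avg k r (fun _ => c) = c := by
  induction r with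
  | zero => rfl
  | succ r ih =>
    simp only [avg, ih, Finset.sum_const, Finset.card_range, nsmul_eq_mul]
    rw [← mul_assoc, ENNReal.mul_inv_cancel (by exact_mod_cast hk) (by simp), one_mul]

/-- The probability that all of `r` draws avoid a set. -/
lemma avg_avoid {k : ℕ} (r : ℕ) (D : ℕ → Prop) [DecidablePred D] :
    avg k r (fun l => if ∀ i ∈ l, ¬ D i then 1 else 0) =
      ((k : ENNReal)⁻¹ * ((Finset.range k).filter fun i => ¬ D i).card) ^ r := by
  induction r with
  | zero => simp [avg]
  | succ r ih =>
    have h : ∀ i, avg k r (fun l => if ∀ j ∈ i :: l, ¬ D j then 1 else 0) =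
        if ¬ D i then ((k : ENNReal)⁻¹ * ((Finset.range k).filter fun i => ¬ D i).card) ^ r
          else 0 := by
      intro i
      by_cases hi : D i
      · simp only [List.mem_cons, forall_eq_or_imp, hi, not_true, false_and, if_false]
        clear ih
        induction r with
        | zero => rfl
        | succ r ih => simp [avg, ih]
      · simpa [hi] using ih
    simp only [avg, h]
    rw [← Finset.mul_sum, ← Finset.sum_filter, Finset.sum_const, nsmul_eq_mul, pow_succ']
    ring

end Welzl

/-! ### The main loop -/

namespace Welzl

variable {π : Par} {s : St} {Q : St → Prop} {T : ℕ}

lemma MInv.congr {e : Env} {s t : St} {C : List ℕ} (h : MInv e s C)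
    (hv : ∀ y ∈ [rN, rM, rK, rQQ, rDD, rk, rf, rctr, r0, r1, r2], t.v y = s.v y)
    (ha : ∀ k, k ≠ aMK → t.a k = s.a k) : MInv e t C := by
  simp only [List.mem_cons, List.not_mem_nil, or_false, forall_eq_or_imp, forall_eq] at hv
  obtain ⟨v0, v1, v2, v3, v4, v5, v6, v7, v8, v9, v10⟩ := hv
  have a8 := ha aLF (by norm_num)
  have a9 := ha aLU (by norm_num)
  have a10 := ha aNW (by norm_num)
  have a12 := ha aSN (by norm_num)
  have a13 := ha aPD (by norm_num)
  have a14 := ha aCU (by norm_num)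
  have a15 := ha aNX (by norm_num)
  exact ⟨v0.trans h.n, v1.trans h.m, v2.trans h.K, v3.trans h.qq, v4.trans h.dd, v8.trans h.zero,
    v9.trans h.one, v10.trans h.two, h.stored.congr fun k hk => ha k (by omega), v5.trans h.k,
    by rw [a14]; exact h.cur, v6.trans h.f, by rw [a15]; exact h.cycles,
    by rw [a8, a10, v7]; exact h.validF, by rw [a9, a10, v7]; exact h.validU,
    by rw [a12, v7]; exact h.seen, by rw [a13, v7]; exact h.pend⟩

/-- The logarithm of the sample size. -/
def Env.sampleLog (e : Env) (C : List ℕ) : ℕ := (Nat.log 2 C.length - e.K) * e.qq / e.dd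

/-- The sample. -/
def Sampled (l C : List ℕ) (u : ℕ) : Prop := u ∈ l.map fun i => C.getD i 0

lemma Cycles.length_le {n : ℕ} {f : ℕ → ℕ} {C : List ℕ} (h : Cycles n f C) : C.length ≤ n := by
  obtain ⟨hnd, hlt⟩ := h.sublist_perm
  have h1 : C.toFinset ⊆ Finset.range n := fun x hx =>
    Finset.mem_range.2 (hlt x (List.mem_toFinset.1 hx))
  have h2 := Finset.card_le_card h1
  rwa [List.toFinset_card_of_nodup hnd, Finset.card_range] at h2

lemma Env.sampleLog_le {e : Env} (hd : e.qq ≤ e.dd) (C : List ℕ) :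
    e.sampleLog C ≤ Nat.log 2 C.length := by
  unfold Env.sampleLog
  refine (Nat.div_le_div_right (Nat.mul_le_mul_left _ hd)).trans ?_
  rcases Nat.eq_zero_or_pos e.dd with h | h
  · simp [h]
  · rw [Nat.mul_div_cancel _ h]; omega

/-- The time for a round. -/
def Env.roundTime (e : Env) : ℕ := 490 * e.n + 190 * e.m + 300 * e.E.length + 280

-- Reduces a random round to the deterministic round for each possible sample `l`. Since `qq ≤ dd`,
-- the sample is no larger than `C`, so drawing it stays within linear time.
open Classical in
lemma okS_round {e : Env} {C : List ℕ} {X : Set Store} {kont : List Cmd} (h : MInv e s C)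
    (hE : e.E.Nodup) (hmark : ∀ u, s.a aMK u = 0) (hf : e.K < Nat.log 2 C.length)
    (hd : e.qq ≤ e.dd) (hB : e.n * e.qq ≤ π.B₀) (hB' : e.n ≤ π.B₀) {g : List ℕ → ENNReal}
    (hok : ∀ l : List ℕ, l.length = 2 ^ e.sampleLog C → (∀ i ∈ l, i < C.length) → ∀ t C' R,
      MInv e t C' → (∀ u, t.a aMK u = 0) →
      Outcome e (Sampled l C) C C' R (s.a aNX) (t.a aNX) → OkS π X T t kont (g l)) :
    OkS π X (T + e.roundTime) s
      (.seq sizeCmd.compile (.seq (.loop (rs + 4) drawCmd) roundCmd.compile) :: kont)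
      (avg C.length (2 ^ e.sampleLog C) g) := by
  have hCn := h.cycles.length_le
  have hCpos : C.length ≠ 0 := by
    intro h0
    rw [h0] at hf
    simp at hf
  have hlogle : Nat.log 2 C.length ≤ C.length := Nat.log_le_self _ _
  have hj := Env.sampleLog_le hd C
  have hpow : 2 ^ e.sampleLog C ≤ C.length :=
    (Nat.pow_le_pow_right (by norm_num) hj).trans (Nat.pow_log_le_self 2 hCpos)
  have hjeq : s.v rf * s.v rQQ / s.v rDD = e.sampleLog C := by
    rw [h.f, h.qq, h.dd]; rfl
  have hsz : W π sizeCmd s (10 * e.n + 20) fun t => Fr sizeCmd s t ∧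
      t.v rs = 2 ^ e.sampleLog C ∧ t.v rk1 = C.length - 1 := by
    refine W.frame (W.mono (w_sizeCmd h.one ?_ ?_) ?_ ?_)
    · rw [h.f, h.qq]
      refine le_trans (Nat.mul_le_mul_right _ ?_) hB
      omega
    · rw [hjeq]; omega
    · rw [hjeq]; omega
    · rw [hjeq, h.k]
      exact fun t ht hf => ⟨hf, ht⟩
  have hlast : OkS π X (T + (440 * e.n + 190 * e.m + 300 * e.E.length + 250) +
      40 * 2 ^ e.sampleLog C + 1 + 1 + (10 * e.n + 20)) s (sizeCmd.compile ::
        .seq (.loop (rs + 4) drawCmd) roundCmd.compile :: kont)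
        (avg C.length (2 ^ e.sampleLog C) g) := by
    refine hsz.okS rfl fun s₁ ⟨hf₁, h1, h2⟩ => ?_
    have hI₁ : MInv e s₁ C := by
      refine h.congr (fun y hy => hf₁.v y ?_) fun k hk => hf₁.a k rfl
      simp only [List.mem_cons, List.not_mem_nil, or_false] at hy
      rcases hy with rfl | rfl | rfl | rfl | rfl | rfl | rfl | rfl | rfl | rfl | rfl <;> rfl
    have hdraws := okS_draws (π := π) (X := X) (kont := roundCmd.compile :: kont)
      (T := T + (440 * e.n + 190 * e.m + 300 * e.E.length + 250)) (k := C.length)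
      (2 ^ e.sampleLog C) (s := s₁) (g := g) hI₁.one h1 (by rw [h2]; omega) fun l hl hlk => ?_
    · intro hT hs
      exact Ok.seq (OkS.bounded hs) (hdraws (by omega) (hs.mono (by omega)))
    · have hI₂ : MInv e (l.foldl drawSt s₁) C := by
        refine hI₁.congr (fun y hy => foldl_drawSt_v _ _ _ ?_) fun k hk => foldl_drawSt_a _ _ _ hk
        simp only [List.mem_cons, List.not_mem_nil, or_false] at hy
        omega
      refine (w_roundCmd hI₂ hE).okS rfl fun t ⟨C', R, k1, k2, k3⟩ => ?_
      have hm₂ : ∀ u, (l.foldl drawSt s₁).a aMK u = if Sampled l C u then 1 else 0 := by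
        intro u
        rw [foldl_drawSt_mark l hI₁.one, hf₁.a aMK rfl, hmark]
        have : l.map (s₁.a aCU) = l.map fun i => C.getD i 0 := by
          refine List.map_congr_left fun i hi => ?_
          have := hlk i hi
          rw [hI₁.cur i this]
          simp [this]
        rw [this]
        exact if_congr Iff.rfl rfl rfl
      have hA : (fun u => (l.foldl drawSt s₁).a aMK u ≠ 0) = Sampled l C := by
        funext u
        rw [hm₂]
        simp
      rw [hA, foldl_drawSt_a _ _ _ (by norm_num), hf₁.a aNX rfl] at k3
      refine hok l hl hlk t C' R k1 (fun u => ?_) k3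
      rw [k2, hm₂]
      split_ifs with h3 h4
      · rfl
      -- Only elements of `C` are ever drawn, so every mark has been removed at the end of the
      -- round.
      · exfalso
        apply h3
        obtain ⟨i, hi, rfl⟩ := List.mem_map.1 h4
        have := hlk i hi
        simp [this]
      · rfl
  obtain ⟨T₁, hT₁⟩ : ∃ T₁, T + e.roundTime = T₁ + 1 :=
    ⟨T + 490 * e.n + 190 * e.m + 300 * e.E.length + 279, by unfold Env.roundTime; omega⟩
  have := hlast.mono (T' := T₁) (by unfold Env.roundTime at hT₁; omega) le_rfl
  rw [hT₁]
  intro hT hs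
  exact Ok.seq (OkS.bounded hs) (this (by omega) (hs.mono (by omega)))

open Classical in
/-- The main loop. Rounds shrink the set of representatives, and with probability at least `1 - p`
they increase the number of separated pairs by at most `Δ` for every set. -/
theorem okS_mainLoop {e : Env} {X : Set Store} {kont : List Cmd} {p : ENNReal} {Δ D : ℕ}
    (hE : e.E.Nodup) (hd : e.qq ≤ e.dd) (hB : e.n * e.qq ≤ π.B₀) (hB' : e.n ≤ π.B₀)
    (hshrink : ∀ C : List ℕ, C.Nodup → (∀ u ∈ C, u < e.n) → e.K < Nat.log 2 C.length →
      ∀ l : List ℕ, l.length = 2 ^ e.sampleLog C → (∀ i ∈ l, i < C.length) → ∀ C' R nx nx',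
      Outcome e (Sampled l C) C C' R nx nx' → 4 * C'.length ≤ 3 * C.length)
    (hprob : ∀ C : List ℕ, C.Nodup → (∀ u ∈ C, u < e.n) → e.K < Nat.log 2 C.length →
      ∃ good : List ℕ → Prop,
        avg C.length (2 ^ e.sampleLog C) (fun l => if good l then 0 else 1) ≤ p ∧
        ∀ l, good l → ∀ C' R nx nx', Outcome e (Sampled l C) C C' R nx nx' → ∀ x < e.m,
          cr e.n (fun u => (x, u) ∈ e.E) nx' ≤ cr e.n (fun u => (x, u) ∈ e.E) nx + Δ)
    (hkont : ∀ t C, MInv e t C → C.length < 2 ^ (e.K + 1) → OkS π X T t kont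
      (if ∀ x < e.m, cr e.n (fun u => (x, u) ∈ e.E) (t.a aNX) ≤ D then 0 else 1)) (r : ℕ) :
    ∀ (s : St) (C : List ℕ), MInv e s C → (∀ u, s.a aMK u = 0) → C.length * 3 ^ r ≤ 4 ^ r →
      OkS π X (T + r * (e.roundTime + 1) + 1) s (mainLoop :: kont)
        (if ∀ x < e.m, cr e.n (fun u => (x, u) ∈ e.E) (s.a aNX) + r * Δ ≤ D then r * p else 1) := by
  -- Here `r` is the number of rounds still allowed; the loop may stop before they are used up. The
  -- failure bound is nontrivial only while the crossing budget `D` suffices for `r` further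
  -- increases by `Δ`.
  have hexit : ∀ (r : ℕ) (s : St) (C : List ℕ), MInv e s C → Nat.log 2 C.length ≤ e.K →
      OkS π X (T + r * (e.roundTime + 1) + 1) s (mainLoop :: kont)
        (if ∀ x < e.m, cr e.n (fun u => (x, u) ∈ e.E) (s.a aNX) + r * Δ ≤ D then r * p else 1) := by
    intro r s C h hlog
    have hlt : C.length < 2 ^ (e.K + 1) := Nat.lt_pow_of_log_lt (by norm_num) (by omega)
    have hk := hkont s C h hlt
    have h1 : OkS π X (T + 1) s (mainLoop :: kont)
        (if ∀ x < e.m, cr e.n (fun u => (x, u) ∈ e.E) (s.a aNX) ≤ D then 0 else 1) := by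
      intro hT hs
      refine Ok.loop_zero (OkS.bounded hs) ?_ (hk (by omega) (hs.mono (by omega)))
      exact h.f.trans (by omega)
    refine h1.mono (by have := Nat.zero_le (r * (e.roundTime + 1)); omega) ?_
    split_ifs with a1 a2 a2
    · exact zero_le
    · exact zero_le
    · exact absurd (fun x hx => le_trans (by omega) (a2 x hx)) a1
    · exact le_rfl
  induction r with
  | zero =>
    intro s C h hmark hr
    simp only [pow_zero, mul_one] at hr
    refine hexit 0 s C h ?_
    -- Without rounds left, the hypothesis `hr` says that at most one representative remains.
    rw [Nat.log_of_lt (by omega)]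
    exact Nat.zero_le _
  | succ r ih =>
    intro s C h hmark hr
    by_cases hlog : Nat.log 2 C.length ≤ e.K
    · exact hexit _ s C h hlog
    push Not at hlog
    obtain ⟨hnd, hlt⟩ := h.cycles.sublist_perm
    obtain ⟨good, hg1, hg2⟩ := hprob C hnd hlt hlog
    have hCpos : C.length ≠ 0 := by
      intro h0
      rw [h0] at hlog
      simp at hlog
    have hstep : ∀ q : List ℕ → ENNReal, (∀ l : List ℕ, ∀ t C' R, MInv e t C' →
        Outcome e (Sampled l C) C C' R (s.a aNX) (t.a aNX) →
        OkS π X (T + r * (e.roundTime + 1) + 1) t (mainLoop :: kont)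
          (if ∀ x < e.m, cr e.n (fun u => (x, u) ∈ e.E) (t.a aNX) + r * Δ ≤ D then r * p else 1) →
        OkS π X (T + r * (e.roundTime + 1) + 1) t (mainLoop :: kont) (q l)) →
        OkS π X (T + (r + 1) * (e.roundTime + 1) + 1) s (mainLoop :: kont)
          (avg C.length (2 ^ e.sampleLog C) q) := by
      intro q hq hT hs
      have e1 : T + (r + 1) * (e.roundTime + 1) + 1 =
        T + r * (e.roundTime + 1) + 1 + e.roundTime + 1 := by ring
      rw [e1] at hT hs ⊢
      refine Ok.loop_pos (OkS.bounded hs) (h.f.trans_ne (by omega)) ?_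
      refine okS_round h hE hmark hlog hd hB hB' (fun l hl hlk t C' R k1 k2 k3 => ?_) (by omega)
        (hs.mono (by omega))
      have hs := hshrink C hnd hlt hlog l hl hlk C' R _ _ k3
      refine hq l t C' R k1 k3 (ih t C' k1 k2 ?_)
      rw [pow_succ, pow_succ] at hr
      have : 4 * (C'.length * 3 ^ r) ≤ 3 * C.length * 3 ^ r := by
        rw [← mul_assoc]; exact Nat.mul_le_mul_right _ hs
      linarith
    by_cases hcond : ∀ x < e.m, cr e.n (fun u => (x, u) ∈ e.E) (s.a aNX) + (r + 1) * Δ ≤ D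
    · rw [if_pos hcond]
      -- Union bound over the rounds: a bad sample is charged failure probability one, and its
      -- average over the samples is at most `p`. After a good sample the budget still suffices for
      -- `r` rounds.
      refine (hstep (fun l => r * p + if good l then 0 else 1) fun l t C' R k1 k3 hk => ?_).mono
        le_rfl ?_
      · refine hk.mono le_rfl ?_
        split_ifs with a1 a2 a2
        · exact le_self_add
        · exact le_self_add
        · refine absurd (fun x hx => ?_) a1
          have h1 := hg2 l a2 C' R _ _ k3 x hx
          have h2 := hcond x hx
          rw [add_mul, one_mul] at h2
          omega
        · exact le_add_self
      · rw [avg_add, avg_const hCpos]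
        push_cast
        rw [add_mul, one_mul]
        gcongr
    · rw [if_neg hcond]
      -- When the budget is exhausted nothing is claimed about success, but halting and the bound on
      -- numbers must still be carried through.
      have := hstep (fun _ => 1) fun l t C' R _ _ hk => fun hT hs => (hk hT hs).trivial_fail
      rwa [avg_const hCpos] at this

end Welzl

/-! ### The whole program -/

namespace Welzl

variable {π : Par} {s : St} {Q : St → Prop} {T : ℕ}

/-- `E` lists the pairs of the number of a row and one of its elements. -/
structure Incidence (rows : List (List ℕ)) (E : List (ℕ × ℕ)) : Prop where
  nodup : E.Nodup
  length : E.length = (rows.map List.length).sum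
  mem : ∀ x u, (x, u) ∈ E ↔ ∃ hx : x < rows.length, u ∈ rows[x]

lemma w_setupCmd {rows : List (List ℕ)} {pos : ℕ → ℕ} {n q c d : ℕ} (hv : ∀ i, s.v i = 0)
    (ha : ∀ k i, s.a k i = 0) (hw : Written s.io π.b rows pos)
    (hn : ∀ r ∈ rows, r.Nodup) (hb : 5 ≤ π.b) (hB : 5 ≤ π.B₀)
    (i0 : s.io 0 = n) (i1 : s.io 1 = rows.length) (i2 : s.io 2 = q) (i3 : s.io 3 = c)
    (i4 : s.io 4 = d) (hK : (d / q + 2) * (c / q + 1) ≤ π.B₀) (hqq : q * q ≤ π.B₀)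
    (hdd : d * d ≤ π.B₀) :
    W π setupCmd s (310 * (rows.map List.length).sum + 30 * rows.length + 110 * n + 140) fun t =>
      ∃ P E, Incidence rows E ∧ (∀ u, t.a aMK u = 0) ∧
        (∀ x < n, t.a aNX x = x) ∧ MInv ⟨n, rows.length, (d / q + 2) * (c / q + 1) + 1, q * q, d * d, P, E⟩ t
          (List.range n) := by
  unfold setupCmd
  refine W.le (W.seq_fr (w_headerCmd (hv r0) hb (by omega) i0 i1 i2 i3 i4 hK hqq hdd)
    (T₂ := (310 * (rows.map List.length).sum + 30 * rows.length + 30) +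
      ((60 * n + 20) + (50 * n + 20) + 1) + 1) fun s₁ hf₁ ⟨h1, h2, h3, h4, h5, h6, h7⟩ => ?_)
    (by omega)
  have ha₁ : ∀ k, s₁.a k = s.a k := fun k => hf₁.a k rfl
  refine W.seq_fr (w_parseCmd (pos := pos) (by rwa [hf₁.io rfl]) h2 hn
    (fun k _ i => by rw [ha₁, ha]) hB) fun s₂ hf₂ ⟨P, E, p1, p2, p3, p4⟩ => ?_
  have hv₂ : ∀ y, parseCmd.fixesVar y = true → s₂.v y = s₁.v y := hf₂.v
  have ha₂ : ∀ k, parseCmd.fixesArr k = true → ∀ i, s₂.a k i = 0 := by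
    intro k hk i
    rw [hf₂.a k hk, ha₁, ha]
  have en : s₂.v rN = n := (hv₂ rN rfl).trans h1
  refine W.seq_fr (W.le (w_initCmd (by omega)) (by rw [en]))
    fun s₃ hf₃ ⟨c1, c2, c3⟩ => ?_
  rw [en] at c1 c2
  have hv₃ : ∀ y, parseCmd.fixesVar y = true → initCmd.fixesVar y = true →
      s₃.v y = s₁.v y := fun y hy hy' => (hf₃.v y hy').trans (hv₂ y hy)
  have ha₃ : ∀ k, parseCmd.fixesArr k = true → initCmd.fixesArr k = true → ∀ i, s₃.a k i = 0 := by
    intro k hk hk' i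
    rw [hf₃.a k hk', ha₂ k hk]
  refine W.frame (W.mono (w_flagCmd ((hv₃ r2 rfl rfl).trans h7)) (by rw [c2]) ?_)
  rintro t ⟨-, ht⟩ hft
  have ha₄ : ∀ k, parseCmd.fixesArr k = true → initCmd.fixesArr k = true → ∀ i, t.a k i = 0 := by
    intro k hk hk' i
    rw [hft.a k rfl, ha₃ k hk hk']
  have hv₄ : ∀ y, parseCmd.fixesVar y = true → initCmd.fixesVar y = true →
      flagCmd.fixesVar y = true → t.v y = s₁.v y := fun y hy hy' hy'' =>
    (hft.v y hy'').trans (hv₃ y hy hy')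
  -- The counter starts at `1`, so the initial contents `0` of the arrays are valid labels.
  have hctr : t.v rctr = 1 := (hft.v rctr rfl).trans c3
  refine ⟨P, E, ⟨p2, p3, p4⟩, ha₄ aMK rfl rfl, fun x hx => ?_, ?_⟩
  · rw [hft.a aNX rfl, (c1 x hx).2]
  refine ⟨(hv₄ rN rfl rfl rfl).trans h1, (hv₄ rM rfl rfl rfl).trans h2,
    (hv₄ rK rfl rfl rfl).trans h3, (hv₄ rQQ rfl rfl rfl).trans h4, (hv₄ rDD rfl rfl rfl).trans h5,
    ?_, (hv₄ r1 rfl rfl rfl).trans h6, (hv₄ r2 rfl rfl rfl).trans h7,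
    p1.congr fun k hk => ?_, ?_, ?_, ?_, ?_, ⟨?_, ?_⟩, ⟨?_, ?_⟩, ?_, ?_⟩
  · rw [hv₄ r0 rfl rfl rfl, hf₁.v r0 rfl, hv]
  · rw [hft.a k rfl]
    refine hf₃.a k ?_
    interval_cases k <;> rfl
  · rw [hft.v rk rfl, c2, List.length_range]
  · intro j hj
    rw [List.length_range] at hj
    rw [hft.a aCU rfl, (c1 j hj).1, List.getElem_range]
  · rw [ht, c2, List.length_range, hv₃ rK rfl rfl, h3]
  · rw [hft.a aNX rfl]
    exact Cycles.id n fun x hx => (c1 x hx).2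
  · intro x; simp only; rw [ha₄ aLF rfl rfl, hctr]; exact Nat.one_pos
  · intro x; simp only; rw [ha₄ aNW rfl rfl, hctr]; exact Nat.one_pos
  · intro x; simp only; rw [ha₄ aLU rfl rfl, hctr]; exact Nat.one_pos
  · intro x; simp only; rw [ha₄ aNW rfl rfl, hctr]; exact Nat.one_pos
  · exact fun o _ => ha₄ aSN rfl rfl o
  · exact fun o _ => ha₄ aPD rfl rfl o

lemma cr_congr {n : ℕ} {χ χ' : ℕ → Prop} [DecidablePred χ] [DecidablePred χ']
    (h : ∀ u, χ u ↔ χ' u) (f : ℕ → ℕ) : cr n χ f = cr n χ' f := by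
  unfold cr
  refine Finset.sum_congr rfl fun x _ => ?_
  simp only [h]

/-- The stores with an order of `{0, …, n - 1}` as output that has at most `D` crossings with every
row. -/
def Success (n : ℕ) (rows : List (List ℕ)) (D : ℕ) : Set Store :=
  {σ | (σ.output n).Perm (List.range n) ∧
    ∀ r ∈ rows, SetSystem.crossings (σ.output n) r.toFinset ≤ D}

/-- The `2 ^ (K + 2)` allows two crossings for each of fewer than `2 ^ (K + 1)` remaining cycles.
The result overwrites the input from address `0` on, matching register `0`, which is never changed.
-/
lemma okS_finishCmd {e : Env} {rows : List (List ℕ)} (hE : Incidence rows e.E)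
    (hm : e.m = rows.length) {C : List ℕ} {D : ℕ} (h : MInv e s C)
    (hC : C.length < 2 ^ (e.K + 1)) (hb : e.n ≤ π.b) (hB : 1 ≤ π.B₀) :
    OkS π (Success e.n rows (D + 2 ^ (e.K + 2))) (190 * e.n + 60) s [finishCmd.compile]
      (if ∀ x < e.m, cr e.n (fun u => (x, u) ∈ e.E) (s.a aNX) ≤ D then 0 else 1) := by
  have hW : W π finishCmd s (190 * e.n + 60) fun t => (∀ x < e.m,
      cr e.n (fun u => (x, u) ∈ e.E) (s.a aNX) ≤ D) →
        conc π.b t ∈ Success e.n rows (D + 2 ^ (e.K + 2)) := by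
    have hCn := h.cycles.length_le
    refine W.le (W.seq_fr (w_joinCmd h.k h.cur h.zero h.one h.cycles hB)
      (T₂ := 40 * e.n + 20) fun s₁ hf₁ ⟨j1, j2⟩ => ?_) (by omega)
    have en : s₁.v rN = e.n := (hf₁.v rN rfl).trans h.n
    refine W.le (W.mono (w_outputCmd (by rw [en]; exact hb)) le_rfl fun t ht hD => ?_)
      (by rw [en])
    rw [en] at ht
    have hout : (conc π.b t).output e.n =
        (List.range e.n).map fun i => (s₁.a aNX)^[i] (s₁.v rw') := by
      refine List.map_congr_left fun i hi => ?_
      have hi' := List.mem_range.1 hi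
      have h0 : (conc π.b t).reg 0 = 0 := rfl
      rw [h0, zero_add, ← ht i hi']
      exact if_pos (by omega)
    cases C with
    | nil =>
      have hn0 : e.n = 0 := by
        obtain ⟨B, -, hp⟩ := h.cycles
        simpa using hp.length_eq.symm
      have hnil : (conc π.b t).output e.n = [] := by rw [hn0]; rfl
      refine ⟨?_, ?_⟩
      · rw [hnil, hn0]; exact List.Perm.nil
      · intro r _
        rw [hnil]; exact Nat.zero_le _
    | cons r C =>
      obtain ⟨hr, hcyc⟩ := j1 r rfl
      rw [hr] at hout
      refine ⟨by rw [hout]; exact hcyc.order, fun R hR => ?_⟩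
      obtain ⟨x, hx, rfl⟩ := List.getElem_of_mem hR
      rw [hout]
      refine (crossings_le_cr hcyc _).trans ?_
      have h1 := hD x (by omega)
      have h2 := j2 fun u => (x, u) ∈ e.E
      have h3 : cr e.n (fun u => u ∈ rows[x].toFinset) (s₁.a aNX) =
          cr e.n (fun u => (x, u) ∈ e.E) (s₁.a aNX) := by
        refine cr_congr (fun u => ?_) _
        rw [hE.mem, List.mem_toFinset]
        exact ⟨fun h => ⟨hx, h⟩, fun ⟨_, h⟩ => h⟩
      have h4 : 2 ^ (e.K + 2) = 2 * 2 ^ (e.K + 1) := by ring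
      omega
  have hk : ∀ t, ((∀ x < e.m, cr e.n (fun u => (x, u) ∈ e.E) (s.a aNX) ≤ D) →
      conc π.b t ∈ Success e.n rows (D + 2 ^ (e.K + 2))) →
      OkS π (Success e.n rows (D + 2 ^ (e.K + 2))) 0 t []
        (if ∀ x < e.m, cr e.n (fun u => (x, u) ∈ e.E) (s.a aNX) ≤ D then 0 else 1) := by
    intro t ht hT hs
    split_ifs with hD
    · exact Ok.of_halted (OkS.bounded hs) (ht hD)
    · exact Ok.of_halted_one (OkS.bounded hs)
  have := hW.okS (T₁ := 0) rfl hk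
  rwa [zero_add] at this

/-- The arrays start at `5 + m + q`, computable from the header alone. The input ends before this
address, so all arrays are initially `0` and the store has the form `conc`. -/
lemma ok_baseCmd {X : Set Store} {kont : List Cmd} {p : ENNReal} {input : List ℕ} {m q : ℕ}
    (h1 : input.getD 1 0 = m) (h2 : input.getD 2 0 = q) (hb : π.b = 5 + m + q)
    (hlen : input.length ≤ π.b) (hB : ∀ i, input.getD i 0 ≤ π.B₀) (hB' : 5 ≤ π.B₀)
    (hT : T + 18 ≤ π.tmax) (h : OkS π X T ⟨fun _ => 0, fun _ _ => 0, fun i => input.getD i 0⟩ kont p) :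
    Ok π.B X (T + 17) ⟨baseCmd :: kont, ⟨fun _ => 0, fun i => input.getD i 0⟩⟩ p := by
  have hBB : π.B₀ ≤ π.B ∧ π.b ≤ π.B := by unfold Par.B; constructor <;> omega
  have b0 : (⟨fun _ => 0, fun i => input.getD i 0⟩ : Store).Bounded π.B := fun i =>
    ⟨Nat.zero_le _, (hB i).trans hBB.1⟩
  have hm := hB 1
  have hq := hB 2
  rw [h1] at hm
  rw [h2] at hq
  refine Ok.seq b0 (Ok.const b0 (by omega) fun b1 => Ok.seq b1 (Ok.load b1 fun b2 => Ok.seq b2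
    (Ok.const b2 (by omega) fun b3 => Ok.seq b3 (Ok.load b3 fun b4 => Ok.seq b4 (Ok.op b4 ?_
    fun b5 => Ok.seq b5 (Ok.const b5 (by omega) fun b6 => Ok.seq b6 (Ok.op b6 ?_
    fun b7 => Ok.seq b7 (Ok.const b7 (Nat.zero_le _) fun b8 => Ok.const b8 (Nat.zero_le _)
    fun b9 => ?_))))))))
  · simp [Store.setReg, BinOp.eval] at h1 h2 ⊢
    omega
  · simp [Store.setReg, BinOp.eval] at h1 h2 ⊢
    omega
  · convert h (by omega) ⟨fun _ => Nat.zero_le _, fun _ _ => Nat.zero_le _,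
      fun i => (hB i).trans (by omega)⟩ using 2
    refine Store.ext_of (funext fun i => ?_) (funext fun i => ?_)
    · simp only [Store.setReg, BinOp.eval, Function.update_apply, conc]
      match i with
      | 0 => rfl
      | 1 => rfl
      | 2 => rfl
      | 3 => simp at h1 h2 ⊢; simp [concReg]; omega
      | r + 4 => simp [concReg]
    · simp only [Store.setReg, conc]
      split_ifs with hi
      · rfl
      · exact List.getD_eq_default _ _ (by omega)

open Classical in
/-- The program is correct if rounds are. -/
theorem ok_welzlProgram {rows : List (List ℕ)} {pos : ℕ → ℕ} {n q c d r K Δ : ℕ} {p : ENNReal}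
    {input : List ℕ} (hw : Written (fun i => input.getD i 0) π.b rows pos)
    (hn : ∀ r ∈ rows, r.Nodup) (hb : π.b = 5 + rows.length + q) (hlen : input.length ≤ π.b)
    (hnb : n ≤ π.b)
    (i0 : input.getD 0 0 = n) (i1 : input.getD 1 0 = rows.length) (i2 : input.getD 2 0 = q)
    (i3 : input.getD 3 0 = c) (i4 : input.getD 4 0 = d) (hB : ∀ i, input.getD i 0 ≤ π.B₀)
    (hB' : 5 ≤ π.B₀) (hKeq : K = (d / q + 2) * (c / q + 1) + 1)
    (hK : K ≤ π.B₀) (hnq : n * (q * q) ≤ π.B₀) (hqq : q * q ≤ π.B₀) (hdd : d * d ≤ π.B₀)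
    (hqd : q ≤ d) (hr : n * 3 ^ r ≤ 4 ^ r)
    (hshrink : ∀ P E, Incidence rows E → ∀ C : List ℕ, C.Nodup → (∀ u ∈ C, u < n) →
      K < Nat.log 2 C.length → ∀ l : List ℕ,
      l.length = 2 ^ (Env.mk n rows.length K (q * q) (d * d) P E).sampleLog C →
      (∀ i ∈ l, i < C.length) → ∀ C' R nx nx',
      Outcome ⟨n, rows.length, K, q * q, d * d, P, E⟩ (Sampled l C) C C' R nx nx' →
      4 * C'.length ≤ 3 * C.length)
    (hprob : ∀ P E, Incidence rows E → ∀ C : List ℕ, C.Nodup → (∀ u ∈ C, u < n) →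
      K < Nat.log 2 C.length → ∃ good : List ℕ → Prop,
        avg C.length (2 ^ (Env.mk n rows.length K (q * q) (d * d) P E).sampleLog C)
          (fun l => if good l then 0 else 1) ≤ p ∧
        ∀ l, good l → ∀ C' R nx nx',
          Outcome ⟨n, rows.length, K, q * q, d * d, P, E⟩ (Sampled l C) C C' R nx nx' →
          ∀ x < rows.length,
            cr n (fun u => (x, u) ∈ E) nx' ≤ cr n (fun u => (x, u) ∈ E) nx + Δ)
    (hT : 1000 * (r + 1) * (n + rows.length + (rows.map List.length).sum + 1) ≤ π.tmax) :
    Ok π.B (Success n rows (r * Δ + 2 ^ (K + 2)))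
      (1000 * (r + 1) * (n + rows.length + (rows.map List.length).sum + 1))
      (start welzlProgram input) (r * p) := by
  obtain ⟨S, hS⟩ : ∃ S, S = (rows.map List.length).sum := ⟨_, rfl⟩
  obtain ⟨Tm, hTm⟩ : ∃ Tm, Tm = (190 * n + 60) + r * (490 * n + 190 * rows.length + 300 * S + 281)
    + 1 := ⟨_, rfl⟩
  have hloop : ∀ t, (∃ P E, Incidence rows E ∧ (∀ u, t.a aMK u = 0) ∧
      (∀ x < n, t.a aNX x = x) ∧ MInv ⟨n, rows.length, K, q * q, d * d, P, E⟩ t (List.range n)) →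
      OkS π (Success n rows (r * Δ + 2 ^ (K + 2))) (Tm + 1) t
        (.seq mainLoop finishCmd.compile :: []) (r * p) := by
    rintro t ⟨P, E, hE, hmark, hid, hI⟩
    have h := okS_mainLoop (π := π) (e := ⟨n, rows.length, K, q * q, d * d, P, E⟩) (p := p)
      (X := Success n rows (r * Δ + 2 ^ (K + 2))) (kont := [finishCmd.compile]) (Δ := Δ)
      (D := r * Δ) (T := 190 * n + 60) hE.nodup (Nat.mul_le_mul hqd hqd) hnq
      ((hB 0).trans' i0.ge) (hshrink P E hE) (hprob P E hE)
      (fun t C h1 h2 => by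
        convert okS_finishCmd (rows := rows) hE rfl h1 h2 hnb (by omega)) r t _ hI hmark
        (by simpa using hr)
    -- In the beginning every element is its own successor, so nothing is crossed.
    have hcr : ∀ x < rows.length, cr n (fun u => (x, u) ∈ E) (t.a aNX) + r * Δ ≤ r * Δ := by
      intro x _
      have : cr n (fun u => (x, u) ∈ E) (t.a aNX) = 0 := by
        refine Finset.sum_eq_zero fun y hy => if_pos ?_
        rw [hid y (Finset.mem_range.1 hy)]
      omega
    rw [if_pos hcr] at h
    have h' := h.mono (T' := Tm) (by
      simp only [Env.roundTime, hE.length, ← hS]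
      rw [hTm]) le_rfl
    intro hT hs
    exact Ok.seq (OkS.bounded hs) (h' (by omega) (hs.mono (by omega)))
  have hset := (w_setupCmd (π := π) (s := ⟨fun _ => 0, fun _ _ => 0, fun i => input.getD i 0⟩)
    (q := q) (c := c) (d := d) (fun _ => rfl) (fun _ _ => rfl) hw hn (by omega) hB' i0 i1 i2 i3 i4
    (by omega) hqq hdd)
  rw [← hKeq] at hset
  have h₁ := hset.okS (T₁ := Tm + 1) (E := Success n rows (r * Δ + 2 ^ (K + 2)))
    (k := [.seq mainLoop finishCmd.compile]) (p := r * p) rfl hloop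
  obtain ⟨T₂, hT₂⟩ : ∃ T₂, T₂ = Tm + 1 + (310 * (rows.map List.length).sum + 30 * rows.length +
    110 * n + 140) := ⟨_, rfl⟩
  rw [← hT₂] at h₁
  have h₂ : OkS π (Success n rows (r * Δ + 2 ^ (K + 2))) (T₂ + 1)
      ⟨fun _ => 0, fun _ _ => 0, fun i => input.getD i 0⟩
      [.seq setupCmd.compile (.seq mainLoop finishCmd.compile)] (r * p) := by
    intro hT hs
    exact Ok.seq (OkS.bounded hs) (h₁ (by omega) (hs.mono (by omega)))
  have hle : T₂ + 1 + 18 ≤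
      1000 * (r + 1) * (n + rows.length + (rows.map List.length).sum + 1) := by
    rw [hT₂, hTm, ← hS]
    nlinarith [Nat.zero_le (r * n), Nat.zero_le (r * rows.length), Nat.zero_le (r * S)]
  have h₃ := ok_baseCmd i1 i2 hb hlen hB hB' (by omega) h₂
  refine Ok.mono (Ok.seq ?_ h₃) (by omega) le_rfl
  exact fun i => ⟨Nat.zero_le _, (hB i).trans (by unfold Par.B; omega)⟩

end Welzl

namespace Welzl

/-! ### The input -/

lemma rows_getD (rows : List (List ℕ)) : ∀ x (hx : x < rows.length),
    (rows.flatMap fun r => r.length :: r).getD ((rows.take x).map fun r => r.length + 1).sum 0 =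
      rows[x].length ∧ ∀ j (hj : j < rows[x].length),
    (rows.flatMap fun r => r.length :: r).getD
      (((rows.take x).map fun r => r.length + 1).sum + 1 + j) 0 = rows[x][j] := by
  induction rows with
  | nil => exact fun x hx => absurd hx (Nat.not_lt_zero x)
  | cons a rows ih =>
    intro x hx
    cases x with
    | zero =>
      refine ⟨rfl, fun j hj => ?_⟩
      have hj' : j < a.length := hj
      have e : (List.map (fun r : List ℕ => r.length + 1) (List.take 0 (a :: rows))).sum + 1 + j =
        j + 1 := by rw [List.take_zero, List.map_nil, List.sum_nil]; omega
      rw [e, List.flatMap_cons, List.cons_append, List.getD_cons_succ,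
        List.getD_append _ _ _ _ hj', List.getD_eq_getElem _ _ hj']
      rfl
    | succ x =>
      have hx' : x < rows.length := by simpa using hx
      obtain ⟨h1, h2⟩ := ih x hx'
      refine ⟨?_, fun j hj => ?_⟩
      · rw [List.take_succ_cons, List.map_cons, List.sum_cons, List.flatMap_cons,
          List.getD_append_right _ _ _ _ (by simp only [List.length_cons]; omega)]
        simp only [List.length_cons, Nat.add_sub_cancel_left]
        exact h1
      · have hj' : j < rows[x].length := hj
        rw [List.take_succ_cons, List.map_cons, List.sum_cons, List.flatMap_cons,
          List.getD_append_right _ _ _ _ (by simp only [List.length_cons]; omega)]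
        have := h2 j hj'
        simp only [List.length_cons]
        rw [show a.length + 1 + (List.map (fun r : List ℕ => r.length + 1)
          (List.take x rows)).sum + 1 + j - (a.length + 1) =
          (List.map (fun r : List ℕ => r.length + 1) (List.take x rows)).sum + 1 + j by omega]
        exact this

lemma rows_length (rows : List (List ℕ)) :
    (rows.flatMap fun r => r.length :: r).length = (rows.map List.length).sum + rows.length := by
  induction rows with
  | nil => rfl
  | cons a rows ih =>
    simp only [List.flatMap_cons, List.length_append, List.length_cons, List.map_cons,
      List.sum_cons, ih]
    omega

lemma rows_take_sum_le (rows : List (List ℕ)) (x : ℕ) :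
    ((rows.take x).map fun r => r.length + 1).sum ≤ (rows.map List.length).sum + rows.length := by
  induction rows generalizing x with
  | nil => simp
  | cons a rows ih =>
    cases x with
    | zero => simp
    | succ x =>
      have := ih x
      simp only [List.take_succ_cons, List.map_cons, List.sum_cons, List.length_cons]
      omega

lemma written_encode {c d : ℝ} {q n b : ℕ} {rows : List (List ℕ)}
    (hb : 5 + rows.length + (rows.map List.length).sum ≤ b) :
    Written (fun i => (encode c d q n rows).getD i 0) b rows
      fun x => 5 + ((rows.take x).map fun r => r.length + 1).sum := by
  have hget : ∀ i, (encode c d q n rows).getD (5 + i) 0 =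
      (rows.flatMap fun r => r.length :: r).getD i 0 := by
    intro i
    unfold encode
    rw [List.getD_append_right _ _ _ _ (by simp)]
    congr 1
    simp
  have hsucc : ∀ x (hx : x < rows.length), ((rows.take (x + 1)).map fun r => r.length + 1).sum =
      ((rows.take x).map fun r => r.length + 1).sum + (rows[x].length + 1) := by
    intro x hx
    rw [List.take_succ_eq_append_getElem hx, List.map_append, List.sum_append, List.map_cons,
      List.sum_cons, List.map_nil, List.sum_nil, add_zero]
  refine ⟨by simp, fun x hx => ?_, fun x hx => ?_, fun x hx j hj => ?_, fun x hx => ?_⟩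
  · simp only [hsucc x hx]
    omega
  · simp only [hget]
    exact (rows_getD rows x hx).1
  · have := (rows_getD rows x hx).2 j hj
    simp only [add_assoc] at this ⊢
    rw [hget, this]
  · have h1 := rows_take_sum_le rows (x + 1)
    rw [hsucc x hx] at h1
    omega

lemma length_encode (c d : ℝ) (q n : ℕ) (rows : List (List ℕ)) :
    (encode c d q n rows).length = 5 + rows.length + (rows.map List.length).sum := by
  unfold encode
  rw [List.length_append, rows_length]
  simp only [List.length_cons, List.length_nil]
  omega

lemma encode_getD_le {c d : ℝ} {q n B : ℕ} {rows : List (List ℕ)} (hn : n ≤ B)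
    (hm : rows.length ≤ B) (hq : q ≤ B) (hc : ⌈c * q⌉₊ ≤ B) (hd : ⌈d * q⌉₊ ≤ B)
    (hl : ∀ r ∈ rows, r.length ≤ B) (hu : ∀ r ∈ rows, ∀ u ∈ r, u ≤ B) (i : ℕ) :
    (encode c d q n rows).getD i 0 ≤ B := by
  have hall : ∀ x ∈ encode c d q n rows, x ≤ B := by
    intro x hx
    simp only [encode, List.mem_append, List.mem_cons, List.not_mem_nil, or_false,
      List.mem_flatMap] at hx
    rcases hx with (rfl | rfl | rfl | rfl | rfl) | ⟨r, hr, rfl | hx⟩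
    · exact hn
    · exact hm
    · exact hq
    · exact hc
    · exact hd
    · exact hl r hr
    · exact hu r hr x hx
  by_cases hi : i < (encode c d q n rows).length
  · rw [List.getD_eq_getElem _ _ hi]
    exact hall _ (List.getElem_mem hi)
  · rw [List.getD_eq_default _ _ (by omega)]
    exact Nat.zero_le _

variable {S : SetSystem ℕ} {n : ℕ} {rows : List (List ℕ)}

lemma IsListing.mem_family (h : IsListing rows n S) {X : Finset ℕ} :
    X ∈ S.family ↔ ∃ r ∈ rows, r.toFinset = X := by
  rw [← h.2.2.2, List.mem_toFinset, List.mem_map]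

lemma IsListing.lt (h : IsListing rows n S) {r : List ℕ} (hr : r ∈ rows) {u : ℕ} (hu : u ∈ r) :
    u < n := by
  have := S.subset_ground _ (h.mem_family.2 ⟨r, hr, rfl⟩) (List.mem_toFinset.2 hu)
  rwa [h.1, Finset.mem_range] at this

lemma IsListing.length_row_le (h : IsListing rows n S) {r : List ℕ} (hr : r ∈ rows) :
    r.length ≤ n := by
  have := Finset.card_le_card (S.subset_ground _ (h.mem_family.2 ⟨r, hr, rfl⟩))
  rwa [h.1, Finset.card_range, List.toFinset_card_of_nodup (h.2.1 r hr)] at this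

lemma IsListing.size (h : IsListing rows n S) : S.size = n + (rows.map List.length).sum := by
  unfold SetSystem.size
  rw [h.1, Finset.card_range, ← h.2.2.2, List.sum_toFinset _ h.2.2.1, List.map_map]
  congr 2
  exact List.map_congr_left fun r hr => List.toFinset_card_of_nodup (h.2.1 r hr)

lemma IsListing.length (h : IsListing rows n S) : rows.length = S.family.card := by
  rw [← h.2.2.2, List.toFinset_card_of_nodup h.2.2.1, List.length_map]

/-- Sets are distinct, so at most one is empty, and each of the others contributes at least one to
the size. This makes work proportional to the number of sets affordable. -/
lemma IsListing.length_le (h : IsListing rows n S) : rows.length ≤ S.size + 1 := by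
  rw [h.length]
  have h1 : ∀ X ∈ S.family, 1 ≤ X.card + if X = ∅ then 1 else 0 := by
    intro X _
    rcases X.eq_empty_or_nonempty with rfl | hX
    · simp
    · exact hX.card_pos.trans_le (Nat.le_add_right _ _)
  have h2 := Finset.sum_le_sum h1
  rw [Finset.sum_add_distrib, Finset.sum_ite_eq', Finset.sum_const, smul_eq_mul, mul_one] at h2
  have h3 : (if ∅ ∈ S.family then 1 else 0) ≤ 1 := by split_ifs <;> omega
  unfold SetSystem.size
  omega

lemma IsListing.crossingNumber_le (h : IsListing rows n S) {l : List ℕ} {D : ℕ}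
    (hl : ∀ r ∈ rows, SetSystem.crossings l r.toFinset ≤ D) : S.crossingNumber l ≤ D := by
  refine Finset.sup_le fun X hX => ?_
  obtain ⟨r, hr, rfl⟩ := h.mem_family.1 hX
  exact hl r hr

lemma IsListing.isOrder (h : IsListing rows n S) {l : List ℕ} (hl : l.Perm (List.range n)) :
    S.IsOrder l := by
  refine ⟨hl.nodup_iff.2 List.nodup_range, ?_⟩
  rw [h.1, List.toFinset_eq_of_perm _ _ hl, List.toFinset_range]

lemma crossings_eq_zero {l : List ℕ} (h : l.length ≤ 1) (X : Finset ℕ) :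
    SetSystem.crossings l X = 0 := by
  match l, h with
  | [], _ => rfl
  | [a], _ => rfl

/-! ### Shatter functions -/

/-- The number of different traces is bounded by the shatter function. -/
lemma card_traces_le (h : IsListing rows n S) {E : List (ℕ × ℕ)} (hE : Incidence rows E)
    {R : List ℕ} {A : Finset ℕ} {k : ℕ} (hR : R.Nodup) (hlt : ∀ x ∈ R, x < rows.length)
    (hA : ∀ u ∈ A, u < n) (hk : A.card ≤ k)
    (hinj : ∀ x ∈ R, ∀ y ∈ R, (∀ u ∈ A, ((x, u) ∈ E ↔ (y, u) ∈ E)) → x = y) :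
    R.length ≤ S.shatter k := by
  have h1 : A ∈ S.ground.powerset.filter fun A => A.card ≤ k := by
    rw [Finset.mem_filter, Finset.mem_powerset, h.1]
    exact ⟨fun u hu => Finset.mem_range.2 (hA u hu), hk⟩
  refine le_trans ?_ (Finset.le_sup (f := fun A => (S.family.image fun X => X ∩ A).card) h1)
  rw [← List.toFinset_card_of_nodup hR]
  refine Finset.card_le_card_of_injOn (fun x => (rows.getD x []).toFinset ∩ A) ?_ ?_
  · intro x hx
    have hx' := hlt x (List.mem_toFinset.1 hx)
    refine Finset.mem_image_of_mem _ (h.mem_family.2 ⟨rows.getD x [], ?_, rfl⟩)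
    rw [List.getD_eq_getElem _ _ hx']
    exact List.getElem_mem hx'
  · intro x hx y hy hxy
    have hx' := List.mem_toFinset.1 hx
    have hy' := List.mem_toFinset.1 hy
    refine hinj x hx' y hy' fun u hu => ?_
    have h2 := Finset.ext_iff.1 hxy u
    simp only [List.getD_eq_getElem _ _ (hlt x hx'), List.getD_eq_getElem _ _ (hlt y hy'),
      Finset.mem_inter, hu, and_true, List.mem_toFinset] at h2
    rw [hE.mem, hE.mem, exists_prop_of_true (hlt x hx'), exists_prop_of_true (hlt y hy')]
    exact h2

/-- The number of different columns of `k` rows is bounded by the dual shatter function. -/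
lemma card_classes_le (h : IsListing rows n S) {E : List (ℕ × ℕ)} (hE : Incidence rows E)
    {R C : List ℕ} {k : ℕ} (hlt : ∀ x ∈ R, x < rows.length) (hC : ∀ u ∈ C, u < n)
    (hk : R.length ≤ k) :
    (C.toFinset.image fun u => R.toFinset.filter fun x => (x, u) ∈ E).card ≤ S.dual.shatter k := by
  have hmem : ∀ x ∈ R, (rows.getD x []).toFinset ∈ S.family := by
    intro x hx
    refine h.mem_family.2 ⟨rows.getD x [], ?_, rfl⟩
    rw [List.getD_eq_getElem _ _ (hlt x hx)]
    exact List.getElem_mem (hlt x hx)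
  have h1 : R.toFinset.image (fun x => (rows.getD x []).toFinset) ∈
      S.dual.ground.powerset.filter fun A => A.card ≤ k := by
    rw [Finset.mem_filter, Finset.mem_powerset]
    refine ⟨fun X hX => ?_, Finset.card_image_le.trans ((List.toFinset_card_le _).trans hk)⟩
    obtain ⟨x, hx, rfl⟩ := Finset.mem_image.1 hX
    exact hmem x (List.mem_toFinset.1 hx)
  refine le_trans ?_ (Finset.le_sup (f := fun A => (S.dual.family.image fun X => X ∩ A).card) h1)
  refine (Finset.card_le_card ?_).trans (Finset.card_image_le (f := fun Z =>
    R.toFinset.filter fun x => (rows.getD x []).toFinset ∈ Z))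
  -- The column of `u` within `R` is determined by the trace of the dual set of `u` on the sets
  -- listed by `R`, so there are at most as many columns as traces.
  intro T hT
  obtain ⟨u, hu, rfl⟩ := Finset.mem_image.1 hT
  refine Finset.mem_image.2 ⟨_, Finset.mem_image_of_mem _ (Finset.mem_image.2 ⟨u, ?_, rfl⟩), ?_⟩
  · rw [h.1]
    exact Finset.mem_range.2 (hC u (List.mem_toFinset.1 hu))
  · refine Finset.filter_congr fun x hx => ?_
    have hx' := List.mem_toFinset.1 hx
    rw [Finset.mem_inter, Finset.mem_filter]
    simp only [hmem x hx', Finset.mem_image_of_mem (fun x => (rows.getD x []).toFinset) hx,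
      true_and, and_true]
    rw [hE.mem, exists_prop_of_true (hlt x hx'), List.mem_toFinset,
      List.getD_eq_getElem _ _ (hlt x hx')]

end Welzl

namespace Welzl

/-! ### Estimates -/

/-- The machine sees only the fixed-point numerators; this and `ceil_div_le` enclose the constant
`K` that it computes from them. -/
lemma le_ceil_div {x : ℝ} {q : ℕ} (hq : 0 < q) : x ≤ (⌈x * q⌉₊ / q : ℕ) + 1 := by
  have hq' : (0 : ℝ) < q := by exact_mod_cast hq
  have h1 : x * q ≤ ⌈x * q⌉₊ := Nat.le_ceil _
  have h2 : ⌈x * q⌉₊ < q * (⌈x * q⌉₊ / q + 1) := Nat.lt_mul_div_succ _ hq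
  have h3 : ((⌈x * q⌉₊ : ℕ) : ℝ) < q * ((⌈x * q⌉₊ / q : ℕ) + 1) := by exact_mod_cast h2
  rw [mul_comm (q : ℝ)] at h3
  exact (lt_of_mul_lt_mul_right (h1.trans_lt h3) hq'.le).le

lemma ceil_mul_le {x : ℝ} {q : ℕ} : ⌈x * q⌉₊ ≤ ⌈x⌉₊ * q := by
  refine Nat.ceil_le.2 ?_
  push_cast
  exact mul_le_mul_of_nonneg_right (Nat.le_ceil x) (Nat.cast_nonneg q)

lemma ceil_div_le {x : ℝ} {q : ℕ} : ⌈x * q⌉₊ / q ≤ ⌈x⌉₊ :=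
  Nat.div_le_of_le_mul (ceil_mul_le.trans (mul_comm _ _).le)

lemma le_two_rpow {c : ℝ} (hc : 1 ≤ c) : c ≤ 2 ^ c := by
  have := one_add_mul_self_le_rpow_one_add (s := 1) (by norm_num) hc
  norm_num at this
  linarith

/-- Classes are rare if there are few traces and the dual shatter function is small. -/
lemma two_mul_le_two_pow {c d : ℝ} (hc : 1 ≤ c) (hd : 2 ≤ d) {j L K b : ℕ} (hKL : K ≤ L)
    (hj : d ^ 2 * j ≤ (L - K : ℕ)) (hK : (d + 1) * c + 1 ≤ K)
    (hb : (b : ℝ) ≤ c * (⌊c * ((2 ^ j : ℕ) : ℝ) ^ d⌋₊ : ℝ) ^ d) : 2 * b ≤ 2 ^ L := by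
  have hc0 : 0 ≤ c := by linarith
  have hd0 : 0 ≤ d := by linarith
  have h2 : (0 : ℝ) ≤ 2 := by norm_num
  have e1 : ((2 ^ j : ℕ) : ℝ) ^ d = (2 : ℝ) ^ (j * d) := by
    rw [Nat.cast_pow, Nat.cast_ofNat, ← Real.rpow_natCast, ← Real.rpow_mul h2]
  have hp : (0 : ℝ) ≤ 2 ^ (j * d) := Real.rpow_nonneg h2 _
  -- Applying the two shatter bounds in turn gives `c ^ (d + 1) 2 ^ (j d ^ 2)`. Since `c ≤ 2 ^ c`,
  -- the constant is at most `2 ^ (c (d + 1))`, and `K` exceeds that exponent by the one needed for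
  -- the factor `2`.
  have h3 : (b : ℝ) ≤ c * (c ^ d * 2 ^ (j * d * d)) := by
    refine hb.trans (mul_le_mul_of_nonneg_left ?_ hc0)
    rw [Real.rpow_mul h2 (j * d), ← Real.mul_rpow hc0 hp]
    refine Real.rpow_le_rpow (Nat.cast_nonneg _) ?_ hd0
    rw [e1]
    exact Nat.floor_le (mul_nonneg hc0 hp)
  have h4 : c * c ^ d ≤ 2 ^ (c * (d + 1)) := by
    rw [Real.rpow_mul h2, Real.rpow_add (by positivity), Real.rpow_one, mul_comm]
    gcongr <;> exact le_two_rpow hc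
  have h5 : (2 * b : ℝ) ≤ 2 ^ (L : ℝ) := by
    calc (2 * b : ℝ) ≤ 2 ^ (1 : ℝ) * (2 ^ (c * (d + 1)) * 2 ^ (j * d * d)) := by
          rw [Real.rpow_one]
          refine mul_le_mul_of_nonneg_left (h3.trans ?_) h2
          rw [← mul_assoc]
          exact mul_le_mul_of_nonneg_right h4 (Real.rpow_nonneg h2 _)
      _ = 2 ^ (1 + (c * (d + 1) + j * d * d)) := by
          rw [Real.rpow_add (by norm_num), Real.rpow_add (by norm_num)]
      _ ≤ 2 ^ (L : ℝ) := by
          refine Real.rpow_le_rpow_of_exponent_le (by norm_num) ?_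
          rw [Nat.cast_sub hKL] at hj
          nlinarith
  rw [Real.rpow_natCast] at h5
  exact_mod_cast h5

/-- Samples are large. -/
lemma le_mul_two_pow {d : ℝ} (hd : 2 ≤ d) {j L K q D n N : ℕ} (hKL : K ≤ L) (hn : 0 < n)
    (hN : N ≤ n) (hNL : N < 2 ^ (L + 1)) (hnq : n ≤ q) (hD : d * q ≤ D) (hD' : (D : ℝ) ≤ d * q + 1)
    (hj : (L - K) * (q * q) < (j + 1) * (D * D)) :
    (N : ℝ) ≤ 2 ^ (K + 3) * (n : ℝ) ^ (1 - 1 / d ^ 2) * 2 ^ j := by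
  rcases Nat.eq_zero_or_pos N with rfl | hN0
  · rw [Nat.cast_zero]; positivity
  have hN' : (0 : ℝ) < N := by exact_mod_cast hN0
  have hn' : (0 : ℝ) < n := by exact_mod_cast hn
  have hn1 : (1 : ℝ) ≤ n := by exact_mod_cast hn
  have hq : (0 : ℝ) < q := by exact_mod_cast hn.trans_le hnq
  have hd0 : (0 : ℝ) < d := by linarith
  have hdq : 0 < d * q := mul_pos hd0 hq
  have hD0 : (0 : ℝ) < D := hdq.trans_le hD
  have h2 : (0 : ℝ) < 2 := by norm_num
  -- The rational number `ρ` is the machine's substitute for `1 / d ^ 2`. Splitting `N = N ^ ρ * N ^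
  -- (1 - ρ)`, the first factor is compared with the sample size and the second with `n ^ (1 - 1 / d
  -- ^ 2)`.
  obtain ⟨ρ, hρ⟩ : ∃ ρ : ℝ, ρ = (q * q) / (D * D) := ⟨_, rfl⟩
  have hρ0 : 0 ≤ ρ := by rw [hρ]; positivity
  have hρ1 : ρ ≤ 1 := by
    rw [hρ, div_le_one (by positivity)]
    have : (q : ℝ) ≤ D := by nlinarith
    nlinarith
  have hjρ : ((L : ℝ) - K) * ρ ≤ j + 1 := by
    rw [hρ, ← mul_div_assoc, div_le_iff₀ (by positivity), ← Nat.cast_sub hKL]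
    exact_mod_cast hj.le
  -- The error from rounding `d` is at most `1 / q`. As `n ≤ q ≤ 2 ^ q`, it changes a power of `n`
  -- by at most the factor `2`; this is why a precision of order `1 / ‖S‖` is enough.
  have hdρ : 1 / d ^ 2 - ρ ≤ 1 / q := by
    have h1 : (q * q) / ((d * q + 1) * (d * q + 1)) ≤ ρ := by
      rw [hρ]
      gcongr
    refine (sub_le_sub_left h1 _).trans ?_
    rw [div_sub_div _ _ (by positivity) (by positivity), div_le_div_iff₀ (by positivity) hq]
    have hq1 : (1 : ℝ) ≤ q := by exact_mod_cast hn.trans_le hnq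
    have h4 : 4 * (d * q) ≤ d * (d * q) * 2 := by nlinarith
    nlinarith [sq_nonneg (d * q), mul_pos hdq hdq, mul_pos hd0 hdq]
  have h1 : (N : ℝ) ^ ρ ≤ 2 ^ (K + 2) * 2 ^ j := by
    calc (N : ℝ) ^ ρ ≤ ((2 : ℝ) ^ ((L : ℝ) + 1)) ^ ρ := by
          refine Real.rpow_le_rpow hN'.le ?_ hρ0
          rw [← Nat.cast_add_one, Real.rpow_natCast]
          exact_mod_cast hNL.le
      _ = 2 ^ ((L + 1) * ρ) := (Real.rpow_mul h2.le _ _).symm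
      _ ≤ 2 ^ (((K + 2 : ℕ) : ℝ) + j) := by
          refine Real.rpow_le_rpow_of_exponent_le (by norm_num) ?_
          push_cast
          -- With `(L - K) * ρ ≤ j + 1` this gives `(L + 1) * ρ ≤ K + 2 + j`: subtracting `K` and
          -- rounding down cost only a constant factor.
          have : ((K : ℝ) + 1) * ρ ≤ K + 1 := mul_le_of_le_one_right (by positivity) hρ1
          nlinarith
      _ = _ := by rw [Real.rpow_add h2, Real.rpow_natCast, Real.rpow_natCast]
  have h3 : (N : ℝ) ^ (1 - ρ) ≤ n ^ (1 - 1 / d ^ 2) * 2 := by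
    calc (N : ℝ) ^ (1 - ρ) ≤ (n : ℝ) ^ (1 - ρ) :=
          Real.rpow_le_rpow hN'.le (by exact_mod_cast hN) (by linarith)
      _ = n ^ (1 - 1 / d ^ 2) * n ^ (1 / d ^ 2 - ρ) := by
          rw [← Real.rpow_add hn']; congr 1; ring
      _ ≤ n ^ (1 - 1 / d ^ 2) * 2 := by
          refine mul_le_mul_of_nonneg_left ?_ (by positivity)
          calc (n : ℝ) ^ (1 / d ^ 2 - ρ) ≤ (n : ℝ) ^ (1 / (q : ℝ)) :=
                Real.rpow_le_rpow_of_exponent_le hn1 hdρ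
            _ ≤ ((2 : ℝ) ^ (q : ℝ)) ^ (1 / (q : ℝ)) := by
                refine Real.rpow_le_rpow hn'.le ?_ (by positivity)
                rw [Real.rpow_natCast]
                have : n ≤ 2 ^ q := hnq.trans Nat.lt_two_pow_self.le
                exact_mod_cast this
            _ = 2 := by
                rw [← Real.rpow_mul h2.le, mul_one_div, div_self hq.ne', Real.rpow_one]
  calc (N : ℝ) = N ^ (1 - ρ) * N ^ ρ := by
        rw [← Real.rpow_add hN', sub_add_cancel, Real.rpow_one]
    _ ≤ (n ^ (1 - 1 / d ^ 2) * 2) * (2 ^ (K + 2) * 2 ^ j) := by gcongr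
    _ = _ := by rw [pow_succ (2 : ℝ) (K + 2)]; ring

end Welzl

/-! ### Shrinking of the representatives and quality of random samples -/

namespace Welzl

variable {S : SetSystem ℕ} {n : ℕ} {rows : List (List ℕ)}

/-- A round removes a quarter of the representatives. -/
lemma Outcome.four_mul_le (h : IsListing rows n S) {c d : ℝ} (hc : 1 ≤ c) (hd : 2 ≤ d)
    (hS : ∀ k : ℕ, 1 ≤ k → (S.shatter k : ℝ) ≤ c * (k : ℝ) ^ d)
    (hS' : ∀ k : ℕ, 1 ≤ k → (S.dual.shatter k : ℝ) ≤ c * (k : ℝ) ^ d) {e : Env} (hn : e.n = n)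
    (hE : Incidence rows e.E) (hm : e.m = rows.length) (hK : (d + 1) * c + 1 ≤ e.K)
    {C C' R l : List ℕ} {nx nx' : ℕ → ℕ} (hC : ∀ u ∈ C, u < n) (hL : e.K < Nat.log 2 C.length)
    (hl : l.length = 2 ^ e.sampleLog C)
    (hj : d ^ 2 * e.sampleLog C ≤ (Nat.log 2 C.length - e.K : ℕ))
    (ho : Outcome e (Sampled l C) C C' R nx nx') : 4 * C'.length ≤ 3 * C.length := by
  subst hn
  have hlt : ∀ x ∈ R, x < rows.length := fun x hx => hm ▸ ho.lt x hx
  have h1 : R.length ≤ S.shatter (2 ^ e.sampleLog C) := by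
    refine card_traces_le h hE (A := (l.map fun i => C.getD i 0).toFinset ∩ C.toFinset) ho.nodup
      hlt ?_ ?_ ?_
    · intro u hu
      exact hC u (List.mem_toFinset.1 (Finset.mem_inter.1 hu).2)
    · refine (Finset.card_le_card Finset.inter_subset_left).trans ?_
      exact (List.toFinset_card_le _).trans (by rw [List.length_map, hl])
    · intro x hx y hy hxy
      refine ho.inj x hx y hy fun u hu hA => hxy u ?_
      exact Finset.mem_inter.2 ⟨List.mem_toFinset.2 hA, List.mem_toFinset.2 hu⟩
  have h2 := hS (2 ^ e.sampleLog C) Nat.one_le_two_pow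
  have h3 : R.length ≤ ⌊c * ((2 ^ e.sampleLog C : ℕ) : ℝ) ^ d⌋₊ :=
    Nat.le_floor ((Nat.cast_le.2 h1).trans h2)
  have h4 : 1 ≤ ⌊c * ((2 ^ e.sampleLog C : ℕ) : ℝ) ^ d⌋₊ := by
    refine Nat.le_floor ?_
    rw [Nat.cast_one]
    refine one_le_mul_of_one_le_of_one_le hc (Real.one_le_rpow ?_ (by linarith))
    exact_mod_cast Nat.one_le_two_pow
  -- The dual shatter function is evaluated at the bound for the number of traces, which is at least
  -- `1`, rather than at `R.length`, which might be `0`.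
  have h5 := card_classes_le h hE hlt hC h3
  have h6 := two_mul_le_two_pow hc hd hL.le hj hK ((Nat.cast_le.2 h5).trans (hS' _ h4))
  have h7 := Nat.pow_log_le_self 2 (x := C.length) (by rintro h0; simp [h0] at hL)
  have h8 := ho.card
  omega

/-- Sets with the same trace on a good sample differ in at most `θ` representatives. -/
def GoodSample (e : Env) (C : List ℕ) (θ : ℕ) (l : List ℕ) : Prop :=
  ∀ x < e.m, ∀ y < e.m, (∀ u ∈ C, Sampled l C u → ((x, u) ∈ e.E ↔ (y, u) ∈ e.E)) →
    (C.countP fun u => ¬ ((x, u) ∈ e.E ↔ (y, u) ∈ e.E)) ≤ θ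

/-- Take a kept set `y` with the same trace as `x`, and let `D` be their symmetric difference.
Paired representatives agree on `y`, so outside of `D` they agree on `x` as well, and
`Outcome.cross` charges the new crossings to the at most `θ` representatives in `D`. -/
lemma GoodSample.cr_le {e : Env} {C C' R l : List ℕ} {nx nx' : ℕ → ℕ} {θ : ℕ}
    (h : GoodSample e C θ l) (ho : Outcome e (Sampled l C) C C' R nx nx') {x : ℕ} (hx : x < e.m) :
    cr e.n (fun u => (x, u) ∈ e.E) nx' ≤ cr e.n (fun u => (x, u) ∈ e.E) nx + 2 * θ := by
  obtain ⟨y, hy, hyx⟩ := ho.cover x hx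
  have h1 := ho.cross (fun u => (x, u) ∈ e.E) (fun u => ¬ ((y, u) ∈ e.E ↔ (x, u) ∈ e.E)) ?_
  · have h2 := h y (ho.lt y hy) x hx hyx
    omega
  · intro u _ v _ huv hu hv
    rw [not_not] at hu hv
    rw [← hu, ← hv]
    exact huv y hy

lemma countP_eq_card_filter_range (C : List ℕ) (D : ℕ → Prop) [DecidablePred D] :
    (C.countP fun u => D u) = ((Finset.range C.length).filter fun i => D (C.getD i 0)).card := by
  have h : C = (List.range C.length).map fun i => C.getD i 0 := by
    refine List.ext_getElem (by simp) fun i h1 h2 => ?_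
    simp [h1]
  conv_lhs => rw [h, List.countP_map, List.countP_eq_length_filter]
  rfl

/-- This is `(1 - θ / k) ^ r ≤ exp (-θ r / k)`. -/
lemma avoid_le {k r a θ : ℕ} {t : ℝ} (hk : 0 < k) (ha : a + θ ≤ k) (ht : t * k ≤ θ * r) :
    ((k : ENNReal)⁻¹ * a) ^ r ≤ ENNReal.ofReal (Real.exp (-t)) := by
  have hk' : (0 : ℝ) < k := by exact_mod_cast hk
  have h1 : (k : ENNReal)⁻¹ * a ≤ ENNReal.ofReal (Real.exp (-(θ / k))) := by
    have e1 : (k : ENNReal)⁻¹ * a = ENNReal.ofReal ((k : ℝ)⁻¹ * a) := by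
      rw [ENNReal.ofReal_mul (by positivity), ENNReal.ofReal_inv_of_pos hk',
        ENNReal.ofReal_natCast, ENNReal.ofReal_natCast]
    rw [e1]
    refine ENNReal.ofReal_le_ofReal ?_
    refine le_trans ?_ (Real.add_one_le_exp _)
    have : (a : ℝ) + θ ≤ k := by exact_mod_cast ha
    rw [inv_mul_le_iff₀ hk', mul_add, mul_neg, mul_div_cancel₀ _ hk'.ne']
    linarith
  refine (pow_le_pow_left₀ zero_le h1 r).trans ?_
  rw [← ENNReal.ofReal_pow (Real.exp_pos _).le, ← Real.exp_nat_mul]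
  refine ENNReal.ofReal_le_ofReal (Real.exp_le_exp.2 ?_)
  rw [mul_neg, neg_le_neg_iff, ← mul_div_assoc, le_div_iff₀ hk', mul_comm (r : ℝ)]
  exact ht

open Classical in
/-- The probability that a sample is not good. -/
lemma avg_not_good_le (e : Env) {C : List ℕ} (hC : C ≠ []) {θ r : ℕ} {t : ℝ}
    (ht : t * C.length ≤ θ * r) :
    avg C.length r (fun l => if GoodSample e C θ l then 0 else 1) ≤
      ENNReal.ofReal (e.m ^ 2 * Real.exp (-t)) := by
  have hk : 0 < C.length := List.length_pos_iff.2 hC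
  -- A bad sample is witnessed by a pair of sets whose difference is large and is missed by all
  -- draws; the indicator is bounded by the sum over all pairs.
  have h1 : avg C.length r (fun l => if GoodSample e C θ l then 0 else 1) ≤
      avg C.length r (fun l => ∑ z ∈ Finset.range e.m ×ˢ Finset.range e.m,
        if (C.countP fun u => ¬ ((z.1, u) ∈ e.E ↔ (z.2, u) ∈ e.E)) ≤ θ then 0 else
          if ∀ i ∈ l, ¬ ¬ ((z.1, C.getD i 0) ∈ e.E ↔ (z.2, C.getD i 0) ∈ e.E) then 1 else 0) := by
    refine avg_mono r fun l _ hlk => ?_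
    split_ifs with hg
    · exact zero_le
    · unfold GoodSample at hg
      push Not at hg
      obtain ⟨x, hx, y, hy, hxy, hθ⟩ := hg
      refine le_trans ?_ (Finset.single_le_sum (fun _ _ => zero_le) (a := (x, y))
        (Finset.mem_product.2 ⟨Finset.mem_range.2 hx, Finset.mem_range.2 hy⟩))
      rw [if_neg (not_le.2 ?_), if_pos fun i hi => not_not.2 (hxy _ ?_ ?_)]
      · have := hlk i hi
        rw [List.getD_eq_getElem _ _ this]
        exact List.getElem_mem this
      · exact List.mem_map_of_mem hi
      · convert hθ
        dsimp only
        tauto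
  refine h1.trans ?_
  rw [avg_sum]
  have h2 : ∀ z ∈ Finset.range e.m ×ˢ Finset.range e.m, avg C.length r (fun l =>
      if (C.countP fun u => ¬ ((z.1, u) ∈ e.E ↔ (z.2, u) ∈ e.E)) ≤ θ then 0 else
        if ∀ i ∈ l, ¬ ¬ ((z.1, C.getD i 0) ∈ e.E ↔ (z.2, C.getD i 0) ∈ e.E) then 1 else 0) ≤
      ENNReal.ofReal (Real.exp (-t)) := by
    intro z _
    split_ifs with hθ
    · rw [avg_const hk.ne']
      exact zero_le
    · rw [avg_avoid r fun i => ¬ ((z.1, C.getD i 0) ∈ e.E ↔ (z.2, C.getD i 0) ∈ e.E)]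
      refine avoid_le hk ?_ ht
      rw [countP_eq_card_filter_range] at hθ
      have := Finset.card_filter_add_card_filter_not (s := Finset.range C.length)
        fun i => ¬ ((z.1, C.getD i 0) ∈ e.E ↔ (z.2, C.getD i 0) ∈ e.E)
      rw [Finset.card_range] at this
      omega
  refine (Finset.sum_le_sum h2).trans ?_
  rw [Finset.sum_const, Finset.card_product, Finset.card_range, nsmul_eq_mul,
    ENNReal.ofReal_mul (by positivity), ENNReal.ofReal_pow (Nat.cast_nonneg _),
    ENNReal.ofReal_natCast, sq, Nat.cast_mul]

end Welzl

/-! ### Choice of the parameters -/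

namespace Welzl

variable {S : SetSystem ℕ} {n : ℕ} {rows : List (List ℕ)}

/-- Three rounds more than halve the number of representatives, as `2 * 27 ≤ 64`. Hence `3 *
(Nat.log 2 n + 1)` rounds suffice. -/
lemma mul_three_pow_le (n : ℕ) :
    n * 3 ^ (3 * (Nat.log 2 n + 1)) ≤ 4 ^ (3 * (Nat.log 2 n + 1)) := by
  have h : n ≤ 2 ^ (Nat.log 2 n + 1) := (Nat.lt_pow_succ_log_self (by norm_num) n).le
  calc n * 3 ^ (3 * (Nat.log 2 n + 1))
      ≤ 2 ^ (Nat.log 2 n + 1) * 3 ^ (3 * (Nat.log 2 n + 1)) := Nat.mul_le_mul_right _ h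
    _ = 54 ^ (Nat.log 2 n + 1) := by rw [pow_mul, ← mul_pow]; norm_num
    _ ≤ 64 ^ (Nat.log 2 n + 1) := Nat.pow_le_pow_left (by norm_num) _
    _ = _ := by rw [pow_mul]; norm_num

/-- The running time. -/
def totalTime (n N m : ℕ) : ℕ := 1000 * (3 * (Nat.log 2 n + 1) + 1) * (N + m + 1)

/-- The bounds for the numbers, for `a = ⌈c⌉ + ⌈d⌉ + 5`. -/
def bounds (a N m T : ℕ) : Par := ⟨a ^ 2 * (N + 2) ^ 3, 5 + m + (N + 1), T⟩

-- Instantiates the program's guarantee with failure probability `1 / (3 r)` for each of `r` rounds.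
-- The parameters `t` and `θ` remain free, subject to the inequalities that the union bound and the
-- sample size require.
open Classical in
theorem ok_start (h : IsListing rows n S) {c d : ℝ} (hc : 1 ≤ c) (hd : 2 ≤ d)
    (hS : ∀ k : ℕ, 1 ≤ k → (S.shatter k : ℝ) ≤ c * (k : ℝ) ^ d)
    (hS' : ∀ k : ℕ, 1 ≤ k → (S.dual.shatter k : ℝ) ≤ c * (k : ℝ) ^ d) {t : ℝ} {K θ : ℕ}
    (hK : K = (⌈d⌉₊ + 2) * (⌈c⌉₊ + 1) + 1)
    (ht : 2 ≤ n → (rows.length : ℝ) ^ 2 * Real.exp (-t) ≤ 1 / (3 * (3 * (Nat.log 2 n + 1))))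
    (ht0 : 0 ≤ t)
    (hθ : 2 ≤ n → t * (2 ^ (K + 3) * (n : ℝ) ^ (1 - 1 / d ^ 2)) ≤ θ) :
    ∃ D ≤ 3 * (Nat.log 2 n + 1) * (2 * θ) + 2 ^ (K + 2),
    Ok (bounds (⌈c⌉₊ + ⌈d⌉₊ + 5) S.size rows.length (totalTime n S.size rows.length)).B
      (Success n rows D)
      (totalTime n S.size rows.length)
      (start welzlProgram (encode c d (S.size + 1) n rows)) (1 / 3) := by
  obtain ⟨N, hN⟩ : ∃ N, N = S.size := ⟨_, rfl⟩
  obtain ⟨a, ha⟩ : ∃ a, a = ⌈c⌉₊ + ⌈d⌉₊ + 5 := ⟨_, rfl⟩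
  obtain ⟨q, hq⟩ : ∃ q, q = N + 1 := ⟨_, rfl⟩
  obtain ⟨Cq, hCq⟩ : ∃ Cq, Cq = ⌈c * q⌉₊ := ⟨_, rfl⟩
  obtain ⟨D, hD⟩ : ∃ D, D = ⌈d * q⌉₊ := ⟨_, rfl⟩
  obtain ⟨r, hr⟩ : ∃ r, r = 3 * (Nat.log 2 n + 1) := ⟨_, rfl⟩
  obtain ⟨k, hk⟩ : ∃ k, k = (D / q + 2) * (Cq / q + 1) + 1 := ⟨_, rfl⟩
  have hsz := h.size
  have hlen := h.length_le
  rw [← hN] at hsz hlen ⊢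
  rw [← ha, ← hq, ← hr]
  have hq0 : 0 < q := by omega
  have hCle : Cq ≤ ⌈c⌉₊ * q := hCq ▸ ceil_mul_le
  have hDle : D ≤ ⌈d⌉₊ * q := hD ▸ ceil_mul_le
  have hC' : Cq / q ≤ ⌈c⌉₊ := hCq ▸ ceil_div_le
  have hD' : D / q ≤ ⌈d⌉₊ := hD ▸ ceil_div_le
  -- The machine's constant `k` depends on the precision `q`, and so on the input; the final bounds
  -- use `K`, which depends on `c` and `d` only.
  have hkK : k ≤ K := by
    rw [hk, hK]
    gcongr
  have hklow : (d + 1) * c + 1 ≤ k := by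
    have h1 : c ≤ (Cq / q : ℕ) + 1 := by rw [hCq]; exact le_ceil_div hq0
    have h2 : d ≤ (D / q : ℕ) + 1 := by rw [hD]; exact le_ceil_div hq0
    rw [hk]
    push_cast
    have h3 : (d + 1) * c ≤ ((D / q : ℕ) + 2) * ((Cq / q : ℕ) + 1) :=
      mul_le_mul (by linarith) h1 (by linarith) (by positivity)
    exact add_le_add_left h3 1
  have hdqD : d * q ≤ D := hD ▸ Nat.le_ceil _
  have hDdq : (D : ℝ) ≤ d * q + 1 := hD ▸ (Nat.ceil_lt_add_one (by positivity)).le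
  have hqD : q ≤ D := by
    have : (q : ℝ) ≤ D := by nlinarith [Nat.cast_nonneg (α := ℝ) q]
    exact_mod_cast this
  have hB : a ^ 2 * (N + 2) ^ 3 = (bounds a N rows.length (totalTime n N rows.length)).B₀ := rfl
  have ha5 : 5 ≤ a := by omega
  have haq : a ^ 2 * q ^ 2 ≤ a ^ 2 * (N + 2) ^ 3 := by
    refine Nat.mul_le_mul_left _ ((Nat.pow_le_pow_left (by omega) 2).trans
      (Nat.pow_le_pow_right (by omega) (by norm_num)))
  have haq1 : a * q ≤ a ^ 2 * q ^ 2 := by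
    rw [← mul_pow]; exact Nat.le_self_pow (by norm_num) _
  have hqa : q ≤ a * q := Nat.le_mul_of_pos_left _ (by omega)
  have hCa : ⌈c⌉₊ * q ≤ a * q := Nat.mul_le_mul_right _ (by omega)
  have hDa : ⌈d⌉₊ * q ≤ a * q := Nat.mul_le_mul_right _ (by omega)
  have haB : a ^ 2 ≤ a ^ 2 * q ^ 2 := Nat.le_mul_of_pos_right _ (by positivity)
  have haa : a ≤ a ^ 2 := Nat.le_self_pow (by norm_num) _
  have hrow : ∀ x ∈ rows, x.length ≤ N := fun x hx => (h.length_row_le hx).trans (by omega)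
  have hL2 : ∀ C : List ℕ, C.Nodup → (∀ u ∈ C, u < n) → C.length ≤ n := by
    intro C hC hCn
    have h1 : C.toFinset ⊆ Finset.range n := fun x hx =>
      Finset.mem_range.2 (hCn x (List.mem_toFinset.1 hx))
    have h2 := Finset.card_le_card h1
    rwa [List.toFinset_card_of_nodup hC, Finset.card_range] at h2
  have hok := ok_welzlProgram (π := bounds a N rows.length (totalTime n N rows.length))
    (rows := rows) (n := n) (q := q) (c := Cq) (d := D) (r := r) (K := k) (Δ := 2 * θ)
    (p := ENNReal.ofReal (1 / (3 * r))) (input := encode c d q n rows)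
    (written_encode (by simp only [bounds]; omega)) h.2.1 (by simp only [bounds]; omega)
    (by rw [length_encode]; simp only [bounds]; omega) (by simp only [bounds]; omega) rfl rfl rfl
    (hCq ▸ rfl) (hD ▸ rfl) (encode_getD_le (by omega) (by omega) (by omega) (by omega) (by omega)
      (fun x hx => (hrow x hx).trans (by omega)) fun x hx u hu => (h.lt hx hu).le.trans (by omega))
    (by omega) hk ?_ ?_ ?_ ?_ hqD (hr ▸ mul_three_pow_le n) ?_ ?_ ?_
  · have htime : 1000 * (r + 1) * (n + rows.length + (rows.map List.length).sum + 1) =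
        totalTime n N rows.length := by
      rw [totalTime, hr, hsz]
      ring
    rw [htime] at hok
    refine ⟨_, ?_, hok.mono le_rfl ?_⟩
    · gcongr
      norm_num
    · have hr0 : (0 : ℝ) < r := by rw [hr]; positivity
      rw [← ENNReal.ofReal_natCast, ← ENNReal.ofReal_mul hr0.le]
      have e1 : (r : ℝ) * (1 / (3 * r)) = 3⁻¹ := by field_simp
      rw [e1, ENNReal.ofReal_inv_of_pos (by norm_num)]
      simp
  · have h1 : K ≤ a ^ 2 := by
      rw [hK, ha]
      nlinarith
    omega
  · refine le_trans ?_ (Nat.le_mul_of_pos_left _ (by positivity))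
    calc n * (q * q) ≤ (N + 2) * ((N + 2) * (N + 2)) := by gcongr <;> omega
      _ = (N + 2) ^ 3 := by ring
  · have : q * q = q ^ 2 := (sq q).symm
    have h2 : q ^ 2 ≤ a ^ 2 * q ^ 2 := Nat.le_mul_of_pos_left _ (by positivity)
    omega
  · have h2 : D * D ≤ a ^ 2 * q ^ 2 := by
      rw [← mul_pow, sq]
      exact Nat.mul_self_le_mul_self (hDle.trans hDa)
    omega
  · intro P E hE C hC hCn hCk l hl _ C' R nx nx' ho
    refine ho.four_mul_le h hc hd hS hS' rfl hE rfl hklow hCn hCk hl ?_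
    have h1 : (Env.mk n rows.length k (q * q) (D * D) P E).sampleLog C * (D * D) ≤
        (Nat.log 2 C.length - k) * (q * q) := Nat.div_mul_le_self _ _
    have h2 : ((Env.mk n rows.length k (q * q) (D * D) P E).sampleLog C : ℝ) * (D * D) ≤
        (Nat.log 2 C.length - k : ℕ) * (q * q) := by exact_mod_cast h1
    have hq' : (0 : ℝ) < q := by exact_mod_cast hq0
    have h3 : (d * q) * (d * q) ≤ (D : ℝ) * D := by gcongr
    have h4 := mul_le_mul_of_nonneg_left h3
      (Nat.cast_nonneg (α := ℝ) ((Env.mk n rows.length k (q * q) (D * D) P E).sampleLog C))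
    refine le_of_mul_le_mul_right ?_ (mul_pos hq' hq')
    refine le_trans (le_of_eq ?_) (h4.trans h2)
    ring
  · intro P E hE C hC hCn hCk
    have hCl := hL2 C hC hCn
    -- A round takes place only if `Nat.log 2 C.length` is positive, so `n` is at least `2` and the
    -- conditional hypotheses on `t` and `θ` apply.
    have hC2 : 2 ≤ C.length := by
      by_contra hlt
      rw [Nat.log_of_lt (by omega)] at hCk
      omega
    refine ⟨GoodSample ⟨n, rows.length, k, q * q, D * D, P, E⟩ C θ, ?_,
      fun l hg C' R nx nx' ho x hx => hg.cr_le ho hx⟩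
    refine (avg_not_good_le _ (by rintro rfl; simp at hC2) (t := t) ?_).trans
      (ENNReal.ofReal_le_ofReal ?_)
    · have h1 : (Nat.log 2 C.length - k) * (q * q) <
          ((Env.mk n rows.length k (q * q) (D * D) P E).sampleLog C + 1) * (D * D) := by
        rw [mul_comm _ (D * D)]
        exact Nat.lt_mul_div_succ _ (Nat.mul_pos (by omega) (by omega))
      have h2 := le_mul_two_pow hd hCk.le (by omega) hCl
        (Nat.lt_pow_succ_log_self (by norm_num) _) (by omega) hdqD hDdq h1
      push_cast
      calc t * C.length ≤ t * (2 ^ (k + 3) * (n : ℝ) ^ (1 - 1 / d ^ 2) *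
            2 ^ (Env.mk n rows.length k (q * q) (D * D) P E).sampleLog C) :=
            mul_le_mul_of_nonneg_left h2 ht0
        _ ≤ t * (2 ^ (K + 3) * (n : ℝ) ^ (1 - 1 / d ^ 2)) *
            2 ^ (Env.mk n rows.length k (q * q) (D * D) P E).sampleLog C := by
            rw [← mul_assoc]
            gcongr
            norm_num
        _ ≤ _ := by
            gcongr
            exact hθ (by omega)
    · have := ht (by omega)
      rw [hr]
      push_cast
      exact this
  · rw [totalTime, hr]
    simp only [bounds]
    exact le_of_eq (by rw [hsz]; ring)

end Welzl

/-! ### Asymptotic bounds and conclusion -/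

namespace Welzl

variable {S : SetSystem ℕ} {n : ℕ} {rows : List (List ℕ)}

/-- Distinct sets have distinct traces on the whole ground set. So the number of sets is polynomial
in `n`, and the union bound costs only a factor of order `log n` in the sample. -/
lemma IsListing.length_le_shatter (h : IsListing rows n S) : rows.length ≤ S.shatter n := by
  have h1 : S.ground ∈ S.ground.powerset.filter fun A => A.card ≤ n := by
    rw [Finset.mem_filter, Finset.mem_powerset]
    exact ⟨Finset.Subset.refl _, by rw [h.1, Finset.card_range]⟩
  refine le_trans ?_ (Finset.le_sup (f := fun A => (S.family.image fun X => X ∩ A).card) h1)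
  rw [h.length]
  refine Finset.card_le_card_of_injOn (fun X => X ∩ S.ground)
    (fun X hX => Finset.mem_image_of_mem _ hX) fun X hX Y hY hXY => ?_
  simpa only [Finset.inter_eq_left.2 (S.subset_ground X hX),
    Finset.inter_eq_left.2 (S.subset_ground Y hY)] using hXY

lemma natLog_le_logb {a b : ℕ} (ha : a ≠ 0) (h : a ≤ b) : (Nat.log 2 a : ℝ) ≤ Real.logb 2 b := by
  rw [Real.le_logb_iff_rpow_le (by norm_num) (by exact_mod_cast (by omega : 0 < b)),
    Real.rpow_natCast]
  exact_mod_cast (Nat.pow_log_le_self 2 ha).trans h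

lemma one_le_logb {a : ℕ} (h : 2 ≤ a) : 1 ≤ Real.logb 2 a := by
  rw [Real.le_logb_iff_rpow_le (by norm_num) (by exact_mod_cast (by omega : 0 < a)),
    Real.rpow_one]
  exact_mod_cast h

lemma totalTime_le {n N m : ℕ} (hn : n ≤ N) (hm : m ≤ N + 1) :
    (totalTime n N m : ℝ) ≤ 28000 * (N * Real.logb 2 N + 1) := by
  unfold totalTime
  have hm' : (m : ℝ) ≤ N + 1 := by exact_mod_cast hm
  push_cast
  rcases Nat.lt_or_ge N 2 with hN | hN
  · have h0 : Nat.log 2 n = 0 := Nat.log_of_lt (by omega)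
    have h1 : (N : ℝ) ≤ 1 := by exact_mod_cast (by omega : N ≤ 1)
    have h2 : (N : ℝ) * Real.logb 2 N = 0 := by
      interval_cases N <;> simp
    rw [h0, h2]
    push_cast
    linarith
  · have hL := one_le_logb hN
    have h1 : (Nat.log 2 n : ℝ) ≤ Real.logb 2 N := by
      rcases Nat.eq_zero_or_pos n with rfl | h0
      · simp only [Nat.log_zero_right, Nat.cast_zero]; linarith
      · exact natLog_le_logb h0.ne' hn
    have hN' : (2 : ℝ) ≤ N := by exact_mod_cast hN
    have h2 : (3 * ((Nat.log 2 n : ℝ) + 1) + 1) * (N + m + 1) ≤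
        (7 * Real.logb 2 N) * (4 * N) := by
      refine mul_le_mul (by linarith) (by linarith) (by positivity) (by positivity)
    linarith

/-- Everything is a constant times `(N + 2) ^ 3`, and the constant is absorbed into the exponent by
`x ≤ 2 ^ x`. The number `96022` is `16 * 6000`, from the running time, plus `22` for the base
address and the additive constant. -/
lemma bounds_le {a n N m : ℕ} (hn : n ≤ N) (hm : m ≤ N + 1) :
    (bounds a N m (totalTime n N m)).B ≤ (N + 2) ^ (16 * a ^ 2 + 96025) := by
  have hlog : Nat.log 2 n ≤ N := (Nat.log_le_self _ _).trans hn
  have h1 : totalTime n N m ≤ 6000 * (N + 2) ^ 3 := by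
    unfold totalTime
    calc 1000 * (3 * (Nat.log 2 n + 1) + 1) * (N + m + 1)
        ≤ 1000 * (3 * (N + 2)) * (2 * (N + 2)) := by
          refine Nat.mul_le_mul (Nat.mul_le_mul_left _ ?_) ?_ <;> omega
      _ = 6000 * (N + 2) ^ 2 := by ring
      _ ≤ _ := Nat.mul_le_mul_left _ (Nat.pow_le_pow_right (by omega) (by norm_num))
  have h2 : 1 ≤ (N + 2) ^ 3 := Nat.one_le_pow _ _ (by omega)
  have h3 : N + 2 ≤ (N + 2) ^ 3 := Nat.le_self_pow (by norm_num) _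
  calc (bounds a N m (totalTime n N m)).B
      ≤ (16 * a ^ 2 + 96022) * (N + 2) ^ 3 := by
        unfold Par.B bounds
        simp only
        rw [add_mul, mul_assoc]
        omega
    _ ≤ (N + 2) ^ (16 * a ^ 2 + 96022) * (N + 2) ^ 3 := by
        refine Nat.mul_le_mul_right _ ?_
        exact Nat.lt_two_pow_self.le.trans (Nat.pow_le_pow_left (by omega) _)
    _ = _ := by rw [← pow_add]

/-- The failure probability of a round is small for this exponent. -/
lemma sq_mul_exp_le {c d : ℝ} (hc : 1 ≤ c) (hd : 2 ≤ d) {m : ℕ} (hn : 2 ≤ n)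
    (hm : (m : ℝ) ≤ c * (n : ℝ) ^ d) :
    (m : ℝ) ^ 2 * Real.exp (-((2 * c + 2 * d + 6) * Real.logb 2 n)) ≤
      1 / (3 * (3 * (Nat.log 2 n + 1))) := by
  have hL := one_le_logb hn
  have hlog : (Nat.log 2 n : ℝ) ≤ Real.logb 2 n := natLog_le_logb (by omega) le_rfl
  have hn0 : (0 : ℝ) < n := by exact_mod_cast (by omega : 0 < n)
  have h2 : (0 : ℝ) < 2 := by norm_num
  obtain ⟨L, hLeq⟩ : ∃ L, L = Real.logb 2 n := ⟨_, rfl⟩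
  rw [← hLeq] at hL hlog ⊢
  have hnL : (n : ℝ) = 2 ^ L := by rw [hLeq, Real.rpow_logb h2 (by norm_num) hn0]
  have h3 : (m : ℝ) ^ 2 ≤ 2 ^ (2 * (c + L * d)) := by
    rw [mul_comm, Real.rpow_mul h2.le, Real.rpow_two]
    refine pow_le_pow_left₀ (Nat.cast_nonneg _) (hm.trans ?_) 2
    rw [Real.rpow_add h2, hnL, ← Real.rpow_mul h2.le]
    exact mul_le_mul_of_nonneg_right (le_two_rpow hc) (by positivity)
  have h4 : 3 * (3 * ((Nat.log 2 n : ℝ) + 1)) ≤ 2 ^ (5 + L) := by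
    rw [Real.rpow_add h2]
    have h5 : (2 : ℝ) ^ (5 : ℝ) = 32 := by norm_num
    rw [h5]
    have := le_two_rpow hL
    linarith
  have h6 : (2 : ℝ) ^ ((2 * c + 2 * d + 6) * L) ≤ Real.exp ((2 * c + 2 * d + 6) * L) := by
    rw [← Real.exp_one_rpow]
    refine Real.rpow_le_rpow h2.le ?_ (by positivity)
    have := Real.add_one_le_exp 1
    linarith
  rw [Real.exp_neg, ← div_eq_mul_inv, div_le_div_iff₀ (Real.exp_pos _) (by positivity), one_mul]
  -- With `2 ≤ e` it suffices to compare exponents of `2`: the total `2c + 2dL + 5 + L` is at most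
  -- `(2c + 2d + 6) L` because `L ≥ 1`. This explains the factor of the logarithm in the exponent.
  calc (m : ℝ) ^ 2 * (3 * (3 * ((Nat.log 2 n : ℝ) + 1)))
      ≤ 2 ^ (2 * (c + L * d)) * 2 ^ (5 + L) := by gcongr
    _ = 2 ^ (2 * (c + L * d) + (5 + L)) := (Real.rpow_add h2 _ _).symm
    _ ≤ 2 ^ ((2 * c + 2 * d + 6) * L) :=
        Real.rpow_le_rpow_of_exponent_le (by norm_num) (by nlinarith)
    _ ≤ _ := h6

/-- The bound for the number of crossings. -/
lemma crossings_bound {d t : ℝ} (hd : 2 ≤ d) (ht : 1 ≤ t) {K θ : ℕ} (hn : 2 ≤ n)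
    (hθ : θ = ⌈t * Real.logb 2 n * (2 ^ (K + 3) * (n : ℝ) ^ (1 - 1 / d ^ 2))⌉₊) :
    ((3 * (Nat.log 2 n + 1) * (2 * θ) + 2 ^ (K + 2) : ℕ) : ℝ) ≤
      (24 * t * 2 ^ (K + 3) + 2 ^ (K + 2)) * (n : ℝ) ^ (1 - 1 / d ^ 2) * Real.logb 2 n ^ 2 := by
  have hL := one_le_logb hn
  have hlog : (Nat.log 2 n : ℝ) ≤ Real.logb 2 n := natLog_le_logb (by omega) le_rfl
  obtain ⟨L, hLeq⟩ : ∃ L, L = Real.logb 2 n := ⟨_, rfl⟩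
  rw [← hLeq] at hL hlog hθ ⊢
  obtain ⟨y, hy⟩ : ∃ y, y = (n : ℝ) ^ (1 - 1 / d ^ 2) := ⟨_, rfl⟩
  have hy1 : 1 ≤ y := by
    rw [hy]
    refine Real.one_le_rpow (by exact_mod_cast (by omega : 1 ≤ n)) ?_
    rw [sub_nonneg, div_le_one (by positivity)]
    nlinarith
  rw [← hy] at hθ ⊢
  have hK : (1 : ℝ) ≤ 2 ^ (K + 3) := one_le_pow₀ (by norm_num)
  have hx : 1 ≤ t * L * (2 ^ (K + 3) * y) :=
    one_le_mul_of_one_le_of_one_le (one_le_mul_of_one_le_of_one_le ht hL)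
      (one_le_mul_of_one_le_of_one_le hK hy1)
  -- The argument of the ceiling is at least `1`, so rounding up at most doubles it.
  have h1 : (θ : ℝ) ≤ 2 * (t * L * (2 ^ (K + 3) * y)) := by
    rw [hθ]
    have := (Nat.ceil_lt_add_one (zero_le_one.trans hx)).le
    linarith
  have h2 : 1 ≤ y * L ^ 2 := one_le_mul_of_one_le_of_one_le hy1 (one_le_pow₀ hL)
  push_cast
  calc 3 * ((Nat.log 2 n : ℝ) + 1) * (2 * θ) + 2 ^ (K + 2)
      ≤ (6 * L) * (2 * (2 * (t * L * (2 ^ (K + 3) * y)))) + 2 ^ (K + 2) * (y * L ^ 2) := by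
        refine add_le_add (mul_le_mul (by linarith) (by linarith) (by positivity) (by positivity))
          (le_mul_of_one_le_right (by positivity) h2)
    _ = _ := by ring

lemma two_thirds_le {α : Type*} (μ : PMF α) {A : Set α} (h : μ.toOuterMeasure Aᶜ ≤ 1 / 3) :
    2 / 3 ≤ μ.toOuterMeasure A := by
  have h1 : 1 ≤ μ.toOuterMeasure A + μ.toOuterMeasure Aᶜ := by
    rw [← (μ.toOuterMeasure_apply_eq_one_iff Set.univ).2 (Set.subset_univ _),
      ← Set.union_compl_self A]
    exact MeasureTheory.measure_union_le _ _
  have h3 : (1 : ENNReal) = 2 / 3 + 1 / 3 := by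
    rw [ENNReal.div_add_div_same, show (2 : ENNReal) + 1 = 3 by norm_num]
    exact (ENNReal.div_self (by norm_num) (by norm_num)).symm
  have h4 : (1 : ENNReal) / 3 ≠ ⊤ := ENNReal.div_ne_top (by norm_num) (by norm_num)
  have h2 := h1.trans (add_le_add_right h _)
  exact (ENNReal.add_le_add_iff_right h4).1 (h3.symm.le.trans h2)

end Welzl

/-- One program `P` for all parameters: on every set system whose primal and dual shatter functions
are at most `c k ^ d`, every run halts within `O(‖S‖ log ‖S‖)` steps and only uses numbers of
`O(log ‖S‖)` bits, and with probability at least `2 / 3` the output is a total order on `U` with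
crossing number `O(|U| ^ (1 - 1 / d ^ 2) log ^ 2 |U|)`. The implied constants depend on `c` and `d`
only. -/
theorem theorem3 :
    ∃ P : Welzl.Cmd, ∀ c d : ℝ, 1 ≤ c → 2 ≤ d →
      ∃ (w : ℕ) (C₁ C₂ : ℝ),
        ∀ (n : ℕ) (S : Welzl.SetSystem ℕ) (rows : List (List ℕ)),
          Welzl.IsListing rows n S →
          (∀ k : ℕ, 1 ≤ k → (S.shatter k : ℝ) ≤ c * (k : ℝ) ^ d) →
          (∀ k : ℕ, 1 ≤ k → (S.dual.shatter k : ℝ) ≤ c * (k : ℝ) ^ d) →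
          (∀ t : ℕ, ∀ x ∈ (Welzl.run t
              (Welzl.start P (Welzl.encode c d (S.size + 1) n rows))).support,
            ∀ i : ℕ, x.store.reg i ≤ (S.size + 2) ^ w ∧ x.store.mem i ≤ (S.size + 2) ^ w) ∧
          ∃ T : ℕ,
            (T : ℝ) ≤ C₁ * ((S.size : ℝ) * Real.logb 2 (S.size : ℝ) + 1) ∧
            (∀ x ∈ (Welzl.run T
                (Welzl.start P (Welzl.encode c d (S.size + 1) n rows))).support, x.Halted) ∧
            (2 / 3 : ENNReal) ≤ (Welzl.run T
                (Welzl.start P (Welzl.encode c d (S.size + 1) n rows))).toOuterMeasure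
              {x | S.IsOrder (x.store.output n) ∧
                (S.crossingNumber (x.store.output n) : ℝ) ≤
                  C₂ * (n : ℝ) ^ (1 - 1 / d ^ 2) * Real.logb 2 (n : ℝ) ^ 2} := by
  refine ⟨Welzl.welzlProgram, fun c d hc hd => ?_⟩
  obtain ⟨K, hK⟩ : ∃ K, K = (⌈d⌉₊ + 2) * (⌈c⌉₊ + 1) + 1 := ⟨_, rfl⟩
  refine ⟨16 * (⌈c⌉₊ + ⌈d⌉₊ + 5) ^ 2 + 96025, 28000,
    24 * (2 * c + 2 * d + 6) * 2 ^ (K + 3) + 2 ^ (K + 2), fun n S rows h hS hS' => ?_⟩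
  have hnN : n ≤ S.size := by rw [h.size]; exact Nat.le_add_right _ _
  have ht0 : 0 ≤ (2 * c + 2 * d + 6) * Real.logb 2 n := by
    refine mul_nonneg (by linarith) ?_
    rcases Nat.eq_zero_or_pos n with rfl | hn
    · simp
    · exact Real.logb_nonneg (by norm_num) (by exact_mod_cast hn)
  obtain ⟨D, hD, hok⟩ := Welzl.ok_start h hc hd hS hS' (K := K)
    (θ := ⌈(2 * c + 2 * d + 6) * Real.logb 2 n * (2 ^ (K + 3) * (n : ℝ) ^ (1 - 1 / d ^ 2))⌉₊) hK
    (fun hn => Welzl.sq_mul_exp_le hc hd hn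
      ((Nat.cast_le.2 h.length_le_shatter).trans (hS n (by omega)))) ht0
    fun _ => Nat.le_ceil _
  refine ⟨fun t x hx i => ?_, Welzl.totalTime n S.size rows.length,
    Welzl.totalTime_le hnN h.length_le, hok.halted, ?_⟩
  · have hb := Welzl.bounds_le (a := ⌈c⌉₊ + ⌈d⌉₊ + 5) hnN h.length_le
    have hx' := hok.bounded t x hx i
    exact ⟨hx'.1.trans hb, hx'.2.trans hb⟩
  · refine Welzl.two_thirds_le _ (le_trans (MeasureTheory.measure_mono ?_) hok.fail)
    intro x hx hx'
    refine hx ⟨h.isOrder hx'.1, ?_⟩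
    -- For `n < 2` the claimed bound vanishes with the logarithm, so the constant loss in `ok_start`
    -- is too weak; but a list of length at most one has no adjacent pairs.
    rcases Nat.lt_or_ge n 2 with hn | hn
    · have h0 : S.crossingNumber (x.store.output n) = 0 :=
        Nat.le_zero.1 (h.crossingNumber_le fun r _ => (Welzl.crossings_eq_zero
          (by rw [hx'.1.length_eq, List.length_range]; omega) _).le)
      have h1 : Real.logb 2 (n : ℝ) = 0 := by interval_cases n <;> simp
      rw [h0, h1]
      simp
    · have h1 := (h.crossingNumber_le hx'.2).trans hD
      exact (Nat.cast_le.2 h1).trans (Welzl.crossings_bound hd (by linarith) hn rfl)
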